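/- **Setting.** For sites $s=(n,m)\in\mathbb Z^2$ put $\Gamma_0=\{(0,0),(1,0),(0,1),(-1,1),(-1,0),(0,-1),(1,-1)\}$, so that $s+\Gamma_0$ consists of $s$ and its six nearest neighbours in the triangular lattice. Consider the system $$\ddot u_s=F_s\big(t,\{u_{s+\delta}\}_{\delta\in\Gamma_0}\big),\qquad s\in\mathbb Z^2, \tag{1}$$ where $t$ ranges over a nonempty open interval $I$, $u_s$ over a nonempty open interval $J_s$ (with $\bigcup_sJ_s$ an interval), and $F_s$ is smooth on an open subset $\Omega_s$ of $\{(t,\{u_{s+\delta}\}): t\in I,\ u_{s+\delta}\in J_{s+\delta}\}$ whose projection to $(t,u_s)$ is dense in $I\times J_s$. The interaction is *nonlinear and coupled* if, for every $s$, some $\partial^2F_s/\partial u_{s+\delta}\partial u_{s+\delta'}$ is not identically zero, and $\partial F_s/\partial u_{s+\delta}$ is not identically zero for every $\delta\in\Gamma_0$. It is *coupled at time $t_0$* if $\partial F_s/\partial u_{s+\delta}\neq0$ at some point of $\Omega_s$ with $t=t_0$, for some $s$ and some $\delta\ne(0,0)$. A *symmetry* is a vector field $X=\tau(t,u_s)\partial_t+\phi_s(t,u_s)\partial_{u_s}$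 (one smooth function $\tau$ and a family of smooth functions $\phi_s$) such that, for every $s$, $$\Big(\tau(t,u_s)\partial_t+\sum_{\delta\in\Gamma_0}\phi_{s+\delta}(t,u_{s+\delta})\partial_{u_{s+\delta}}+\phi_s^{tt}\partial_{\ddot u_s}\Big)(\ddot u_s-F_s)=0\quad\text{whenever }\ddot u_s=F_s,$$ with $\phi_s^{tt}=D_t^2\phi_s-(D_t^2\tau)\dot u_s-2(D_t\tau)\ddot u_s$ and $D_t$ the total time derivative. A *symmetry algebra* is a Lie algebra of symmetries under the Lie bracket of vector fields. An *allowed transformation* is a change of variables $t\mapsto\tilde t(t)$, $u_s=\dot{\tilde t}^{-1/2}P_s\tilde u_s+Q_s(t)$ with $\tilde t,Q_s$ smooth, $\dot{\tilde t}>0$, and constants $P_s\ne0$, over an open interval of times; it turns (1) into $d^2\tilde u_s/d\tilde t^2=\tilde F_s$ with $$\tilde F_s=\dot{\tilde t}^{-3/2}P_s^{-1}(F_s-\ddot Q_s)+\tfrac12\dot{\tilde t}^{-3}\big(\dddot{\tilde t}-\tfrac32\dot{\tilde t}^{-1}\ddot{\tilde t}^{\,2}\big)\tilde u_s .$$ Let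 $X_1=\partial_t,\quad X_2=t\partial_t+\tfrac12u_s\partial_{u_s},\quad X_3=t^2\partial_t+tu_s\partial_{u_s}.$ **Theorem.** The Lie algebra $\mathrm{sl}(2,\mathbb R)$ is simple, and the following hold. 1. Let the interaction in (1) be nonlinear and coupled, and let $\mathfrak g$ be a finite-dimensional simple real Lie algebra realized faithfully as a symmetry algebra of (1). Then $\mathfrak g\cong\mathrm{sl}(2,\mathbb R)$. Moreover, for every time $t_0$ at which the interaction is coupled there are an allowed transformation over an open interval containing $t_0$ (contained in $I$) and a basis $e_1,e_2,e_3$ of $\mathfrak g$ with $[e_1,e_2]=e_1$, $[e_1,e_3]=2e_2$, $[e_2,e_3]=e_3$, such that the transformation carries the vector fields of $e_1,e_2,e_3$ to $X_1,X_2,X_3$ (written in $\tilde t,\tilde u_s$), and near every point of $\Omega_s$ with time in that interval and with $\tilde u_s\neq0$ one has $$\tilde F_s=\tilde u_s^{-3}f\big(\{\tilde u_{s+\delta}/\tilde u_s\}_{\delta\in\Gamma_0\setminus\{(0,0)\}}\big)$$ with some smooth function $f$ (depending on $s$ and on the point). 2. Conversely, whenever $u_s\ne0$ and $F_s=u_s^{-3}f_s(\{u_{s+\delta}/u_s\}_{\delta\ne(0,0)})$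 on $\Omega_s$ for every $s$, the fields $X_1,X_2,X_3$ are a basis of a symmetry algebra of (1) isomorphic to $\mathrm{sl}(2,\mathbb R)$, with $[X_1,X_2]=X_1$, $[X_1,X_3]=2X_2$, $[X_2,X_3]=X_3$. 3. There is a smooth function $f$ on $(0,\infty)^6$, invariant under all permutations of its six variables, such that for $I=\mathbb R$, $J_s=(0,\infty)$ and $F_s=u_s^{-3}f(\{u_{s+\delta}/u_s\}_{\delta\neq(0,0)})$ on $\Omega_s=\{u_{s+\delta}>0\text{ for all }\delta\in\Gamma_0\}$, for all $s$, the interaction is nonlinear and coupled and the symmetries of (1) are exactly the real linear combinations of $X_1,X_2,X_3$. -/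

import Mathlib

open scoped ContDiff

noncomputable section

namespace TriLattice

/-- A site `(n, m)` of the two-dimensional triangular lattice. -/
abbrev Site : Type := ℤ × ℤ

/-- The offsets of the points of `Γ` relative to `(n, m)`: the point itself and its
six nearest neighbours. -/
def stencil : Finset (ℤ × ℤ) :=
  {(0, 0), (1, 0), (0, 1), (-1, 1), (-1, 0), (0, -1), (1, -1)}

/-- Index type of the variables `u_{pq}`, `(p, q) ∈ Γ`; the offset `δ` at the site `s`
stands for the site `s + δ`. -/
abbrev Stencil : Type := {δ : ℤ × ℤ // δ ∈ stencil}

/-- The offset of the point `(n, m)` itself. -/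
def origin : Stencil := ⟨(0, 0), by simp [stencil]⟩

/-- Index type of the six nearest neighbours, `(p, q) ∈ Γ \ {(n, m)}`. -/
abbrev Neighbour : Type := {δ : Stencil // δ ≠ origin}

/-- A system `ü_s = F_s(t, {u_{s+δ}}_δ)` on the lattice. Time runs in an open interval `I`,
the variable `u_s` takes values in an open interval `J s`, and `F_s` is smooth on an open set
`Ω s` of points `(t, {u_{s+δ}}_δ)` which lies in the resulting box and whose projection to the
variables `(t, u_s)` is dense in `I × J s` (so `F_s` may be singular, for instance at `u_s = 0`).
The intervals `J s` overlap to a single interval: the coefficient `τ(t, u_s)` of a symmetry is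
one and the same function for all sites. -/
structure LatticeSystem where
  I : Set ℝ
  J : Site → Set ℝ
  Ω : Site → Set (ℝ × (Stencil → ℝ))
  F : Site → ℝ × (Stencil → ℝ) → ℝ
  isOpen_I : IsOpen I
  ordConnected_I : I.OrdConnected
  nonempty_I : I.Nonempty
  isOpen_J : ∀ s, IsOpen (J s)
  ordConnected_J : ∀ s, (J s).OrdConnected
  nonempty_J : ∀ s, (J s).Nonempty
  ordConnected_iUnion_J : (⋃ s, J s).OrdConnected
  isOpen_Ω : ∀ s, IsOpen (Ω s)
  mem_box : ∀ s, ∀ q ∈ Ω s, q.1 ∈ I ∧ ∀ δ : Stencil, q.2 δ ∈ J (s + δ)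
  dense_proj : ∀ s, I ×ˢ J s ⊆ closure ((fun q => (q.1, q.2 origin)) '' Ω s)
  smooth_F : ∀ s, ContDiffOn ℝ ∞ (F s) (Ω s)

/-- `∂g/∂t` for a function `g` of `(t, {u_δ})`. -/
def partialT (g : ℝ × (Stencil → ℝ) → ℝ) (q : ℝ × (Stencil → ℝ)) : ℝ :=
  fderiv ℝ g q (1, 0)

/-- `∂g/∂u_δ` for a function `g` of `(t, {u_δ})`. -/
def partialU (δ : Stencil) (g : ℝ × (Stencil → ℝ) → ℝ) (q : ℝ × (Stencil → ℝ)) : ℝ :=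
  fderiv ℝ g q (0, Pi.single δ 1)

/-- The interaction is nonlinear and coupled: at each site some second derivative
`∂²F/∂u_{pq}∂u_{p'q'}` does not vanish identically, and no first derivative `∂F/∂u_{pq}`
vanishes identically. -/
def LatticeSystem.IsNonlinearCoupled (S : LatticeSystem) : Prop :=
  (∀ s, ∃ δ δ' : Stencil, ∃ q ∈ S.Ω s, partialU δ (partialU δ' (S.F s)) q ≠ 0) ∧
  (∀ s, ∀ δ : Stencil, ∃ q ∈ S.Ω s, partialU δ (S.F s) q ≠ 0)

/-- At the time `t`, the interaction at some site does depend on one of its neighbours. -/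
def LatticeSystem.CoupledAt (S : LatticeSystem) (t : ℝ) : Prop :=
  ∃ s, ∃ δ : Neighbour, ∃ u, (t, u) ∈ S.Ω s ∧ partialU δ (S.F s) (t, u) ≠ 0

/-- A vector field `τ(t, u_s) ∂_t + φ_s(t, u_s) ∂_{u_s}`: the function `τ` and the family `φ`. -/
abbrev PointField : Type := (ℝ × ℝ → ℝ) × (Site → ℝ × ℝ → ℝ)

/-- The vector field in the `(t, u_s)`-plane at the site `s`. -/
def PointField.at (X : PointField) (s : Site) (p : ℝ × ℝ) : ℝ × ℝ := (X.1 p, X.2 s p)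

/-- The coefficients are smooth on the domain of the system. -/
def PointField.IsSmoothOn (X : PointField) (S : LatticeSystem) : Prop :=
  ContDiffOn ℝ ∞ X.1 (S.I ×ˢ ⋃ s, S.J s) ∧ ∀ s, ContDiffOn ℝ ∞ (X.2 s) (S.I ×ˢ S.J s)

/-- Total time derivative `D_t g = g_t + u̇ g_u` of a function `g(t, u)`, at `(t, u, u̇)`. -/
def totalDeriv (g : ℝ × ℝ → ℝ) (j : ℝ × ℝ × ℝ) : ℝ :=
  fderiv ℝ g (j.1, j.2.1) (1, j.2.2)

/-- `D_t² g`: the total time derivative `h_t + u̇ h_u + ü h_u̇` of the function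
`h(t, u, u̇) = D_t g`. -/
def totalDeriv₂ (g : ℝ × ℝ → ℝ) (j : ℝ × ℝ × ℝ) (w : ℝ) : ℝ :=
  fderiv ℝ (totalDeriv g) j (1, j.2.2, w)

/-- The coefficient `φ_s^{tt} = D_t² φ_s - (D_t² τ) u̇_s - 2 (D_t τ) ü_s` at
`(t, u_s, u̇_s) = j` and `ü_s = w`. -/
def PointField.phiTT (X : PointField) (s : Site) (j : ℝ × ℝ × ℝ) (w : ℝ) : ℝ :=
  totalDeriv₂ (X.2 s) j w - totalDeriv₂ X.1 j w * j.2.2 - 2 * totalDeriv X.1 j * w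

/-- The second prolongation of `X`, that is
`τ(t, u_s) ∂_t + ∑_δ φ_{s+δ}(t, u_{s+δ}) ∂_{u_{s+δ}} + φ_s^{tt} ∂_{ü_s}`, applied to
`Δ_s = ü_s - F_s(t, {u_{s+δ}})`, at `(t, {u_{s+δ}}) = q`, `u̇_s = v`, `ü_s = w`. -/
def PointField.prolongationDelta (X : PointField) (S : LatticeSystem) (s : Site)
    (q : ℝ × (Stencil → ℝ)) (v w : ℝ) : ℝ :=
  X.phiTT s (q.1, q.2 origin, v) w
    - X.1 (q.1, q.2 origin) * partialT (S.F s) q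
    - ∑ δ : Stencil, X.2 (s + δ) (q.1, q.2 δ) * partialU δ (S.F s) q

/-- `X` is a (smooth) Lie point symmetry: its second prolongation annihilates `Δ_s` on
`Δ_s = 0`, for every site `s`. -/
def LatticeSystem.IsSymmetry (S : LatticeSystem) (X : PointField) : Prop :=
  X.IsSmoothOn S ∧
  ∀ s, ∀ q ∈ S.Ω s, ∀ v w : ℝ, w - S.F s q = 0 → X.prolongationDelta S s q v w = 0

/-- The linear map `ρ` realizes the Lie algebra `𝔤` faithfully by symmetries of the system, the
bracket being the Lie bracket of vector fields: `ρ` identifies `𝔤` with a Lie algebra of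
symmetries. (Values of the fields outside the domain of the system play no role.) -/
structure LatticeSystem.IsSymmetryAlgebra (S : LatticeSystem) {𝔤 : Type*} [LieRing 𝔤]
    [LieAlgebra ℝ 𝔤] (ρ : 𝔤 →ₗ[ℝ] PointField) : Prop where
  isSymmetry : ∀ x, S.IsSymmetry (ρ x)
  map_lie : ∀ x y, ∀ s, ∀ p ∈ S.I ×ˢ S.J s,
    (ρ ⁅x, y⁆).at s p = VectorField.lieBracket ℝ ((ρ x).at s) ((ρ y).at s) p
  faithful : ∀ x, (∀ s, ∀ p ∈ S.I ×ˢ S.J s, (ρ x).at s p = 0) → x = 0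

/-- An allowed (fibre preserving) transformation `(t, u_s) ↦ (t̃, ũ_s)`, given by `t̃ = t̃(t)` and
`u_s = (dt̃/dt)^{-1/2} P_s ũ_s + Q_s(t)`, over an open interval `dom` of times. -/
structure AllowedTransformation where
  dom : Set ℝ
  T : ℝ → ℝ
  P : Site → ℝ
  Q : Site → ℝ → ℝ
  isOpen_dom : IsOpen dom
  ordConnected_dom : dom.OrdConnected
  smooth_T : ContDiffOn ℝ ∞ T dom
  deriv_T_pos : ∀ t ∈ dom, 0 < deriv T t
  P_ne_zero : ∀ s, P s ≠ 0
  smooth_Q : ∀ s, ContDiffOn ℝ ∞ (Q s) dom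

/-- The new coordinates `(t̃, ũ_s)` of the point `(t, u_s)`. -/
def AllowedTransformation.map (A : AllowedTransformation) (s : Site) (p : ℝ × ℝ) : ℝ × ℝ :=
  (A.T p.1, (deriv A.T p.1) ^ (1 / 2 : ℝ) * (A.P s)⁻¹ * (p.2 - A.Q s p.1))

/-- The new variables `{ũ_{s+δ}}_δ` at the point `(t, {u_{s+δ}}_δ) = q`. -/
def AllowedTransformation.newU (A : AllowedTransformation) (s : Site)
    (q : ℝ × (Stencil → ℝ)) (δ : Stencil) : ℝ :=
  (A.map (s + δ) (q.1, q.2 δ)).2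

/-- The right-hand side `F̃_s` of the transformed equation `d²ũ_s/dt̃² = F̃_s`, as a function of
the old variables `(t, {u_{s+δ}}_δ) = q`. -/
def AllowedTransformation.newF (A : AllowedTransformation) (S : LatticeSystem) (s : Site)
    (q : ℝ × (Stencil → ℝ)) : ℝ :=
  (deriv A.T q.1) ^ (-(3 / 2) : ℝ) * (A.P s)⁻¹ * (S.F s q - iteratedDeriv 2 (A.Q s) q.1)
    + 1 / 2 * (deriv A.T q.1) ^ (-3 : ℤ)
      * (iteratedDeriv 3 A.T q.1
          - 3 / 2 * (deriv A.T q.1)⁻¹ * (iteratedDeriv 2 A.T q.1) ^ 2)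
      * A.newU s q origin

/-- `X₁ = ∂_t`, `X₂ = t ∂_t + ½ u_s ∂_{u_s}`, `X₃ = t² ∂_t + t u_s ∂_{u_s}`. -/
def canonicalField : Fin 3 → PointField :=
  ![(fun _ => 1, fun _ _ => 0),
    (fun p => p.1, fun _ p => 1 / 2 * p.2),
    (fun p => p.1 ^ 2, fun _ p => p.1 * p.2)]

/-- The invariants `ξ_{pq} = u_{pq} / u_{nm}`, `(p, q) ∈ Γ \ {(n, m)}`. -/
def ratios (u : Stencil → ℝ) (δ : Neighbour) : ℝ := u δ / u origin

/-- The elements `e₁, e₂, e₃` satisfy `[e₁, e₂] = e₁`, `[e₁, e₃] = 2 e₂`, `[e₂, e₃] = e₃`. -/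
def HasCanonicalBrackets {𝔤 : Type*} [LieRing 𝔤] [LieAlgebra ℝ 𝔤] (e : Fin 3 → 𝔤) : Prop :=
  ⁅e 0, e 1⁆ = e 0 ∧ ⁅e 0, e 2⁆ = (2 : ℝ) • e 1 ∧ ⁅e 1, e 2⁆ = e 2

/-- The Lie algebra `sl(2, ℝ)`. -/
abbrev SL2 : Type := LieAlgebra.SpecialLinear.sl (Fin 2) ℝ

end TriLattice

end

/-! On `ü = F` the velocity is free, so the symmetry condition is a cubic polynomial identity in it
with four vanishing coefficients (`IsSymmetry.determining`). In the coefficient linear in the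
velocity only the term `3 F τ_u` sees the neighbours; hence `τ_u = 0` at coupled times. Over an
interval of such times the other coefficients give `X = b(t) ∂_t + ((b'/2 + A_s) u_s + β_s(t))
∂_{u_s}` (`IsSymmetry.exists_localForm`). A bracket of two such fields has `A = 0`, and a simple
algebra is spanned by its brackets, so `A = 0` for all its fields. Thus `x ↦ b` is a homomorphism to
vector fields on the line.

This homomorphism is studied through Taylor series at `t₀`, which loses nothing essential. If all
`b'` vanished at `t₀`, then all `b` would vanish near `t₀`: each field is a combination of brackets,
hence bounded by (size of the fields) times (size of their derivatives), and the second factor is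
small (`eventually_eq_zero_of_fderiv_eq_zero`). The fields would then be `β_s(t) ∂_{u_s}`, which
commute, so by simplicity they would vanish near `t₀`, and by unique continuation everywhere,
contradicting faithfulness. A simple finite-dimensional algebra of formal vector fields on the line
is filtered by order of vanishing, and comparing orders of brackets leaves exactly the orders 0, 1,
2 (`exists_canonicalBasis`); this is `sl(2, ℝ)`.

The coefficient `b` of the first basis field is positive near `t₀`. New time is the ratio of the
first two `∂_t` coefficients, and the shift `Q_s` is read off the zero of the vertical combination
of the same two fields (`canonicalData_of_localForm`). The bracket relations then put all three
fields in canonical form. Invariance under translation of time and dilation alone makes `ũ_s³ F̃_s`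
locally constant along curves with fixed ratios, hence a function of the ratios
(`exists_canonical_rhs`).

Conversely, time independence and homogeneity of degree -3 are exactly what the three fields need.
For the last claim `f` is the sum of the ratios, so `F_s = u_s⁻⁴ ∑ u_{s+δ}`: the determining
equation is affine in the neighbours, and its coefficients kill `A`, `β` and `b'''`. -/

open scoped ContDiff

noncomputable section

namespace TriLattice

/-! ### The algebra `sl(2, ℝ)` and its canonical basis. -/

section CanonicalBrackets

variable {𝔤 : Type*} [LieRing 𝔤] [LieAlgebra ℝ 𝔤]

/-- The Lie bracket in coordinates with respect to a basis with the canonical brackets. -/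
theorem HasCanonicalBrackets.lie_eq {e : Fin 3 → 𝔤} (h : HasCanonicalBrackets e)
    (a b : Fin 3 → ℝ) :
    ⁅∑ i, a i • e i, ∑ i, b i • e i⁆ =
      (a 0 * b 1 - a 1 * b 0) • e 0 + (2 * (a 0 * b 2 - a 2 * b 0)) • e 1
        + (a 1 * b 2 - a 2 * b 1) • e 2 := by
  obtain ⟨h1, h2, h3⟩ := h
  have h1' : ⁅e 1, e 0⁆ = -e 0 := by rw [← lie_skew, h1]
  have h2' : ⁅e 2, e 0⁆ = -((2 : ℝ) • e 1) := by rw [← lie_skew, h2]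
  have h3' : ⁅e 2, e 1⁆ = -e 2 := by rw [← lie_skew, h3]
  simp only [Fin.sum_univ_three, add_lie, lie_add, smul_lie, lie_smul, lie_self, h1, h2, h3,
    h1', h2', h3']
  module

/-- The operator `ad (e 0)` is nilpotent and lowers `e 2` to `e 1` to `e 0`, up to nonzero factors.
Applied at most twice to a nonzero element of an ideal, it produces a nonzero multiple of `e 0`, and
brackets with `e 2` then recover `e 1` and `e 2`. -/
theorem HasCanonicalBrackets.isSimple (e : Module.Basis (Fin 3) ℝ 𝔤)
    (h : HasCanonicalBrackets e) : LieAlgebra.IsSimple ℝ 𝔤 := by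
  obtain ⟨h1, h2, h3⟩ := id h
  refine ⟨fun I => ?_, fun hab => ?_⟩
  · have key : e 0 ∈ I → I = ⊤ := by
      intro h0
      have m1 : e 1 ∈ I := by
        have := lie_mem_left ℝ 𝔤 I (e 0) (e 2) h0
        rw [h2] at this
        exact (Submodule.smul_mem_iff I.toSubmodule (two_ne_zero (α := ℝ))).1 this
      have m2 : e 2 ∈ I := by
        have := lie_mem_left ℝ 𝔤 I (e 1) (e 2) m1
        rwa [h3] at this
      rw [eq_top_iff]
      intro x _
      rw [← e.sum_repr x, Fin.sum_univ_three]
      exact add_mem (add_mem (I.smul_mem _ h0) (I.smul_mem _ m1)) (I.smul_mem _ m2)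
    by_cases hI : I = ⊥
    · exact Or.inl hI
    refine Or.inr (key ?_)
    obtain ⟨x, hx, hx0⟩ := (Submodule.ne_bot_iff I.toSubmodule).1
      (fun h => hI ((LieSubmodule.toSubmodule_eq_bot I).1 h))
    have e0 : e 0 = ∑ i, (![1, 0, 0] : Fin 3 → ℝ) i • e i := by simp [Fin.sum_univ_three]
    obtain ⟨a, rfl⟩ : ∃ a : Fin 3 → ℝ, x = ∑ i, a i • e i := ⟨e.repr x, (e.sum_repr x).symm⟩
    have b1 : ⁅e 0, ∑ i, a i • e i⁆ = a 1 • e 0 + (2 * a 2) • e 1 := by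
      conv_lhs => rw [e0]
      rw [h.lie_eq]; simp
    have b2 : ⁅e 0, ⁅e 0, ∑ i, a i • e i⁆⁆ = (2 * a 2) • e 0 := by
      rw [b1, lie_add, lie_smul, lie_smul, lie_self, h1]; simp
    have m1 : a 1 • e 0 + (2 * a 2) • e 1 ∈ I := b1 ▸ lie_mem_right ℝ 𝔤 I _ _ hx
    have m2 : (2 * a 2) • e 0 ∈ I :=
      b2 ▸ lie_mem_right ℝ 𝔤 I _ _ (lie_mem_right ℝ 𝔤 I _ _ hx)
    by_cases c2 : a 2 = 0
    · by_cases c1 : a 1 = 0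
      · have : a 0 ≠ 0 := by
          rintro c0
          apply hx0
          simp [Fin.sum_univ_three, c0, c1, c2]
        refine (Submodule.smul_mem_iff I.toSubmodule this).1 ?_
        simpa [Fin.sum_univ_three, c1, c2] using hx
      · refine (Submodule.smul_mem_iff I.toSubmodule c1).1 ?_
        simpa [c2] using m1
    · exact (Submodule.smul_mem_iff I.toSubmodule (mul_ne_zero two_ne_zero c2)).1 m2
  · have := hab.trivial (e 0) (e 1)
    rw [h1] at this
    exact e.ne_zero 0 this

/-- Two Lie algebras with bases with the canonical brackets are isomorphic. -/
def HasCanonicalBrackets.equiv {𝔥 : Type*} [LieRing 𝔥] [LieAlgebra ℝ 𝔥]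
    (e : Module.Basis (Fin 3) ℝ 𝔤) (h : HasCanonicalBrackets e)
    (e' : Module.Basis (Fin 3) ℝ 𝔥) (h' : HasCanonicalBrackets e') : 𝔤 ≃ₗ⁅ℝ⁆ 𝔥 :=
  { e.equiv e' (Equiv.refl _) with
    map_lie' := by
      intro x y
      have hsum : ∀ c : Fin 3 → ℝ,
          (e.equiv e' (Equiv.refl _)) (∑ i, c i • e i) = ∑ i, c i • e' i := by
        intro c; simp [map_sum]
      have hx := e.sum_repr x
      have hy := e.sum_repr y
      rw [← hx, ← hy, h.lie_eq]
      simp only [AddHom.toFun_eq_coe, LinearMap.coe_toAddHom, LinearEquiv.coe_coe, hsum, h'.lie_eq]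
      simp }

end CanonicalBrackets

theorem SL2.mem_iff (M : Matrix (Fin 2) (Fin 2) ℝ) :
    M ∈ LieAlgebra.SpecialLinear.sl (Fin 2) ℝ ↔ M 0 0 + M 1 1 = 0 := by
  rw [← Matrix.trace_fin_two]; rfl

/-- The linear isomorphism `sl(2, ℝ) ≃ ℝ³` which sends `E, -H/2, -F` to the standard basis. -/
def sl2Coord : SL2 ≃ₗ[ℝ] (Fin 3 → ℝ) where
  toFun x := ![x.val 0 1, -2 * x.val 0 0, -x.val 1 0]
  map_add' x y := by ext i; fin_cases i <;> simp <;> ring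
  map_smul' c x := by ext i; fin_cases i <;> simp; ring
  invFun a := ⟨!![-a 1 / 2, a 0; -a 2, a 1 / 2], by
    rw [SL2.mem_iff]; simp; ring⟩
  left_inv x := by
    have hx := (SL2.mem_iff _).1 x.property
    apply Subtype.ext
    ext i j
    fin_cases i <;> fin_cases j <;> simp
    linarith
  right_inv a := by
    ext i; fin_cases i <;> simp
    ring

theorem sl2Coord_lie (x y : SL2) : sl2Coord ⁅x, y⁆ =
    ![sl2Coord x 0 * sl2Coord y 1 - sl2Coord x 1 * sl2Coord y 0,
      2 * (sl2Coord x 0 * sl2Coord y 2 - sl2Coord x 2 * sl2Coord y 0),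
      sl2Coord x 1 * sl2Coord y 2 - sl2Coord x 2 * sl2Coord y 1] := by
  have hx := (SL2.mem_iff _).1 x.property
  have hy := (SL2.mem_iff _).1 y.property
  have h : ∀ i j, (⁅x, y⁆ : SL2).val i j = x.val i 0 * y.val 0 j + x.val i 1 * y.val 1 j
      - (y.val i 0 * x.val 0 j + y.val i 1 * x.val 1 j) := by
    intro i j
    rw [LieAlgebra.SpecialLinear.sl_bracket]
    simp [Matrix.mul_apply, Fin.sum_univ_two]
  have hx1 : x.val 1 1 = -x.val 0 0 := by linarith
  have hy1 : y.val 1 1 = -y.val 0 0 := by linarith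
  ext i
  fin_cases i <;> simp only [sl2Coord, LinearEquiv.coe_mk, LinearMap.coe_mk, AddHom.coe_mk, h] <;>
    simp [hx1, hy1] <;> ring

/-- The basis `E, -H/2, -F` of `sl(2, ℝ)`. -/
def sl2Basis : Module.Basis (Fin 3) ℝ SL2 := Module.Basis.ofEquivFun sl2Coord

theorem sl2Basis_hasCanonicalBrackets : HasCanonicalBrackets sl2Basis := by
  have hb : ∀ i, sl2Coord (sl2Basis i) = Pi.single i 1 := fun i => by simp [sl2Basis]
  refine ⟨?_, ?_, ?_⟩ <;> apply sl2Coord.injective <;> rw [sl2Coord_lie] <;>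
    simp only [map_smul, hb] <;> ext i <;> fin_cases i <;> simp

/-! ### Simple Lie algebras of formal vector fields on the line. -/

section FormalVectorFields

variable {𝔤 : Type*} [LieRing 𝔤] [LieAlgebra ℝ 𝔤]

/-- The brackets span an ideal, which is nonzero because the algebra is not abelian. Properties that
define a subspace therefore need checking only on brackets; most later uses of simplicity take this
form. -/
theorem span_lie_eq_top [LieAlgebra.IsSimple ℝ 𝔤] :
    Submodule.span ℝ {z : 𝔤 | ∃ x y : 𝔤, ⁅x, y⁆ = z} = ⊤ := by
  have h := LieSubmodule.lieIdeal_oper_eq_linear_span' (R := ℝ) (L := 𝔤) (M := 𝔤)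
    (I := ⊤) (N := ⊤)
  rcases LieAlgebra.IsSimple.eq_bot_or_eq_top (R := ℝ) (⁅(⊤ : LieIdeal ℝ 𝔤), (⊤ : LieIdeal ℝ 𝔤)⁆)
    with h0 | h0
  · exfalso
    apply LieAlgebra.IsSimple.non_abelian ℝ (L := 𝔤)
    refine ⟨fun x y => ?_⟩
    have : ⁅x, y⁆ ∈ (⁅(⊤ : LieIdeal ℝ 𝔤), (⊤ : LieIdeal ℝ 𝔤)⁆ : LieIdeal ℝ 𝔤) :=
      LieSubmodule.lie_mem_lie (LieSubmodule.mem_top x) (LieSubmodule.mem_top y)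
    rw [h0] at this
    simpa using this
  · rw [h0] at h
    simpa using h.symm

/-- A linear map which vanishes on brackets vanishes on a simple Lie algebra. -/
theorem linearMap_eq_zero_of_lie [LieAlgebra.IsSimple ℝ 𝔤] {M : Type*} [AddCommGroup M]
    [Module ℝ M] (f : 𝔤 →ₗ[ℝ] M) (h : ∀ x y : 𝔤, f ⁅x, y⁆ = 0) (x : 𝔤) : f x = 0 := by
  have : Submodule.span ℝ {z : 𝔤 | ∃ x y : 𝔤, ⁅x, y⁆ = z} ≤ LinearMap.ker f := by
    rw [Submodule.span_le]
    rintro _ ⟨x, y, rfl⟩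
    exact h x y
  rw [span_lie_eq_top] at this
  exact this (Submodule.mem_top)

open PowerSeries in
-- This is `[t^m ∂, t^n ∂] = (n - m) t^(m+n-1) ∂` at the level of leading terms: orders at least `m`
-- and `n` give order at least `m + n - 1`, with the displayed coefficient there.
theorem coeff_wronskian {f g : ℝ⟦X⟧} {m n k : ℕ} (hf : ∀ j < m, coeff j f = 0)
    (hg : ∀ j < n, coeff j g = 0) (hk : k < m + n) :
    coeff k (f * derivative ℝ g - g * derivative ℝ f) =
      if k + 1 = m + n then ((n : ℝ) - m) * (coeff m f * coeff n g) else 0 := by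
  obtain ⟨f', rfl⟩ := X_pow_dvd_iff.2 hf
  obtain ⟨g', rfl⟩ := X_pow_dvd_iff.2 hg
  -- The Euler operator `X d/dX` preserves the factor `X ^ l`, so multiplying by `X` avoids the
  -- exponent `l - 1`, which is truncated at `l = 0`.
  have hd : ∀ (l : ℕ) (h : ℝ⟦X⟧), X * derivative ℝ (X ^ l * h)
      = X ^ l * ((l : ℝ⟦X⟧) * h + X * derivative ℝ h) := by
    intro l h
    rw [Derivation.leibniz, derivative_pow, derivative_X]
    rcases l with _ | l
    · simp
    · simp only [smul_eq_mul, Nat.add_sub_cancel]; push_cast; ring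
  have key : X * (X ^ m * f' * derivative ℝ (X ^ n * g') - X ^ n * g' * derivative ℝ (X ^ m * f'))
      = X ^ (m + n) * (((n : ℝ⟦X⟧) - (m : ℝ⟦X⟧)) * (f' * g')
        + X * (f' * derivative ℝ g' - g' * derivative ℝ f')) := by
    linear_combination (X ^ m * f') * hd n g' - (X ^ n * g') * hd m f'
  have hc := congrArg (coeff (k + 1)) key
  rw [coeff_succ_X_mul, coeff_X_pow_mul'] at hc
  rw [hc, coeff_X_pow_mul', coeff_X_pow_mul']
  by_cases h : k + 1 = m + n
  · rw [if_pos h.ge, if_pos h, if_pos le_rfl, if_pos le_rfl, h]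
    have : ((n : ℝ⟦X⟧) - (m : ℝ⟦X⟧)) = C ((n : ℝ) - m) := by simp
    rw [this]
    simp
  · rw [if_neg (by omega), if_neg h]

open PowerSeries in
/-- **Lie's theorem on the line**, formally: a simple finite-dimensional Lie algebra of formal
vector fields on the line is `sl(2, ℝ)`, spanned by `1 + …`, `t + …` and `t² + …`. -/
theorem exists_canonicalBasis [FiniteDimensional ℝ 𝔤] [LieAlgebra.IsSimple ℝ 𝔤]
    (T : 𝔤 →ₗ[ℝ] ℝ⟦X⟧) (hT : ∀ x y, T ⁅x, y⁆ = T x * derivative ℝ (T y) - T y * derivative ℝ (T x))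
    (hne : ∃ x, coeff 1 (T x) ≠ 0) :
    ∃ e : Module.Basis (Fin 3) ℝ 𝔤, HasCanonicalBrackets e ∧ coeff 0 (T (e 0)) = 1 := by
  -- The kernel of `T` is an ideal, and `hne` excludes that it is everything.
  have hinj : ∀ x, T x = 0 → x = 0 := by
    let I : LieIdeal ℝ 𝔤 :=
      { LinearMap.ker T with
        lie_mem := by
          intro x m hm
          have hm : T m = 0 := hm
          show T ⁅x, m⁆ = 0
          rw [hT, hm]; simp }
    have hI : ∀ x, x ∈ I ↔ T x = 0 := fun x => Iff.rfl
    rcases LieAlgebra.IsSimple.eq_bot_or_eq_top (R := ℝ) I with h | h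
    · intro x hx
      have := (hI x).2 hx
      rw [h] at this
      simpa using this
    · exfalso
      obtain ⟨x, hx⟩ := hne
      have := (hI x).1 (h ▸ LieSubmodule.mem_top x)
      simp [this] at hx
  -- an element of order zero
  obtain ⟨x₀, hx₀⟩ : ∃ x, coeff 0 (T x) ≠ 0 := by
    -- If all series vanish at order zero, the linear coefficient of a bracket carries the factor `1
    -- - 1`, so the linear coefficient is a functional that kills all brackets.
    by_contra! h0
    obtain ⟨x, hx⟩ := hne
    refine hx (linearMap_eq_zero_of_lie ((coeff (R := ℝ) 1).comp T) (fun y z => ?_) x)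
    have := coeff_wronskian (m := 1) (n := 1) (k := 1) (f := T y) (g := T z)
      (by intro j hj; interval_cases j; exact h0 y) (by intro j hj; interval_cases j; exact h0 z)
      (by norm_num)
    simpa [hT] using this
  obtain ⟨f₀, hf₀⟩ : ∃ x, coeff 0 (T x) = 1 :=
    ⟨(coeff 0 (T x₀))⁻¹ • x₀, by rw [map_smul, coeff_smul, smul_eq_mul, inv_mul_cancel₀ hx₀]⟩
  -- brackets with `f₀` lower the order by one
  have hlow : ∀ (n : ℕ) (y : 𝔤), (∀ j < n + 1, coeff j (T y) = 0) →
      (∀ j < n, coeff j (T ⁅f₀, y⁆) = 0) ∧ coeff n (T ⁅f₀, y⁆) = (n + 1) * coeff (n + 1) (T y) := by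
    intro n y hy
    refine ⟨fun j hj => ?_, ?_⟩
    · rw [hT, coeff_wronskian (m := 0) (n := n + 1) (by simp) hy (by omega), if_neg (by omega)]
    · rw [hT, coeff_wronskian (m := 0) (n := n + 1) (by simp) hy (by omega), if_pos (by omega), hf₀]
      push_cast; ring
  -- `K n` collects the elements of order at least `n`.
  let K : ℕ → Submodule ℝ 𝔤 := fun n => ⨅ j : Fin n, LinearMap.ker ((coeff (R := ℝ) (j : ℕ)).comp T)
  have hK : ∀ n x, x ∈ K n ↔ ∀ j < n, coeff j (T x) = 0 := by
    intro n x
    simp only [K, Submodule.mem_iInf, LinearMap.mem_ker, LinearMap.comp_apply]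
    exact ⟨fun h j hj => h ⟨j, hj⟩, fun h j => h j j.2⟩
  have hKanti : ∀ m n, m ≤ n → K n ≤ K m := fun m n hmn x hx =>
    (hK m x).2 fun j hj => (hK n x).1 hx j (by omega)
  -- A decreasing chain of subspaces of a finite-dimensional space becomes constant; an element of
  -- the final term has zero series, hence is zero.
  have hKbot : ∃ n, K n = ⊥ := by
    obtain ⟨n, hn⟩ := IsArtinian.monotone_stabilizes (R := ℝ) (M := 𝔤)
      ⟨fun n => OrderDual.toDual (K n), fun m n hmn => hKanti m n hmn⟩
    refine ⟨n, (Submodule.eq_bot_iff _).2 fun x hx => hinj x ?_⟩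
    ext j
    rcases lt_or_ge j n with hj | hj
    · simpa using (hK n x).1 hx j hj
    · have h1 : K n = K (j + 1) := hn (j + 1) (by omega)
      rw [h1] at hx
      simpa using (hK _ x).1 hx j (by omega)
  classical
  obtain ⟨N, hN, hNmin⟩ : ∃ N, K N = ⊥ ∧ ∀ m < N, K m ≠ ⊥ :=
    ⟨Nat.find hKbot, Nat.find_spec hKbot, fun m hm => Nat.find_min hKbot hm⟩
  have hlead : ∀ n x, K (n + 1) = ⊥ → x ∈ K n → coeff n (T x) = 0 → x = 0 := by
    intro n x h hx hn
    have : x ∈ K (n + 1) := (hK _ _).2 fun j hj => by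
      rcases Nat.lt_succ_iff_lt_or_eq.1 hj with h | rfl
      · exact (hK _ _).1 hx j h
      · exact hn
    rw [h] at this
    simpa using this
  -- the maximal order is two
  have hN3 : N ≤ 3 := by
    by_contra! h
    obtain ⟨M, rfl⟩ : ∃ M, N = M + 2 := ⟨N - 2, by omega⟩
    obtain ⟨f, hf, hf0⟩ := (Submodule.ne_bot_iff _).1 (hNmin (M + 1) (by omega))
    have hfl : coeff (M + 1) (T f) ≠ 0 := fun h => hf0 (hlead _ f hN hf h)
    obtain ⟨g1, g2⟩ := hlow M f ((hK _ _).1 hf)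
    have hbr := fun k hk => coeff_wronskian (k := k) g1 ((hK _ _).1 hf) hk
    -- With `f` of the top order `M + 1`, the bracket `⁅f₀, f⁆` has order `M`, so this double
    -- bracket has order exactly `2 M`. Since `M ≥ 2`, that is at least `M + 2`, beyond the top
    -- order, although the leading coefficient is not zero.
    have hmem : ⁅⁅f₀, f⁆, f⁆ ∈ K (M + 2) := (hK _ _).2 fun j hj => by
      rw [hT, hbr j (by omega), if_neg (by omega)]
    rw [hN] at hmem
    have h0 : ⁅⁅f₀, f⁆, f⁆ = 0 := (Submodule.mem_bot ℝ).1 hmem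
    have := hbr (M + M) (by omega)
    rw [← hT, h0, if_pos (by omega), g2] at this
    simp only [map_zero] at this
    have h1 : ((M + 1 : ℕ) : ℝ) - M = 1 := by push_cast; ring
    rw [h1, one_mul] at this
    have h2 : (M : ℝ) + 1 ≠ 0 := by positivity
    exact mul_ne_zero (mul_ne_zero h2 hfl) hfl this.symm
  have hK1 : ∀ x, x - coeff 0 (T x) • f₀ ∈ K 1 := fun x => (hK _ _).2 fun j hj => by
    interval_cases j
    simp only [map_sub, map_smul, hf₀, smul_eq_mul, mul_one, sub_self]
  -- Without elements of order two the algebra is spanned by `f₀` and at most one further element.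
  -- All brackets then lie on one line, and being perfect the algebra is that line, hence abelian.
  have hK2 : K 2 ≠ ⊥ := by
    intro h2
    obtain ⟨f, hfspan⟩ : ∃ f, ∀ x ∈ K 1, ∃ c : ℝ, x = c • f := by
      by_cases h1 : K 1 = ⊥
      · exact ⟨0, fun x hx => ⟨0, by rw [h1] at hx; simpa using hx⟩⟩
      · obtain ⟨f, hf, hf0⟩ := (Submodule.ne_bot_iff _).1 h1
        have hfl : coeff 1 (T f) ≠ 0 := fun h => hf0 (hlead _ f h2 hf h)
        refine ⟨f, fun x hx => ⟨coeff 1 (T x) / coeff 1 (T f), ?_⟩⟩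
        rw [← sub_eq_zero]
        refine hlead 1 _ h2 (sub_mem hx (Submodule.smul_mem _ _ hf)) ?_
        simp only [map_sub, map_smul, smul_eq_mul]
        field_simp
        ring
    have hall : ∀ x, ∃ a c : ℝ, x = a • f₀ + c • f := fun x => by
      obtain ⟨c, hc⟩ := hfspan _ (hK1 x)
      exact ⟨coeff 0 (T x), c, by rw [← hc]; abel⟩
    have hbr : ∀ x y : 𝔤, ∃ c : ℝ, ⁅x, y⁆ = c • ⁅f₀, f⁆ := by
      intro x y
      obtain ⟨a, b, rfl⟩ := hall x
      obtain ⟨c, d, rfl⟩ := hall y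
      refine ⟨a * d - b * c, ?_⟩
      simp only [add_lie, lie_add, smul_lie, lie_smul, lie_self]
      rw [← lie_skew f f₀]
      module
    have hspan : ∀ x : 𝔤, ∃ c : ℝ, x = c • ⁅f₀, f⁆ := by
      intro x
      have : Submodule.span ℝ {z : 𝔤 | ∃ x y : 𝔤, ⁅x, y⁆ = z} ≤ Submodule.span ℝ {⁅f₀, f⁆} := by
        rw [Submodule.span_le]
        rintro _ ⟨x, y, rfl⟩
        obtain ⟨c, hc⟩ := hbr x y
        exact Submodule.mem_span_singleton.2 ⟨c, hc.symm⟩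
      rw [span_lie_eq_top] at this
      obtain ⟨c, hc⟩ := Submodule.mem_span_singleton.1 (this (Submodule.mem_top (x := x)))
      exact ⟨c, hc.symm⟩
    apply LieAlgebra.IsSimple.non_abelian ℝ (L := 𝔤)
    refine ⟨fun x y => ?_⟩
    obtain ⟨c, rfl⟩ := hspan x
    obtain ⟨d, rfl⟩ := hspan y
    simp
  have hN' : N = 3 := by
    by_contra hne
    exact hK2 ((Submodule.eq_bot_iff _).2 fun x hx =>
      (Submodule.eq_bot_iff _).1 hN x (hKanti N 2 (by omega) hx))
  subst hN'
  -- the basis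
  obtain ⟨f, hf, hf0⟩ := (Submodule.ne_bot_iff _).1 hK2
  have hfl : coeff 2 (T f) ≠ 0 := fun h => hf0 (hlead _ f hN hf h)
  obtain ⟨e₃, he₃, h32⟩ : ∃ x ∈ K 2, coeff 2 (T x) = 1 :=
    ⟨(coeff 2 (T f))⁻¹ • f, Submodule.smul_mem _ _ hf, by
      rw [map_smul, coeff_smul, smul_eq_mul, inv_mul_cancel₀ hfl]⟩
  have h3 := (hK _ _).1 he₃
  obtain ⟨e₂, he₂⟩ : ∃ x, ⁅f₀, e₃⁆ = (2 : ℝ) • x := ⟨(1 / 2 : ℝ) • ⁅f₀, e₃⁆, by module⟩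
  obtain ⟨g1, g2⟩ := hlow 1 e₃ h3
  have h20 : coeff 0 (T e₂) = 0 := by
    have := g1 0 (by norm_num)
    rw [he₂, map_smul, coeff_smul] at this
    simpa using this
  have h21 : coeff 1 (T e₂) = 1 := by
    rw [he₂, map_smul, coeff_smul, h32] at g2
    simp only [smul_eq_mul] at g2
    norm_num at g2
    linarith
  have he₂K : e₂ ∈ K 1 := (hK _ _).2 fun j hj => by interval_cases j; exact h20
  have hexp1 : ∀ x ∈ K 1, ∃ a b : ℝ, x = a • e₂ + b • e₃ := by
    intro x hx
    set y := x - coeff 1 (T x) • e₂ with hy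
    have hyK : y ∈ K 2 := (hK _ _).2 fun j hj => by
      have hx0 := (hK _ _).1 hx 0 (by norm_num)
      interval_cases j
      · simp only [hy, map_sub, map_smul, h20, hx0, smul_eq_mul, mul_zero, sub_self]
      · simp only [hy, map_sub, map_smul, h21, smul_eq_mul, mul_one, sub_self]
    refine ⟨coeff 1 (T x), coeff 2 (T y), ?_⟩
    have : y - coeff 2 (T y) • e₃ = 0 := by
      refine hlead 2 _ hN (sub_mem hyK (Submodule.smul_mem _ _ he₃)) ?_
      simp only [map_sub, map_smul, h32, smul_eq_mul, mul_one, sub_self]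
    rw [← sub_eq_zero.1 this, hy]
    abel
  have h23 : ⁅e₂, e₃⁆ = e₃ := by
    have hbr := fun k hk => coeff_wronskian (k := k) ((hK _ _).1 he₂K) h3 hk
    rw [← sub_eq_zero]
    refine hlead 2 _ hN ((hK _ _).2 fun j hj => ?_) ?_
    · rw [map_sub, map_sub, h3 j hj, hT, hbr j (by omega), if_neg (by omega), sub_zero]
    · rw [map_sub, map_sub, hT, hbr 2 (by omega), if_pos (by omega), h32, h21]
      norm_num
  obtain ⟨β, hβ⟩ : ∃ β : ℝ, ⁅f₀, e₂⁆ = f₀ + β • e₃ := by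
    obtain ⟨-, g⟩ := hlow 0 e₂ ((hK _ _).1 he₂K)
    have hm := hK1 ⁅f₀, e₂⁆
    rw [g, zero_add, h21] at hm
    obtain ⟨α, β, hαβ⟩ := hexp1 _ hm
    have h12 : ⁅f₀, e₂⁆ = f₀ + α • e₂ + β • e₃ := by
      rw [add_assoc, ← hαβ]; simp
    -- The Jacobi identity reduces to `α • e₃ = 0`, the other terms cancelling.
    have hJ := lie_jacobi f₀ e₂ e₃
    have h30 : ⁅e₃, f₀⁆ = -((2 : ℝ) • e₂) := by rw [← lie_skew, he₂]
    have h32' : ⁅e₃, e₂⁆ = -e₃ := by rw [← lie_skew, h23]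
    rw [h23, h30, he₂, h12, lie_neg, lie_smul, lie_self, lie_add, lie_add, lie_smul, lie_smul,
      h30, h32', lie_self] at hJ
    have hα : α • e₃ = 0 := by
      rw [← neg_eq_zero, ← hJ]; module
    have he₃0 : e₃ ≠ 0 := by rintro rfl; simp at h32
    rcases smul_eq_zero.1 hα with h | h
    · exact ⟨β, by rw [h12, h]; simp⟩
    · exact absurd h he₃0
  -- Since `⁅e₃, e₂⁆ = -e₃`, adding `(β / 2) • e₃` turns `f₀ + β • e₃` into the bracket relation
  -- `⁅e₁, e₂⁆ = e₁`; the bracket with `e₃` is unaffected.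
  set e₁ := f₀ + (β / 2) • e₃ with he₁
  have h10 : coeff 0 (T e₁) = 1 := by
    simp only [he₁, map_add, map_smul, hf₀, h3 0 (by norm_num)]; simp
  have hli : LinearIndependent ℝ ![e₁, e₂, e₃] := by
    rw [Fintype.linearIndependent_iff]
    intro g hg
    simp only [Fin.sum_univ_three, Matrix.cons_val_zero, Matrix.cons_val_one, Matrix.cons_val] at hg
    have hc : ∀ n, g 0 * coeff n (T e₁) + g 1 * coeff n (T e₂) + g 2 * coeff n (T e₃) = 0 := by
      intro n
      have := congrArg (fun x => coeff n (T x)) hg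
      simpa only [map_add, map_smul, coeff_smul, smul_eq_mul, map_zero] using this
    have c0 := hc 0
    rw [h10, h20, h3 0 (by norm_num)] at c0
    have z0 : g 0 = 0 := by linarith
    have c1 := hc 1
    rw [z0, h21, h3 1 (by norm_num)] at c1
    have z1 : g 1 = 0 := by linarith
    have c2 := hc 2
    rw [z0, z1, h32] at c2
    have z2 : g 2 = 0 := by linarith
    intro i; fin_cases i <;> assumption
  have hspan : ⊤ ≤ Submodule.span ℝ (Set.range ![e₁, e₂, e₃]) := by
    intro x _
    have m : ∀ i, ![e₁, e₂, e₃] i ∈ Submodule.span ℝ (Set.range ![e₁, e₂, e₃]) :=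
      fun i => Submodule.subset_span ⟨i, rfl⟩
    have m1 := m 0
    have m2 := m 1
    have m3 := m 2
    simp only [Matrix.cons_val_zero, Matrix.cons_val_one, Matrix.cons_val] at m1 m2 m3
    obtain ⟨a, b, hab⟩ := hexp1 _ (hK1 x)
    have : x = coeff 0 (T x) • e₁ + a • e₂ + (b - coeff 0 (T x) * (β / 2)) • e₃ := by
      rw [sub_eq_iff_eq_add] at hab
      conv_lhs => rw [hab]
      rw [he₁]; module
    rw [this]
    exact add_mem (add_mem (Submodule.smul_mem _ _ m1) (Submodule.smul_mem _ _ m2))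
      (Submodule.smul_mem _ _ m3)
  have hb : ∀ i, Module.Basis.mk hli hspan i = ![e₁, e₂, e₃] i := fun i => by simp
  refine ⟨Module.Basis.mk hli hspan, ⟨?_, ?_, ?_⟩, ?_⟩ <;> simp only [hb] <;>
    simp only [Matrix.cons_val_zero, Matrix.cons_val_one, Matrix.cons_val]
  · rw [he₁, add_lie, hβ, smul_lie, ← lie_skew, h23]; module
  · rw [he₁, add_lie, smul_lie, lie_self, he₂]; simp
  · exact h23
  · exact h10

end FormalVectorFields

/-! ### Taylor series as a differential homomorphism to formal power series. -/

section Taylor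

open PowerSeries Nat

/-- The Taylor series of a function at a point. -/
def taylor (t₀ : ℝ) (f : ℝ → ℝ) : ℝ⟦X⟧ := PowerSeries.mk fun n => iteratedDeriv n f t₀ / n !

theorem coeff_taylor (t₀ : ℝ) (f : ℝ → ℝ) (n : ℕ) :
    coeff n (taylor t₀ f) = iteratedDeriv n f t₀ / n ! := by simp [taylor]

theorem taylor_congr {t₀ : ℝ} {f g : ℝ → ℝ} (h : f =ᶠ[nhds t₀] g) : taylor t₀ f = taylor t₀ g := by
  ext n
  rw [coeff_taylor, coeff_taylor, h.iteratedDeriv_eq]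

theorem taylor_deriv (t₀ : ℝ) (f : ℝ → ℝ) :
    taylor t₀ (deriv f) = derivative ℝ (taylor t₀ f) := by
  ext n
  rw [coeff_derivative, coeff_taylor, coeff_taylor, iteratedDeriv_succ', Nat.factorial_succ]
  have : (n ! : ℝ) ≠ 0 := by positivity
  have : (n : ℝ) + 1 ≠ 0 := by positivity
  push_cast
  field_simp

theorem taylor_add {t₀ : ℝ} {f g : ℝ → ℝ} (hf : ContDiffAt ℝ ∞ f t₀) (hg : ContDiffAt ℝ ∞ g t₀) :
    taylor t₀ (f + g) = taylor t₀ f + taylor t₀ g := by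
  ext n
  rw [map_add, coeff_taylor, coeff_taylor, coeff_taylor,
    iteratedDeriv_add (hf.of_le (by exact_mod_cast le_top)) (hg.of_le (by exact_mod_cast le_top)),
    add_div]

theorem taylor_smul {t₀ : ℝ} (c : ℝ) (f : ℝ → ℝ) : taylor t₀ (c • f) = c • taylor t₀ f := by
  ext n
  rw [coeff_smul, coeff_taylor, coeff_taylor, iteratedDeriv_const_smul_field, smul_eq_mul,
    smul_eq_mul, mul_div_assoc]

theorem taylor_sub {t₀ : ℝ} {f g : ℝ → ℝ} (hf : ContDiffAt ℝ ∞ f t₀) (hg : ContDiffAt ℝ ∞ g t₀) :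
    taylor t₀ (f - g) = taylor t₀ f - taylor t₀ g := by
  have h1 : f - g = f + (-1 : ℝ) • g := by ext; simp [sub_eq_add_neg]
  have h2 : ContDiffAt ℝ ∞ ((-1 : ℝ) • g) t₀ := contDiffAt_const.smul hg
  rw [h1, taylor_add hf h2, taylor_smul, neg_one_smul, sub_eq_add_neg]

theorem taylor_mul {t₀ : ℝ} {f g : ℝ → ℝ} (hf : ContDiffAt ℝ ∞ f t₀) (hg : ContDiffAt ℝ ∞ g t₀) :
    taylor t₀ (f * g) = taylor t₀ f * taylor t₀ g := by
  ext n
  rw [coeff_taylor, iteratedDeriv_mul (hf.of_le (by exact_mod_cast le_top))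
    (hg.of_le (by exact_mod_cast le_top)), coeff_mul,
    Finset.Nat.sum_antidiagonal_eq_sum_range_succ_mk, Finset.sum_div]
  refine Finset.sum_congr rfl fun i hi => ?_
  have hi : i ≤ n := Nat.lt_succ_iff.1 (Finset.mem_range.1 hi)
  simp only [coeff_taylor]
  rw [Nat.cast_choose ℝ hi]
  have h1 : (n ! : ℝ) ≠ 0 := by positivity
  have h2 : (i ! : ℝ) ≠ 0 := by positivity
  have h3 : ((n - i)! : ℝ) ≠ 0 := by positivity
  field_simp

end Taylor

/-! ### Unique continuation for simple Lie algebras of vector fields. -/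

section UniqueContinuation

variable {𝔤 : Type*} [LieRing 𝔤] [LieAlgebra ℝ 𝔤]
  {E : Type*} [NormedAddCommGroup E] [NormedSpace ℝ E]

/-- A simple finite-dimensional Lie algebra of vector fields vanishes near every point where all
first derivatives vanish. -/
theorem eventually_eq_zero_of_fderiv_eq_zero [FiniteDimensional ℝ 𝔤] [LieAlgebra.IsSimple ℝ 𝔤]
    (V : 𝔤 →ₗ[ℝ] (E → E)) (p : E)
    (hlie : ∀ᶠ y in nhds p, ∀ x z, V ⁅x, z⁆ y = VectorField.lieBracket ℝ (V x) (V z) y)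
    (hcont : ∀ x, ContinuousAt (fderiv ℝ (V x)) p) (h0 : ∀ x, fderiv ℝ (V x) p = 0) :
    ∀ᶠ y in nhds p, ∀ x, V x y = 0 := by
  let v := Module.finBasis ℝ 𝔤
  set M : E → ℝ := fun y => ∑ i, ‖fderiv ℝ (V (v i)) y‖ with hM
  set N : E → ℝ := fun y => ∑ i, ‖V (v i) y‖ with hN
  have hM0 : ∀ y, 0 ≤ M y := fun y => Finset.sum_nonneg fun i _ => norm_nonneg _
  have hN0 : ∀ y, 0 ≤ N y := fun y => Finset.sum_nonneg fun i _ => norm_nonneg _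
  let G : Set E := {y | ∀ x z, V ⁅x, z⁆ y = VectorField.lieBracket ℝ (V x) (V z) y}
  -- Elements whose field is bounded by a constant times (derivatives) times (values) form a
  -- subspace. It contains the brackets of basis elements, hence everything, as the algebra is
  -- perfect.
  let P : Submodule ℝ 𝔤 :=
    { carrier := {w | ∃ C : ℝ, 0 ≤ C ∧ ∀ y ∈ G, ‖V w y‖ ≤ C * (M y * N y)}
      add_mem' := by
        rintro a b ⟨C, hC, h⟩ ⟨D, hD, k⟩
        refine ⟨C + D, by positivity, fun y hy => ?_⟩
        rw [map_add, add_mul]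
        exact (norm_add_le _ _).trans (add_le_add (h y hy) (k y hy))
      zero_mem' := ⟨0, le_rfl, fun y _ => by simp⟩
      smul_mem' := by
        rintro c a ⟨C, hC, h⟩
        refine ⟨|c| * C, by positivity, fun y hy => ?_⟩
        rw [map_smul, mul_assoc, Pi.smul_apply, norm_smul, Real.norm_eq_abs]
        exact mul_le_mul_of_nonneg_left (h y hy) (abs_nonneg c) }
  have hij : ∀ i j, ⁅v i, v j⁆ ∈ P := by
    intro i j
    refine ⟨2, by norm_num, fun y hy => ?_⟩
    have bd : ∀ i j, ‖fderiv ℝ (V (v i)) y (V (v j) y)‖ ≤ M y * N y := fun i j =>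
      ((fderiv ℝ (V (v i)) y).le_opNorm _).trans <| mul_le_mul
        (Finset.single_le_sum (f := fun i => ‖fderiv ℝ (V (v i)) y‖) (fun i _ => norm_nonneg _)
          (Finset.mem_univ i))
        (Finset.single_le_sum (f := fun i => ‖V (v i) y‖) (fun i _ => norm_nonneg _)
          (Finset.mem_univ j)) (norm_nonneg _) (hM0 y)
    rw [hy, VectorField.lieBracket_eq]
    refine (norm_sub_le _ _).trans ?_
    linarith [bd i j, bd j i]
  have hP : P = ⊤ := by
    rw [eq_top_iff, ← span_lie_eq_top, Submodule.span_le]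
    rintro _ ⟨x, z, rfl⟩
    show ⁅x, z⁆ ∈ P
    rw [← v.sum_repr x, ← v.sum_repr z, sum_lie]
    refine Submodule.sum_mem _ fun i _ => ?_
    rw [smul_lie, lie_sum]
    refine Submodule.smul_mem _ _ (Submodule.sum_mem _ fun j _ => ?_)
    rw [lie_smul]
    exact Submodule.smul_mem _ _ (hij i j)
  have hbd : ∀ i, ∃ C : ℝ, 0 ≤ C ∧ ∀ y ∈ G, ‖V (v i) y‖ ≤ C * (M y * N y) := fun i => by
    have : v i ∈ P := hP ▸ Submodule.mem_top
    exact this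
  choose C hC0 hC using hbd
  have hMc : ContinuousAt (fun y => (∑ i, C i) * M y) p :=
    continuousAt_const.mul (tendsto_finsetSum _ fun i _ => (hcont (v i)).norm)
  -- Near `p` the derivatives are small, so summing the bounds over the basis gives `N ≤ θ N` with
  -- `θ < 1`, which forces `N = 0`.
  have hlt : ∀ᶠ y in nhds p, (∑ i, C i) * M y < 1 := by
    refine hMc.eventually_lt continuousAt_const ?_
    simp [hM, h0]
  filter_upwards [hlie, hlt] with y hy hlt x
  have h1 : N y ≤ (∑ i, C i) * M y * N y := by
    rw [mul_assoc, Finset.sum_mul]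
    exact Finset.sum_le_sum fun i _ => hC i y hy
  have h2 : N y = 0 := by nlinarith [hN0 y]
  have h3 : ∀ i, V (v i) y = 0 := fun i =>
    norm_eq_zero.1 ((Finset.sum_eq_zero_iff_of_nonneg fun i _ => norm_nonneg _).1 h2 i
      (Finset.mem_univ i))
  rw [← v.sum_repr x, map_sum, Finset.sum_apply]
  exact Finset.sum_eq_zero fun i _ => by rw [map_smul, Pi.smul_apply, h3, smul_zero]

/-- A simple finite-dimensional Lie algebra of vector fields on a connected open set which
vanishes on a nonempty open subset vanishes identically. -/
theorem eq_zero_of_eq_zero_on_open [FiniteDimensional ℝ 𝔤] [LieAlgebra.IsSimple ℝ 𝔤]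
    (V : 𝔤 →ₗ[ℝ] (E → E)) {U U₀ : Set E} (hU : IsOpen U) (hUc : IsPreconnected U)
    (hV : ∀ x, ContDiffOn ℝ ∞ (V x) U)
    (hlie : ∀ x z, ∀ y ∈ U, V ⁅x, z⁆ y = VectorField.lieBracket ℝ (V x) (V z) y)
    (hU₀ : IsOpen U₀) (hne : (U ∩ U₀).Nonempty) (h0 : ∀ x, ∀ y ∈ U₀, V x y = 0) :
    ∀ x, ∀ y ∈ U, V x y = 0 := by
  set Z : Set E := interior {y | ∀ x, V x y = 0} with hZ
  have hsub : U₀ ⊆ Z := interior_maximal (fun y hy x => h0 x y hy) hU₀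
  have key : U ⊆ Z := by
    refine hUc.subset_of_closure_inter_subset isOpen_interior
      (hne.mono (Set.inter_subset_inter_right _ hsub)) ?_
    rintro p ⟨hpc, hpU⟩
    have hcd : ∀ x, ContinuousAt (fderiv ℝ (V x)) p := fun x =>
      ((hV x).continuousOn_fderiv_of_isOpen hU (by simp)).continuousAt (hU.mem_nhds hpU)
    -- At a limit point of the open zero set all first derivatives vanish by continuity, so the
    -- local criterion applies there and the zero set is relatively closed.
    refine mem_interior_iff_mem_nhds.2 (eventually_eq_zero_of_fderiv_eq_zero V p ?_ hcd ?_)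
    · filter_upwards [hU.mem_nhds hpU] with y hy x z using hlie x z y hy
    · intro x
      have : ∀ y ∈ Z, fderiv ℝ (V x) y = 0 := fun y hy => by
        have : V x =ᶠ[nhds y] fun _ => 0 := by
          filter_upwards [isOpen_interior.mem_nhds hy] with z hz using interior_subset hz x
        rw [this.fderiv_eq, fderiv_fun_const]; rfl
      have hcl : fderiv ℝ (V x) p ∈ closure ({0} : Set (E →L[ℝ] E)) :=
        closure_mono (by rintro _ ⟨y, hy, rfl⟩; exact this y hy)
          ((hcd x).continuousWithinAt.mem_closure_image hpc)
      simpa using hcl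
  exact fun x y hy => interior_subset (key hy) x

end UniqueContinuation

/-! ### Derivatives along coordinate lines and total derivatives. -/

section Slices

variable {g : ℝ × ℝ → ℝ} {t u : ℝ}

theorem hasDerivAt_slice_fst (hg : DifferentiableAt ℝ g (t, u)) :
    HasDerivAt (fun t' => g (t', u)) (fderiv ℝ g (t, u) (1, 0)) t :=
  hg.hasFDerivAt.comp_hasDerivAt t ((hasDerivAt_id t).prodMk (hasDerivAt_const t u))

theorem hasDerivAt_slice_snd (hg : DifferentiableAt ℝ g (t, u)) :
    HasDerivAt (fun u' => g (t, u')) (fderiv ℝ g (t, u) (0, 1)) u :=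
  hg.hasFDerivAt.comp_hasDerivAt u ((hasDerivAt_const u t).prodMk (hasDerivAt_id u))

theorem hasDerivAt_fderiv_slice_fst (hg : ContDiffAt ℝ ∞ g (t, u)) (w : ℝ × ℝ) :
    HasDerivAt (fun t' => fderiv ℝ g (t', u) w) (fderiv ℝ (fderiv ℝ g) (t, u) (1, 0) w) t := by
  have h := ((hg.fderiv_right (m := ∞) (by simp)).differentiableAt (by simp)).hasFDerivAt
  have h2 := h.comp_hasDerivAt t ((hasDerivAt_id t).prodMk (hasDerivAt_const t u))
  simpa using h2.clm_apply (hasDerivAt_const t w)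

theorem hasDerivAt_fderiv_slice_snd (hg : ContDiffAt ℝ ∞ g (t, u)) (w : ℝ × ℝ) :
    HasDerivAt (fun u' => fderiv ℝ g (t, u') w) (fderiv ℝ (fderiv ℝ g) (t, u) (0, 1) w) u := by
  have h := ((hg.fderiv_right (m := ∞) (by simp)).differentiableAt (by simp)).hasFDerivAt
  have h2 := h.comp_hasDerivAt u ((hasDerivAt_const u t).prodMk (hasDerivAt_id u))
  simpa using h2.clm_apply (hasDerivAt_const u w)

/-- As `D_t g` is linear in the velocity, the acceleration enters only through the term `w g_u`. -/
theorem totalDeriv₂_eq (hg : ContDiffAt ℝ ∞ g (t, u)) (v w : ℝ) :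
    totalDeriv₂ g (t, u, v) w =
      fderiv ℝ (fderiv ℝ g) (t, u) (1, v) (1, v) + w * fderiv ℝ g (t, u) (0, 1) := by
  have h := ((hg.fderiv_right (m := ∞) (by simp)).differentiableAt (by simp)).hasFDerivAt
  have hL : HasFDerivAt (fun j : ℝ × ℝ × ℝ => (j.1, j.2.1))
      ((ContinuousLinearMap.fst ℝ ℝ (ℝ × ℝ)).prod
        ((ContinuousLinearMap.fst ℝ ℝ ℝ).comp (ContinuousLinearMap.snd ℝ ℝ (ℝ × ℝ)))) (t, u, v) :=
    ((ContinuousLinearMap.fst ℝ ℝ (ℝ × ℝ)).prod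
      ((ContinuousLinearMap.fst ℝ ℝ ℝ).comp (ContinuousLinearMap.snd ℝ ℝ (ℝ × ℝ)))).hasFDerivAt
  have hM : HasFDerivAt (fun j : ℝ × ℝ × ℝ => ((1 : ℝ), j.2.2))
      ((0 : ℝ × ℝ × ℝ →L[ℝ] ℝ).prod
        ((ContinuousLinearMap.snd ℝ ℝ ℝ).comp (ContinuousLinearMap.snd ℝ ℝ (ℝ × ℝ)))) (t, u, v) :=
    (hasFDerivAt_const _ _).prodMk
      ((ContinuousLinearMap.snd ℝ ℝ ℝ).comp (ContinuousLinearMap.snd ℝ ℝ (ℝ × ℝ))).hasFDerivAt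
  have h2 : HasFDerivAt (fun j : ℝ × ℝ × ℝ => fderiv ℝ g (j.1, j.2.1)) _ (t, u, v) :=
    HasFDerivAt.comp (t, u, v) (g := fderiv ℝ g) (f := fun j : ℝ × ℝ × ℝ => (j.1, j.2.1)) h hL
  have h3 := (h2.clm_apply hM).fderiv
  have h4 : (0, w) = w • ((0, 1) : ℝ × ℝ) := by simp
  unfold totalDeriv₂ totalDeriv
  rw [h3]
  simp only [add_apply, ContinuousLinearMap.comp_apply,
    ContinuousLinearMap.flip_apply, ContinuousLinearMap.prod_apply,
    ContinuousLinearMap.coe_fst', ContinuousLinearMap.coe_snd', zero_apply]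
  rw [h4, map_smul, smul_eq_mul, add_comm]

end Slices

/-- A second derivative as a polynomial in the velocity. -/
theorem bilin_velocity (B : ℝ × ℝ →L[ℝ] ℝ × ℝ →L[ℝ] ℝ) (v : ℝ) :
    B (1, v) (1, v) = B (1, 0) (1, 0) + v * (B (1, 0) (0, 1) + B (0, 1) (1, 0))
      + v ^ 2 * B (0, 1) (0, 1) := by
  have h : ((1, v) : ℝ × ℝ) = (1, 0) + v • (0, 1) := by simp
  rw [h]
  simp only [map_add, map_smul, add_apply, smul_apply,
    smul_eq_mul]
  ring

theorem contDiffAt_deriv {f : ℝ → ℝ} {t : ℝ} (hf : ContDiffAt ℝ ∞ f t) :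
    ContDiffAt ℝ ∞ (deriv f) t :=
  (hf.fderiv_right (m := ∞) (by simp)).clm_apply contDiffAt_const

theorem eq_of_hasDerivAt_zero {f : ℝ → ℝ} {D : Set ℝ} (hD : IsOpen D) (hc : IsPreconnected D)
    (hd : ∀ u ∈ D, HasDerivAt f 0 u) {x y : ℝ} (hx : x ∈ D) (hy : y ∈ D) : f x = f y :=
  hD.is_const_of_deriv_eq_zero hc (fun u hu => (hd u hu).differentiableAt.differentiableWithinAt)
    (fun u hu => (hd u hu).deriv) hx hy

theorem cubic_eq_zero {c₀ c₁ c₂ c₃ : ℝ} (h : ∀ v : ℝ, c₀ + c₁ * v + c₂ * v ^ 2 + c₃ * v ^ 3 = 0) :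
    c₀ = 0 ∧ c₁ = 0 ∧ c₂ = 0 ∧ c₃ = 0 := by
  have h0 := h 0
  have h1 := h 1
  have h2 := h (-1)
  have h3 := h 2
  norm_num at h0 h1 h2 h3
  refine ⟨h0, ?_, ?_, ?_⟩ <;> linarith

/-! ### The determining equations and the form of the symmetries. -/

namespace LatticeSystem

variable {S : LatticeSystem} {X : PointField} {s : Site}

theorem isOpen_box : IsOpen (S.I ×ˢ S.J s) := S.isOpen_I.prod (S.isOpen_J s)

theorem isOpen_wideBox : IsOpen (S.I ×ˢ ⋃ s, S.J s) := S.isOpen_I.prod (isOpen_iUnion S.isOpen_J)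

theorem mem_J {q : ℝ × (Stencil → ℝ)} (hq : q ∈ S.Ω s) : q.2 origin ∈ S.J s := by
  have := (S.mem_box s q hq).2 origin
  have h : s + (origin : ℤ × ℤ) = s := by simp [origin]
  rwa [h] at this

theorem mem_siteBox {q : ℝ × (Stencil → ℝ)} (hq : q ∈ S.Ω s) :
    (q.1, q.2 origin) ∈ S.I ×ˢ S.J s := ⟨(S.mem_box s q hq).1, mem_J hq⟩

theorem box_subset : S.I ×ˢ S.J s ⊆ S.I ×ˢ ⋃ s, S.J s :=
  Set.prod_mono_right (Set.subset_iUnion _ s)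

theorem contDiffAt_tau (hX : X.IsSmoothOn S) {p : ℝ × ℝ} (hp : p ∈ S.I ×ˢ ⋃ s, S.J s) :
    ContDiffAt ℝ ∞ X.1 p := hX.1.contDiffAt (isOpen_wideBox.mem_nhds hp)

theorem contDiffAt_phi (hX : X.IsSmoothOn S) {p : ℝ × ℝ} (hp : p ∈ S.I ×ˢ S.J s) :
    ContDiffAt ℝ ∞ (X.2 s) p := (hX.2 s).contDiffAt (isOpen_box.mem_nhds hp)

theorem contDiffAt_F {q : ℝ × (Stencil → ℝ)} (hq : q ∈ S.Ω s) : ContDiffAt ℝ ∞ (S.F s) q :=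
  (S.smooth_F s).contDiffAt ((S.isOpen_Ω s).mem_nhds hq)

/-- The symmetry condition with the derivatives along the trajectories written out. -/
theorem prolongationDelta_eq (hX : X.IsSmoothOn S) {q : ℝ × (Stencil → ℝ)} (hq : q ∈ S.Ω s)
    (v w : ℝ) :
    X.prolongationDelta S s q v w =
      fderiv ℝ (fderiv ℝ (X.2 s)) (q.1, q.2 origin) (1, v) (1, v)
      + w * fderiv ℝ (X.2 s) (q.1, q.2 origin) (0, 1)
      - (fderiv ℝ (fderiv ℝ X.1) (q.1, q.2 origin) (1, v) (1, v)
        + w * fderiv ℝ X.1 (q.1, q.2 origin) (0, 1)) * v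
      - 2 * (fderiv ℝ X.1 (q.1, q.2 origin) (1, 0)
        + v * fderiv ℝ X.1 (q.1, q.2 origin) (0, 1)) * w
      - X.1 (q.1, q.2 origin) * partialT (S.F s) q
      - ∑ δ : Stencil, X.2 (s + δ) (q.1, q.2 δ) * partialU δ (S.F s) q := by
  have hp := mem_siteBox hq
  have h : ((1, v) : ℝ × ℝ) = (1, 0) + v • (0, 1) := by simp
  rw [PointField.prolongationDelta, PointField.phiTT,
    totalDeriv₂_eq (contDiffAt_tau hX (box_subset hp)), totalDeriv₂_eq (contDiffAt_phi hX hp)]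
  simp only [totalDeriv]
  rw [show fderiv ℝ X.1 (q.1, q.2 origin) (1, v) = fderiv ℝ X.1 (q.1, q.2 origin) (1, 0)
        + v * fderiv ℝ X.1 (q.1, q.2 origin) (0, 1) by rw [h, map_add, map_smul, smul_eq_mul]]

/-- The determining equations of the symmetries. -/
theorem IsSymmetry.determining (hX : S.IsSymmetry X) {q : ℝ × (Stencil → ℝ)} (hq : q ∈ S.Ω s) :
    (fderiv ℝ (fderiv ℝ (X.2 s)) (q.1, q.2 origin) (1, 0) (1, 0)
      + (fderiv ℝ (X.2 s) (q.1, q.2 origin) (0, 1)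
        - 2 * fderiv ℝ X.1 (q.1, q.2 origin) (1, 0)) * S.F s q
      - X.1 (q.1, q.2 origin) * partialT (S.F s) q
      - ∑ δ : Stencil, X.2 (s + δ) (q.1, q.2 δ) * partialU δ (S.F s) q = 0) ∧
    (fderiv ℝ (fderiv ℝ (X.2 s)) (q.1, q.2 origin) (1, 0) (0, 1)
      + fderiv ℝ (fderiv ℝ (X.2 s)) (q.1, q.2 origin) (0, 1) (1, 0)
      - fderiv ℝ (fderiv ℝ X.1) (q.1, q.2 origin) (1, 0) (1, 0)
      - 3 * S.F s q * fderiv ℝ X.1 (q.1, q.2 origin) (0, 1) = 0) ∧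
    (fderiv ℝ (fderiv ℝ (X.2 s)) (q.1, q.2 origin) (0, 1) (0, 1)
      - (fderiv ℝ (fderiv ℝ X.1) (q.1, q.2 origin) (1, 0) (0, 1)
        + fderiv ℝ (fderiv ℝ X.1) (q.1, q.2 origin) (0, 1) (1, 0)) = 0) ∧
    -fderiv ℝ (fderiv ℝ X.1) (q.1, q.2 origin) (0, 1) (0, 1) = 0 := by
  -- `F` does not involve the velocity, so after `ü = F` the condition holds for every `v`. The four
  -- claims are the coefficients of `1`, `v`, `v²`, `v³`.
  refine cubic_eq_zero fun v => ?_
  have h := hX.2 s q hq v (S.F s q) (sub_self _)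
  rw [prolongationDelta_eq hX.1 hq, bilin_velocity _ v,
    bilin_velocity (fderiv ℝ (fderiv ℝ X.1) (q.1, q.2 origin)) v] at h
  linear_combination h

/-- A continuous function on the `(t, u_s)`-plane which vanishes at the points below `Ω_s`
vanishes, also over an open set of times. -/
theorem eq_zero_of_dense {I₀ : Set ℝ} (hI₀ : IsOpen I₀) (hI : I₀ ⊆ S.I) {h : ℝ × ℝ → ℝ}
    (hc : ∀ p ∈ I₀ ×ˢ S.J s, ContinuousAt h p)
    (h0 : ∀ q ∈ S.Ω s, q.1 ∈ I₀ → h (q.1, q.2 origin) = 0) : ∀ p ∈ I₀ ×ˢ S.J s, h p = 0 := by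
  intro p hp
  have hcl := S.dense_proj s (Set.prod_mono_left hI hp)
  have hcl2 : p ∈ closure ((fun q : ℝ × (Stencil → ℝ) => (q.1, q.2 origin)) '' S.Ω s
      ∩ Prod.fst ⁻¹' I₀) := by
    refine mem_closure_iff.2 fun o ho hpo => ?_
    obtain ⟨z, hz, hz'⟩ := mem_closure_iff.1 hcl (o ∩ Prod.fst ⁻¹' I₀)
      (ho.inter (hI₀.preimage continuous_fst)) ⟨hpo, hp.1⟩
    exact ⟨z, hz.1, hz', hz.2⟩
  have := closure_mono (t := {(0 : ℝ)})
    (by rintro _ ⟨_, ⟨⟨q, hq, rfl⟩, hqI⟩, rfl⟩; exact h0 q hq hqI)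
    ((hc p hp).continuousWithinAt.mem_closure_image hcl2)
  simpa using this

theorem continuousAt_snd_fderiv {g : ℝ × ℝ → ℝ} {p : ℝ × ℝ} (hg : ContDiffAt ℝ ∞ g p)
    (a b : ℝ × ℝ) : ContinuousAt (fun p => fderiv ℝ (fderiv ℝ g) p a b) p := by
  have h := ((hg.fderiv_right (m := ∞) (by simp)).fderiv_right (m := ∞) (by simp)).continuousAt
  exact (h.clm_apply continuousAt_const).clm_apply continuousAt_const

/-- Where the interaction is coupled, `τ` does not depend on the dependent variables. -/
theorem IsSymmetry.fderiv_tau_eq_zero (hX : S.IsSymmetry X) {t : ℝ} (ht : S.CoupledAt t) :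
    ∀ u ∈ ⋃ s, S.J s, fderiv ℝ X.1 (t, u) (0, 1) = 0 := by
  obtain ⟨s, δ, u, hu, hδ⟩ := ht
  have htI : t ∈ S.I := (S.mem_box s _ hu).1
  -- `τ_u` vanishes at one point
  have h0 : fderiv ℝ X.1 (t, u origin) (0, 1) = 0 := by
    have hd : HasDerivAt (fun ε : ℝ => ((t, u + ε • Pi.single (δ : Stencil) 1) : ℝ × (Stencil → ℝ)))
        (0, Pi.single (δ : Stencil) 1) 0 := by
      refine (hasDerivAt_const _ _).prodMk ?_
      simpa using ((hasDerivAt_id (0 : ℝ)).smul_const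
        (Pi.single (δ : Stencil) (1 : ℝ) : Stencil → ℝ)).const_add u
    have hF : HasDerivAt (fun ε : ℝ => S.F s (t, u + ε • Pi.single (δ : Stencil) 1))
        (partialU δ (S.F s) (t, u)) 0 := by
      have h1 : HasFDerivAt (S.F s) (fderiv ℝ (S.F s) (t, u))
          ((fun ε : ℝ => ((t, u + ε • Pi.single (δ : Stencil) 1) : ℝ × (Stencil → ℝ))) 0) := by
        simpa using ((contDiffAt_F hu).differentiableAt (by simp)).hasFDerivAt
      exact h1.comp_hasDerivAt 0 hd
    -- Only a neighbour is moved, so `(t, u_s)` stays fixed, and in the equation linear in the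
    -- velocity only `F` can change. Differentiating in `ε` gives `∂F/∂u_δ · τ_u = 0`.
    have hev : ∀ᶠ ε : ℝ in nhds 0, S.F s (t, u + ε • Pi.single (δ : Stencil) 1)
        * fderiv ℝ X.1 (t, u origin) (0, 1) = S.F s (t, u) * fderiv ℝ X.1 (t, u origin) (0, 1) := by
      have hm : ∀ᶠ ε : ℝ in nhds 0, (t, u + ε • Pi.single (δ : Stencil) 1) ∈ S.Ω s :=
        hd.continuousAt.eventually_mem ((S.isOpen_Ω s).mem_nhds (by simpa using hu))
      filter_upwards [hm] with ε hε
      have e1 := (hX.determining hε).2.1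
      have e2 := (hX.determining hu).2.1
      have ho : (u + ε • (Pi.single (δ : Stencil) (1 : ℝ) : Stencil → ℝ)) origin = u origin := by
        simp [Pi.single_eq_of_ne (M := fun _ => ℝ) δ.2.symm]
      simp only [ho] at e1 e2
      linarith
    have h1 := hF.mul_const (fderiv ℝ X.1 (t, u origin) (0, 1))
    have h2 := h1.unique ((hasDerivAt_const (0 : ℝ) _).congr_of_eventuallyEq hev)
    exact (mul_eq_zero.1 h2).resolve_left hδ
  have huJ : u origin ∈ ⋃ s, S.J s := Set.mem_iUnion.2 ⟨s, mem_J hu⟩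
  -- The cubic coefficient is `τ_uu = 0`, first below `Ω_s` and then by density on each box. As the
  -- union of the `J s` is an interval, the single zero of `τ_u` spreads to all of it.
  have hd : ∀ u ∈ ⋃ s, S.J s, HasDerivAt (fun u' => fderiv ℝ X.1 (t, u') (0, 1)) 0 u := by
    intro u hu
    obtain ⟨s, hs⟩ := Set.mem_iUnion.1 hu
    have h1 := hasDerivAt_fderiv_slice_snd (contDiffAt_tau hX.1 (p := (t, u)) ⟨htI, hu⟩) (0, 1)
    have h2 := eq_zero_of_dense (s := s) S.isOpen_I subset_rfl
      (h := fun p => fderiv ℝ (fderiv ℝ X.1) p (0, 1) (0, 1))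
      (fun p hp => continuousAt_snd_fderiv (contDiffAt_tau hX.1 (box_subset hp)) _ _)
      (fun q hq _ => neg_eq_zero.1 (hX.determining hq).2.2.2) (t, u) ⟨htI, hs⟩
    rwa [h2] at h1
  intro u' hu'
  exact (eq_of_hasDerivAt_zero (isOpen_iUnion S.isOpen_J) S.ordConnected_iUnion_J.isPreconnected hd
    hu' huJ).trans h0

end LatticeSystem

/-! ### Fields affine in the dependent variable: brackets and the equation for `F`. -/

/-- Over the times in `I₀`, the vector field is `b(t) ∂_t + ((b'(t)/2 + A_s) u_s + β_s(t)) ∂_{u_s}`. -/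
structure PointField.LocalForm (S : LatticeSystem) (X : PointField) (I₀ : Set ℝ) (b : ℝ → ℝ)
    (A : Site → ℝ) (β : Site → ℝ → ℝ) : Prop where
  smooth_b : ContDiffOn ℝ ∞ b I₀
  smooth_β : ∀ s, ContDiffOn ℝ ∞ (β s) I₀
  tau : ∀ t ∈ I₀, ∀ u ∈ ⋃ s, S.J s, X.1 (t, u) = b t
  phi : ∀ s, ∀ t ∈ I₀, ∀ u ∈ S.J s, X.2 s (t, u) = (deriv b t / 2 + A s) * u + β s t

namespace LatticeSystem

variable {S : LatticeSystem} {X : PointField}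

/-- The form of a symmetry over an interval of times at which the interaction is coupled. -/
theorem IsSymmetry.exists_localForm (hX : S.IsSymmetry X) {I₀ : Set ℝ} (hI₀ : IsOpen I₀)
    (hc : IsPreconnected I₀) (hI : I₀ ⊆ S.I) (hcoup : ∀ t ∈ I₀, S.CoupledAt t) {u₀ : ℝ}
    (hu₀ : u₀ ∈ ⋃ s, S.J s) :
    ∃ A β, X.LocalForm S I₀ (fun t => X.1 (t, u₀)) A β := by
  set b : ℝ → ℝ := fun t => X.1 (t, u₀) with hb
  have hτ := fun {t u : ℝ} (ht : t ∈ I₀) (hu : u ∈ ⋃ s, S.J s) =>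
    contDiffAt_tau hX.1 (p := (t, u)) ⟨hI ht, hu⟩
  have hφ := fun {s : Site} {t u : ℝ} (ht : t ∈ I₀) (hu : u ∈ S.J s) =>
    contDiffAt_phi hX.1 (s := s) (p := (t, u)) ⟨hI ht, hu⟩
  have hJo : IsOpen (⋃ s, S.J s) := isOpen_iUnion S.isOpen_J
  have hsmooth : ContDiffOn ℝ ∞ b I₀ := fun t ht =>
    ((hτ ht hu₀).comp t (contDiffAt_id.prodMk contDiffAt_const)).contDiffWithinAt
  have hτu : ∀ t ∈ I₀, ∀ u ∈ ⋃ s, S.J s, fderiv ℝ X.1 (t, u) (0, 1) = 0 := fun t ht =>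
    hX.fderiv_tau_eq_zero (hcoup t ht)
  have htau : ∀ t ∈ I₀, ∀ u ∈ ⋃ s, S.J s, X.1 (t, u) = b t := by
    intro t ht u hu
    have hd : ∀ u ∈ ⋃ s, S.J s, HasDerivAt (fun u' => X.1 (t, u')) 0 u := fun u hu => by
      have := hasDerivAt_slice_snd ((hτ ht hu).differentiableAt (by simp))
      rwa [hτu t ht u hu] at this
    exact eq_of_hasDerivAt_zero hJo S.ordConnected_iUnion_J.isPreconnected hd hu hu₀
  have hτt : ∀ t ∈ I₀, ∀ u ∈ ⋃ s, S.J s, fderiv ℝ X.1 (t, u) (1, 0) = deriv b t := by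
    intro t ht u hu
    rw [← (hasDerivAt_slice_fst ((hτ ht hu).differentiableAt (by simp))).deriv]
    refine Filter.EventuallyEq.deriv_eq ?_
    filter_upwards [hI₀.mem_nhds ht] with t' ht' using htau t' ht' u hu
  -- second derivatives of `τ`
  have hτtt : ∀ t ∈ I₀, ∀ u ∈ ⋃ s, S.J s,
      fderiv ℝ (fderiv ℝ X.1) (t, u) (1, 0) (1, 0) = deriv (deriv b) t := by
    intro t ht u hu
    rw [← (hasDerivAt_fderiv_slice_fst (hτ ht hu) (1, 0)).deriv]
    refine Filter.EventuallyEq.deriv_eq ?_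
    filter_upwards [hI₀.mem_nhds ht] with t' ht' using hτt t' ht' u hu
  have hτtu : ∀ t ∈ I₀, ∀ u ∈ ⋃ s, S.J s,
      fderiv ℝ (fderiv ℝ X.1) (t, u) (1, 0) (0, 1) = 0 := by
    intro t ht u hu
    refine (hasDerivAt_fderiv_slice_fst (hτ ht hu) (0, 1)).unique
      ((hasDerivAt_const t (0 : ℝ)).congr_of_eventuallyEq ?_)
    filter_upwards [hI₀.mem_nhds ht] with t' ht' using hτu t' ht' u hu
  have hτut : ∀ t ∈ I₀, ∀ u ∈ ⋃ s, S.J s,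
      fderiv ℝ (fderiv ℝ X.1) (t, u) (0, 1) (1, 0) = 0 := by
    intro t ht u hu
    refine (hasDerivAt_fderiv_slice_snd (hτ ht hu) (1, 0)).unique
      ((hasDerivAt_const u (deriv b t)).congr_of_eventuallyEq ?_)
    filter_upwards [hJo.mem_nhds hu] with u' hu' using hτt t ht u' hu'
  choose us hus using S.nonempty_J
  have hform : ∀ s, ∃ A : ℝ, ∀ t ∈ I₀, ∀ u ∈ S.J s,
      X.2 s (t, u) = X.2 s (t, us s) + (deriv b t / 2 + A) * (u - us s) := by
    intro s
    have hJ : ∀ {u}, u ∈ S.J s → u ∈ ⋃ s, S.J s := fun hu => Set.mem_iUnion.2 ⟨s, hu⟩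
    -- Once `τ_u = 0`, the quadratic coefficient makes `φ_s` affine in `u_s`, and the linear one, `2
    -- φ_tu = τ_tt`, fixes its slope as `b'/2` up to a constant `A`.
    have hφuu : ∀ p ∈ I₀ ×ˢ S.J s, fderiv ℝ (fderiv ℝ (X.2 s)) p (0, 1) (0, 1) = 0 := by
      refine eq_zero_of_dense hI₀ hI
        (fun p hp => continuousAt_snd_fderiv (hφ hp.1 hp.2) _ _) fun q hq hqI => ?_
      have := (hX.determining hq).2.2.1
      rw [hτtu _ hqI _ (hJ (mem_J hq)), hτut _ hqI _ (hJ (mem_J hq))] at this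
      simpa using this
    have hφut : ∀ p ∈ I₀ ×ˢ S.J s, fderiv ℝ (fderiv ℝ (X.2 s)) p (1, 0) (0, 1)
        + fderiv ℝ (fderiv ℝ (X.2 s)) p (0, 1) (1, 0)
        - fderiv ℝ (fderiv ℝ X.1) p (1, 0) (1, 0) = 0 := by
      refine eq_zero_of_dense hI₀ hI (fun p hp => ?_) fun q hq hqI => ?_
      · exact ((continuousAt_snd_fderiv (hφ hp.1 hp.2) _ _).add
          (continuousAt_snd_fderiv (hφ hp.1 hp.2) _ _)).sub
          (continuousAt_snd_fderiv (hτ hp.1 (hJ hp.2)) _ _)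
      · have := (hX.determining hq).2.1
        rw [hτu _ hqI _ (hJ (mem_J hq))] at this
        simpa using this
    have hφu : ∀ t ∈ I₀, ∀ u ∈ S.J s,
        fderiv ℝ (X.2 s) (t, u) (0, 1) = fderiv ℝ (X.2 s) (t, us s) (0, 1) := by
      intro t ht u hu
      have hd : ∀ u ∈ S.J s, HasDerivAt (fun u' => fderiv ℝ (X.2 s) (t, u') (0, 1)) 0 u :=
        fun u hu => by
          have := hasDerivAt_fderiv_slice_snd (hφ ht hu) (0, 1)
          rwa [hφuu (t, u) ⟨ht, hu⟩] at this
      exact eq_of_hasDerivAt_zero (S.isOpen_J s) (S.ordConnected_J s).isPreconnected hd hu (hus s)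
    have hα : ∀ t ∈ I₀, HasDerivAt
        (fun t => fderiv ℝ (X.2 s) (t, us s) (0, 1) - deriv b t / 2) 0 t := by
      intro t ht
      have h1 := hasDerivAt_fderiv_slice_fst (hφ ht (hus s)) (0, 1)
      have hbd : DifferentiableAt ℝ (deriv b) t :=
        (contDiffAt_deriv (hsmooth.contDiffAt (hI₀.mem_nhds ht))).differentiableAt (by simp)
      have h2 := h1.sub (hbd.hasDerivAt.div_const 2)
      have h3 := hφut (t, us s) ⟨ht, hus s⟩
      have h4 : fderiv ℝ (fderiv ℝ (X.2 s)) (t, us s) (0, 1) (1, 0)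
          = fderiv ℝ (fderiv ℝ (X.2 s)) (t, us s) (1, 0) (0, 1) :=
        ((hφ ht (hus s)).isSymmSndFDerivAt (by simp; exact WithTop.coe_le_coe.2 le_top)).eq _ _
      rw [hτtt t ht _ (hJ (hus s)), h4] at h3
      exact h2.congr_deriv (by linarith)
    obtain ⟨A, hA⟩ : ∃ A : ℝ, ∀ t ∈ I₀,
        fderiv ℝ (X.2 s) (t, us s) (0, 1) - deriv b t / 2 = A := by
      rcases I₀.eq_empty_or_nonempty with h | ⟨t₀, ht₀⟩
      · exact ⟨0, by simp [h]⟩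
      · exact ⟨_, fun t ht => eq_of_hasDerivAt_zero hI₀ hc hα ht ht₀⟩
    refine ⟨A, fun t ht u hu => ?_⟩
    have hd : ∀ u ∈ S.J s, HasDerivAt
        (fun u' => X.2 s (t, u') - (deriv b t / 2 + A) * (u' - us s)) 0 u := fun u hu => by
      have h1 := hasDerivAt_slice_snd ((hφ ht hu).differentiableAt (by simp))
      rw [hφu t ht u hu] at h1
      have h2 := h1.sub (((hasDerivAt_id u).sub_const (us s)).const_mul (deriv b t / 2 + A))
      exact h2.congr_deriv (by linarith [hA t ht])
    have := eq_of_hasDerivAt_zero (S.isOpen_J s) (S.ordConnected_J s).isPreconnected hd hu (hus s)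
    simp only [sub_self, mul_zero, sub_zero] at this
    linarith
  choose A hA using hform
  refine ⟨A, fun s t => X.2 s (t, us s) - (deriv b t / 2 + A s) * us s, hsmooth, fun s => ?_, htau,
    fun s t ht u hu => by rw [hA s t ht u hu]; ring⟩
  intro t ht
  have h1 : ContDiffAt ℝ ∞ (fun t => X.2 s (t, us s)) t :=
    (hφ ht (hus s)).comp t (contDiffAt_id.prodMk contDiffAt_const)
  have h2 : ContDiffAt ℝ ∞ (deriv b) t :=
    contDiffAt_deriv (hsmooth.contDiffAt (hI₀.mem_nhds ht))
  exact (h1.sub (((h2.div_const 2).add contDiffAt_const).mul contDiffAt_const)).contDiffWithinAt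

end LatticeSystem

/-- An affine function which vanishes on a nonempty open set vanishes. -/
theorem affine_eq_zero_of_isOpen {J : Set ℝ} (hJ : IsOpen J) (hne : J.Nonempty) {a c : ℝ}
    (h : ∀ u ∈ J, a * u + c = 0) : a = 0 ∧ c = 0 := by
  obtain ⟨u, hu⟩ := hne
  have h1 : HasDerivAt (fun u => a * u + c) a u := by
    simpa using ((hasDerivAt_id u).const_mul a).add_const c
  have h2 : a = 0 := h1.unique <| (hasDerivAt_const u (0 : ℝ)).congr_of_eventuallyEq <| by
    filter_upwards [hJ.mem_nhds hu] with u' hu' using h u' hu'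
  have := h u hu
  rw [h2] at this
  exact ⟨h2, by linarith⟩

theorem fderiv_apply_eq_partials (g : ℝ × (Stencil → ℝ) → ℝ) (q : ℝ × (Stencil → ℝ)) (a : ℝ)
    (w : Stencil → ℝ) :
    fderiv ℝ g q (a, w) = a * partialT g q + ∑ δ, w δ * partialU δ g q := by
  have h : ((a, w) : ℝ × (Stencil → ℝ)) = a • (1, 0)
      + ∑ δ, w δ • ((0, Pi.single δ 1) : ℝ × (Stencil → ℝ)) := by
    ext x
    · simp [Prod.fst_sum]
    · simp [Prod.snd_sum, Finset.sum_apply, Pi.single_apply]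
  conv_lhs => rw [h]
  simp only [map_add, map_sum, map_smul, partialT, partialU, smul_eq_mul]

namespace PointField.LocalForm

variable {S : LatticeSystem} {X Y Z : PointField} {I₀ : Set ℝ} {b b₁ b₂ b₃ : ℝ → ℝ}
  {A A₁ A₂ A₃ : Site → ℝ} {β β₁ β₂ β₃ : Site → ℝ → ℝ}

theorem contDiffAt_b (h : X.LocalForm S I₀ b A β) (hI₀ : IsOpen I₀) {t : ℝ} (ht : t ∈ I₀) :
    ContDiffAt ℝ ∞ b t := h.smooth_b.contDiffAt (hI₀.mem_nhds ht)

theorem contDiffAt_β (h : X.LocalForm S I₀ b A β) (hI₀ : IsOpen I₀) (s : Site) {t : ℝ}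
    (ht : t ∈ I₀) : ContDiffAt ℝ ∞ (β s) t := (h.smooth_β s).contDiffAt (hI₀.mem_nhds ht)

theorem mono (h : X.LocalForm S I₀ b A β) {I₁ : Set ℝ} (hI : I₁ ⊆ I₀) :
    X.LocalForm S I₁ b A β :=
  ⟨h.smooth_b.mono hI, fun s => (h.smooth_β s).mono hI, fun t ht => h.tau t (hI ht),
    fun s t ht => h.phi s t (hI ht)⟩

theorem at_eq (h : X.LocalForm S I₀ b A β) {s : Site} {p : ℝ × ℝ} (hp : p ∈ I₀ ×ˢ S.J s) :
    X.at s p = (b p.1, (deriv b p.1 / 2 + A s) * p.2 + β s p.1) :=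
  Prod.ext (h.tau _ hp.1 _ (Set.mem_iUnion.2 ⟨s, hp.2⟩)) (h.phi s _ hp.1 _ hp.2)

theorem fderiv_at (h : X.LocalForm S I₀ b A β) (hI₀ : IsOpen I₀) {s : Site} {p : ℝ × ℝ}
    (hp : p ∈ I₀ ×ˢ S.J s) (a c : ℝ) :
    fderiv ℝ (X.at s) p (a, c) = (deriv b p.1 * a,
      (deriv (deriv b) p.1 / 2 * p.2 + deriv (β s) p.1) * a + (deriv b p.1 / 2 + A s) * c) := by
  have hev : X.at s =ᶠ[nhds p] fun p => (b p.1, (deriv b p.1 / 2 + A s) * p.2 + β s p.1) := by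
    filter_upwards [(hI₀.prod (S.isOpen_J s)).mem_nhds hp] with p' hp' using h.at_eq hp'
  have hfst : HasFDerivAt (Prod.fst : ℝ × ℝ → ℝ) (ContinuousLinearMap.fst ℝ ℝ ℝ) p :=
    hasFDerivAt_fst
  have h1 : HasFDerivAt (fun p : ℝ × ℝ => b p.1) _ p :=
    ((h.contDiffAt_b hI₀ hp.1).differentiableAt (by simp)).hasDerivAt.comp_hasFDerivAt p
      hfst
  have h2 : HasFDerivAt (fun p : ℝ × ℝ => deriv b p.1) _ p :=
    ((contDiffAt_deriv (h.contDiffAt_b hI₀ hp.1)).differentiableAt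
      (by simp)).hasDerivAt.comp_hasFDerivAt p hfst
  have h3 : HasFDerivAt (fun p : ℝ × ℝ => β s p.1) _ p :=
    ((h.contDiffAt_β hI₀ s hp.1).differentiableAt (by simp)).hasDerivAt.comp_hasFDerivAt p
      hfst
  have h4 := h1.prodMk ((((h2.mul_const (1 / 2)).add_const (A s)).mul hasFDerivAt_snd).add h3)
  have h5 : HasFDerivAt (fun p : ℝ × ℝ => (b p.1, (deriv b p.1 / 2 + A s) * p.2 + β s p.1)) _ p :=
    h4.congr_of_eventuallyEq (Filter.Eventually.of_forall fun p => by simp [div_eq_mul_inv])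
  rw [hev.fderiv_eq, h5.fderiv]
  simp
  ring

/-- The products of the two slopes cancel in the bracket, so its coefficient of `u_s` is `(b₁ b₂'' -
b₂ b₁'')/2`, which is already `b₃'/2`. Nothing remains for `A₃`: the constants `A` disappear on
brackets. -/
theorem lie (hI₀ : IsOpen I₀) (hX : X.LocalForm S I₀ b₁ A₁ β₁) (hY : Y.LocalForm S I₀ b₂ A₂ β₂)
    (hZ : Z.LocalForm S I₀ b₃ A₃ β₃)
    (hlie : ∀ s, ∀ p ∈ I₀ ×ˢ S.J s, Z.at s p = VectorField.lieBracket ℝ (X.at s) (Y.at s) p) :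
    ∀ t ∈ I₀, b₃ t = b₁ t * deriv b₂ t - b₂ t * deriv b₁ t ∧ ∀ s, A₃ s = 0 ∧
      β₃ s t = b₁ t * deriv (β₂ s) t - b₂ t * deriv (β₁ s) t
        + β₁ s t * (deriv b₂ t / 2 + A₂ s) - β₂ s t * (deriv b₁ t / 2 + A₁ s) := by
  have key : ∀ s, ∀ t ∈ I₀, ∀ u ∈ S.J s, b₃ t = b₁ t * deriv b₂ t - b₂ t * deriv b₁ t ∧
      (deriv b₃ t / 2 + A₃ s) * u + β₃ s t =
        (deriv (deriv b₂) t / 2 * u + deriv (β₂ s) t) * b₁ t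
          + (deriv b₂ t / 2 + A₂ s) * ((deriv b₁ t / 2 + A₁ s) * u + β₁ s t)
        - ((deriv (deriv b₁) t / 2 * u + deriv (β₁ s) t) * b₂ t
          + (deriv b₁ t / 2 + A₁ s) * ((deriv b₂ t / 2 + A₂ s) * u + β₂ s t)) := by
    intro s t ht u hu
    have hp : ((t, u) : ℝ × ℝ) ∈ I₀ ×ˢ S.J s := ⟨ht, hu⟩
    have h := hlie s _ hp
    rw [VectorField.lieBracket_eq] at h
    simp only [hX.at_eq hp, hY.at_eq hp, hZ.at_eq hp, hX.fderiv_at hI₀ hp,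
      hY.fderiv_at hI₀ hp, Prod.mk_sub_mk, Prod.mk.injEq] at h
    exact ⟨by linarith [h.1], h.2⟩
  have hb : ∀ t ∈ I₀, b₃ t = b₁ t * deriv b₂ t - b₂ t * deriv b₁ t := fun t ht => by
    obtain ⟨u, hu⟩ := S.nonempty_J (0, 0)
    exact (key _ t ht u hu).1
  have hb' : ∀ t ∈ I₀, deriv b₃ t = b₁ t * deriv (deriv b₂) t - b₂ t * deriv (deriv b₁) t := by
    intro t ht
    have hev : b₃ =ᶠ[nhds t] fun t => b₁ t * deriv b₂ t - b₂ t * deriv b₁ t := by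
      filter_upwards [hI₀.mem_nhds ht] with t' ht' using hb t' ht'
    have d1 := ((hX.contDiffAt_b hI₀ ht).differentiableAt (by simp)).hasDerivAt
    have d2 := ((hY.contDiffAt_b hI₀ ht).differentiableAt (by simp)).hasDerivAt
    have d1' := ((contDiffAt_deriv (hX.contDiffAt_b hI₀ ht)).differentiableAt (by simp)).hasDerivAt
    have d2' := ((contDiffAt_deriv (hY.contDiffAt_b hI₀ ht)).differentiableAt (by simp)).hasDerivAt
    rw [hev.deriv_eq]
    exact (((d1.mul d2').sub (d2.mul d1')).congr_deriv (by ring)).deriv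
  intro t ht
  refine ⟨hb t ht, fun s => ?_⟩
  have haff := affine_eq_zero_of_isOpen (S.isOpen_J s) (S.nonempty_J s)
    (a := A₃ s) (c := β₃ s t - (b₁ t * deriv (β₂ s) t - b₂ t * deriv (β₁ s) t
        + β₁ s t * (deriv b₂ t / 2 + A₂ s) - β₂ s t * (deriv b₁ t / 2 + A₁ s))) (fun u hu => by
      have h := (key s t ht u hu).2
      rw [hb' t ht] at h
      linear_combination h)
  exact ⟨haff.1, by linarith [haff.2]⟩

theorem fderiv_tau_phi (hI₀ : IsOpen I₀) (hI : I₀ ⊆ S.I) (hX : X.IsSmoothOn S)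
    (h : X.LocalForm S I₀ b A β) {s : Site} {p : ℝ × ℝ} (hp : p ∈ I₀ ×ˢ S.J s) (a c : ℝ) :
    fderiv ℝ X.1 p (a, c) = deriv b p.1 * a ∧ fderiv ℝ (X.2 s) p (a, c) =
      (deriv (deriv b) p.1 / 2 * p.2 + deriv (β s) p.1) * a + (deriv b p.1 / 2 + A s) * c := by
  have hp' : p ∈ S.I ×ˢ S.J s := ⟨hI hp.1, hp.2⟩
  have h1 := (LatticeSystem.contDiffAt_tau hX (LatticeSystem.box_subset hp')).differentiableAt
    (by simp)
  have h2 := (LatticeSystem.contDiffAt_phi hX hp').differentiableAt (by simp)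
  have h3 : fderiv ℝ (X.at s) p = _ := h1.fderiv_prodMk h2
  have h4 := h.fderiv_at hI₀ hp a c
  rw [h3] at h4
  exact ⟨congrArg Prod.fst h4, congrArg Prod.snd h4⟩

/-- The symmetry condition for a field of the given form. -/
theorem prolongationDelta_eq (hI₀ : IsOpen I₀) (hI : I₀ ⊆ S.I) (hX : X.IsSmoothOn S)
    (h : X.LocalForm S I₀ b A β) {s : Site} {q : ℝ × (Stencil → ℝ)} (hq : q ∈ S.Ω s)
    (hqI : q.1 ∈ I₀) (v w : ℝ) :
    X.prolongationDelta S s q v w =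
      deriv (deriv (deriv b)) q.1 / 2 * q.2 origin + deriv (deriv (β s)) q.1
        + (A s - 3 / 2 * deriv b q.1) * w
        - fderiv ℝ (S.F s) q
          (b q.1, fun δ => (deriv b q.1 / 2 + A (s + δ)) * q.2 δ + β (s + δ) q.1) := by
  have hJ := LatticeSystem.mem_J hq
  have hbox := LatticeSystem.mem_siteBox hq
  have hφ := LatticeSystem.contDiffAt_phi hX hbox
  have hτ := LatticeSystem.contDiffAt_tau hX (LatticeSystem.box_subset hbox)
  have hd : ∀ t ∈ I₀, ∀ u ∈ S.J s, ∀ a c : ℝ, fderiv ℝ X.1 (t, u) (a, c) = deriv b t * a ∧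
      fderiv ℝ (X.2 s) (t, u) (a, c)
        = (deriv (deriv b) t / 2 * u + deriv (β s) t) * a + (deriv b t / 2 + A s) * c :=
    fun t ht u hu => h.fderiv_tau_phi hI₀ hI hX (p := (t, u)) ⟨ht, hu⟩
  have evt : ∀ᶠ t in nhds q.1, t ∈ I₀ := hI₀.mem_nhds hqI
  have evu : ∀ᶠ u in nhds (q.2 origin), u ∈ S.J s := (S.isOpen_J s).mem_nhds hJ
  have db := (contDiffAt_deriv (h.contDiffAt_b hI₀ hqI))
  have db1 := (db.differentiableAt (by simp)).hasDerivAt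
  have db2 := ((contDiffAt_deriv db).differentiableAt (by simp)).hasDerivAt
  have dβ := ((contDiffAt_deriv (h.contDiffAt_β hI₀ s hqI)).differentiableAt
    (by simp)).hasDerivAt
  -- second derivatives of `τ`
  have t1 : ∀ a c : ℝ, fderiv ℝ (fderiv ℝ X.1) (q.1, q.2 origin) (1, 0) (a, c)
      = deriv (deriv b) q.1 * a := fun a c =>
    (hasDerivAt_fderiv_slice_fst hτ _).unique ((db1.mul_const a).congr_of_eventuallyEq
      (evt.mono fun t ht => (hd t ht _ hJ a c).1))
  have t2 : ∀ a c : ℝ, fderiv ℝ (fderiv ℝ X.1) (q.1, q.2 origin) (0, 1) (a, c) = 0 := fun a c =>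
    (hasDerivAt_fderiv_slice_snd hτ _).unique ((hasDerivAt_const _ _).congr_of_eventuallyEq
      (evu.mono fun u hu => (hd _ hqI u hu a c).1))
  -- second derivatives of `φ_s`
  have f1 : ∀ a c : ℝ, fderiv ℝ (fderiv ℝ (X.2 s)) (q.1, q.2 origin) (1, 0) (a, c)
      = (deriv (deriv (deriv b)) q.1 / 2 * q.2 origin + deriv (deriv (β s)) q.1) * a
        + deriv (deriv b) q.1 / 2 * c := fun a c =>
    (hasDerivAt_fderiv_slice_fst hφ _).unique ((((((db2.div_const 2).mul_const _).add
      dβ).mul_const a).add (((db1.div_const 2).add_const (A s)).mul_const c)).congr_of_eventuallyEq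
      (evt.mono fun t ht => (hd t ht _ hJ a c).2))
  have f2 : ∀ a c : ℝ, fderiv ℝ (fderiv ℝ (X.2 s)) (q.1, q.2 origin) (0, 1) (a, c)
      = deriv (deriv b) q.1 / 2 * a := fun a c => by
    refine (hasDerivAt_fderiv_slice_snd hφ _).unique (HasDerivAt.congr_of_eventuallyEq ?_
      (evu.mono fun u hu => (hd _ hqI u hu a c).2))
    simpa using (((((hasDerivAt_id (q.2 origin)).const_mul (deriv (deriv b) q.1 / 2)).add_const
      (deriv (β s) q.1)).mul_const a).add_const ((deriv b q.1 / 2 + A s) * c))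
  have hs : ∀ δ : Stencil, X.2 (s + δ) (q.1, q.2 δ)
      = (deriv b q.1 / 2 + A (s + δ)) * q.2 δ + β (s + δ) q.1 := fun δ =>
    h.phi _ _ hqI _ ((S.mem_box s q hq).2 δ)
  rw [LatticeSystem.prolongationDelta_eq hX hq, bilin_velocity _ v,
    bilin_velocity (fderiv ℝ (fderiv ℝ X.1) (q.1, q.2 origin)) v, t1, t1, t2, t2, f1, f1, f2, f2,
    (hd _ hqI _ hJ _ _).1, (hd _ hqI _ hJ _ _).1, (hd _ hqI _ hJ _ _).2,
    h.tau _ hqI _ (Set.mem_iUnion.2 ⟨s, hJ⟩), fderiv_apply_eq_partials]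
  simp only [hs]
  ring

/-- The determining equation for the right-hand side of the system. -/
theorem rhs_equation (hI₀ : IsOpen I₀) (hI : I₀ ⊆ S.I) (hX : S.IsSymmetry X)
    (h : X.LocalForm S I₀ b A β) {s : Site} {q : ℝ × (Stencil → ℝ)} (hq : q ∈ S.Ω s)
    (hqI : q.1 ∈ I₀) :
    fderiv ℝ (S.F s) q
        (b q.1, fun δ => (deriv b q.1 / 2 + A (s + δ)) * q.2 δ + β (s + δ) q.1) =
      deriv (deriv (deriv b)) q.1 / 2 * q.2 origin + deriv (deriv (β s)) q.1
        + (A s - 3 / 2 * deriv b q.1) * S.F s q := by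
  have e := hX.2 s q hq 0 (S.F s q) (sub_self _)
  rw [h.prolongationDelta_eq hI₀ hI hX.1 hq hqI] at e
  linarith

end PointField.LocalForm

/-! ### Simple symmetry algebras near a coupled time. -/

/-- The vector field at the site `s`, as a linear function of the point field. -/
def siteField (s : Site) : PointField →ₗ[ℝ] (ℝ × ℝ → ℝ × ℝ) where
  toFun X := X.at s
  map_add' _ _ := rfl
  map_smul' _ _ := rfl

/-- The coefficient of `∂_t` along the line `u = u₀`, as a linear function of the point field. -/
def timeField (u₀ : ℝ) : PointField →ₗ[ℝ] (ℝ → ℝ) where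
  toFun X := fun t => X.1 (t, u₀)
  map_add' _ _ := rfl
  map_smul' _ _ := rfl

namespace LatticeSystem

variable {S : LatticeSystem}

theorem CoupledAt.eventually {t₀ : ℝ} (h : S.CoupledAt t₀) : ∀ᶠ t in nhds t₀, S.CoupledAt t := by
  obtain ⟨s, δ, u, hu, hδ⟩ := h
  have hline : ContinuousAt (fun t : ℝ => (t, u)) t₀ :=
    continuousAt_id.prodMk continuousAt_const
  have hc : ContinuousAt (fun t => partialU δ (S.F s) (t, u)) t₀ := by
    have h1 : ContinuousAt (fderiv ℝ (S.F s)) (t₀, u) :=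
      ((contDiffAt_F hu).fderiv_right (m := ∞) (by simp)).continuousAt
    exact (ContinuousAt.comp (f := fun t : ℝ => (t, u)) h1 hline).clm_apply continuousAt_const
  filter_upwards [hline.eventually_mem ((S.isOpen_Ω s).mem_nhds hu), hc.eventually_ne hδ]
    with t h1 h2 using ⟨s, δ, u, h1, h2⟩

theorem IsNonlinearCoupled.exists_coupledAt (h : S.IsNonlinearCoupled) : ∃ t, S.CoupledAt t := by
  obtain ⟨q, hq, hne⟩ := h.2 (0, 0) ⟨(1, 0), by simp [stencil]⟩
  exact ⟨q.1, (0, 0), ⟨⟨(1, 0), by simp [stencil]⟩, fun h => by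
    simpa [origin] using congrArg (fun d : Stencil => d.val.1) h⟩, q.2, hq, hne⟩

end LatticeSystem

section SymmetryAlgebra

variable {S : LatticeSystem} {𝔤 : Type*} [LieRing 𝔤] [LieAlgebra ℝ 𝔤]
  [LieAlgebra.IsSimple ℝ 𝔤] {ρ : 𝔤 →ₗ[ℝ] PointField}

/-- A simple symmetry algebra does not vanish on a nonempty open set of times. -/
theorem LatticeSystem.IsSymmetryAlgebra.not_vanish [FiniteDimensional ℝ 𝔤] (hρ : S.IsSymmetryAlgebra ρ) {I₁ : Set ℝ}
    (hI₁ : IsOpen I₁) (hne : I₁.Nonempty) (hI : I₁ ⊆ S.I)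
    (h0 : ∀ x s, ∀ p ∈ I₁ ×ˢ S.J s, (ρ x).at s p = 0) : False := by
  apply LieAlgebra.IsSimple.non_abelian ℝ (L := 𝔤)
  have hz : ∀ x, x = (0 : 𝔤) := by
    intro x
    refine hρ.faithful x fun s => ?_
    refine eq_zero_of_eq_zero_on_open ((siteField s).comp ρ)
      (LatticeSystem.isOpen_box (S := S) (s := s))
      (S.ordConnected_I.isPreconnected.prod (S.ordConnected_J s).isPreconnected)
      (fun x => ?_) (fun x z p hp => hρ.map_lie x z s p hp) (hI₁.prod (S.isOpen_J s)) ?_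
      (fun x p hp => h0 x s p hp) x
    · exact ((hρ.isSymmetry x).1.1.mono LatticeSystem.box_subset).prodMk
        ((hρ.isSymmetry x).1.2 s)
    · obtain ⟨t, ht⟩ := hne
      obtain ⟨u, hu⟩ := S.nonempty_J s
      exact ⟨(t, u), ⟨hI ht, hu⟩, ht, hu⟩
  exact ⟨fun x y => hz _⟩

/-- Over an interval of times at which the interaction is coupled, the fields of a simple symmetry
algebra have the form `b ∂_t + (b'/2 u_s + β_s) ∂_{u_s}`. -/
theorem LatticeSystem.IsSymmetryAlgebra.exists_localForm (hρ : S.IsSymmetryAlgebra ρ) {I₀ : Set ℝ}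
    (hI₀ : IsOpen I₀) (hc : IsPreconnected I₀) (hI : I₀ ⊆ S.I)
    (hcoup : ∀ t ∈ I₀, S.CoupledAt t) {u₀ : ℝ} (hu₀ : u₀ ∈ ⋃ s, S.J s) (hne : I₀.Nonempty) (x : 𝔤) :
    ∃ β, (ρ x).LocalForm S I₀ (timeField u₀ (ρ x)) 0 β := by
  have hform : ∀ x, ∃ A β, (ρ x).LocalForm S I₀ (timeField u₀ (ρ x)) A β := fun x =>
    (hρ.isSymmetry x).exists_localForm hI₀ hc hI hcoup hu₀
  have hdiff : ∀ x, ∀ t ∈ I₀, DifferentiableAt ℝ (timeField u₀ (ρ x)) t := fun x t ht => by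
    obtain ⟨A, β, h⟩ := hform x
    exact (h.contDiffAt_b hI₀ ht).differentiableAt (by simp)
  let P : Submodule ℝ 𝔤 :=
    { carrier := {x | ∃ β, (ρ x).LocalForm S I₀ (timeField u₀ (ρ x)) 0 β}
      add_mem' := by
        rintro x y ⟨β, h⟩ ⟨γ, k⟩
        refine ⟨fun s t => β s t + γ s t, ?_⟩
        rw [map_add, map_add]
        refine ⟨h.smooth_b.add k.smooth_b, fun s => (h.smooth_β s).add (k.smooth_β s),
          fun t ht u hu => congrArg₂ (· + ·) (h.tau t ht u hu) (k.tau t ht u hu),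
          fun s t ht u hu => ?_⟩
        rw [((hdiff x t ht).hasDerivAt.add (hdiff y t ht).hasDerivAt).deriv]
        refine (congrArg₂ (· + ·) (h.phi s t ht u hu) (k.phi s t ht u hu)).trans ?_
        simp only [Pi.zero_apply]; ring
      zero_mem' := by
        refine ⟨fun _ _ => 0, ?_⟩
        rw [map_zero, map_zero]
        refine ⟨contDiffOn_const, fun s => contDiffOn_const, fun t ht u hu => rfl,
          fun s t ht u hu => ?_⟩
        have : deriv (0 : ℝ → ℝ) t = 0 := deriv_const t (0 : ℝ)
        rw [this]
        simp
      smul_mem' := by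
        rintro c x ⟨β, h⟩
        refine ⟨fun s t => c * β s t, ?_⟩
        rw [map_smul, map_smul]
        refine ⟨contDiffOn_const.smul h.smooth_b, fun s => contDiffOn_const.mul (h.smooth_β s),
          fun t ht u hu => congrArg (c * ·) (h.tau t ht u hu), fun s t ht u hu => ?_⟩
        rw [((hdiff x t ht).hasDerivAt.const_smul c).deriv]
        refine (congrArg (c * ·) (h.phi s t ht u hu)).trans ?_
        simp only [Pi.zero_apply, smul_eq_mul]; ring }
  have hP : P = ⊤ := by
    rw [eq_top_iff, ← span_lie_eq_top, Submodule.span_le]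
    rintro _ ⟨x, y, rfl⟩
    obtain ⟨A₁, β₁, h₁⟩ := hform x
    obtain ⟨A₂, β₂, h₂⟩ := hform y
    obtain ⟨A₃, β₃, h₃⟩ := hform ⁅x, y⁆
    obtain ⟨t, ht⟩ := hne
    have hA : A₃ = 0 := funext fun s =>
      ((h₁.lie hI₀ h₂ h₃ (fun s p hp => hρ.map_lie x y s p ⟨hI hp.1, hp.2⟩) t ht).2 s).1
    exact ⟨β₃, hA ▸ h₃⟩
  have : x ∈ P := hP ▸ Submodule.mem_top
  exact this

/-- Near a time at which the interaction is coupled, a simple symmetry algebra has a basis with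
the canonical brackets whose first field is transversal to the fibres. -/
theorem LatticeSystem.IsSymmetryAlgebra.exists_basis [FiniteDimensional ℝ 𝔤]
    (hρ : S.IsSymmetryAlgebra ρ) {t₀ : ℝ} (ht₀ : S.CoupledAt t₀) :
    ∃ (e : Module.Basis (Fin 3) ℝ 𝔤) (r : ℝ) (b : Fin 3 → ℝ → ℝ) (β : Fin 3 → Site → ℝ → ℝ),
      HasCanonicalBrackets e ∧ 0 < r ∧ Metric.ball t₀ r ⊆ S.I ∧
      (∀ i, (ρ (e i)).LocalForm S (Metric.ball t₀ r) (b i) 0 (β i)) ∧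
      ∀ t ∈ Metric.ball t₀ r, 0 < b 0 t := by
  have ht₀I : t₀ ∈ S.I := by
    obtain ⟨s, δ, u, hu, -⟩ := ht₀
    exact (S.mem_box s _ hu).1
  obtain ⟨r, hr, hball⟩ := Metric.eventually_nhds_iff_ball.1
    (ht₀.eventually.and (S.isOpen_I.mem_nhds ht₀I))
  set I₀ := Metric.ball t₀ r with hI₀def
  have hI₀ : IsOpen I₀ := Metric.isOpen_ball
  have hc : IsPreconnected I₀ := (convex_ball t₀ r).isPreconnected
  have ht₀' : t₀ ∈ I₀ := Metric.mem_ball_self hr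
  have hI : I₀ ⊆ S.I := fun t ht => (hball t ht).2
  obtain ⟨u₀, hu₀⟩ := S.nonempty_J (0, 0)
  replace hu₀ : u₀ ∈ ⋃ s, S.J s := Set.mem_iUnion.2 ⟨_, hu₀⟩
  let V : 𝔤 →ₗ[ℝ] (ℝ → ℝ) := (timeField u₀).comp ρ
  have hex : ∀ x, ∃ β, (ρ x).LocalForm S I₀ (V x) 0 β := fun x =>
    hρ.exists_localForm hI₀ hc hI (fun t ht => (hball t ht).1) hu₀ ⟨t₀, ht₀'⟩ x
  choose β hform using hex
  have hlie : ∀ x y, ∀ t ∈ I₀, V ⁅x, y⁆ t = V x t * deriv (V y) t - V y t * deriv (V x) t ∧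
      ∀ s, (0 : Site → ℝ) s = 0 ∧
      β ⁅x, y⁆ s t = V x t * deriv (β y s) t - V y t * deriv (β x s) t
        + β x s t * (deriv (V y) t / 2 + (0 : Site → ℝ) s)
        - β y s t * (deriv (V x) t / 2 + (0 : Site → ℝ) s) := fun x y =>
    (hform x).lie hI₀ (hform y) (hform ⁅x, y⁆) (fun s p hp => hρ.map_lie x y s p ⟨hI hp.1, hp.2⟩)
  have hsm : ∀ x, ContDiffAt ℝ ∞ (V x) t₀ := fun x => (hform x).contDiffAt_b hI₀ ht₀'
  -- some field has a nonvanishing first derivative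
  have hjet : ∃ x, deriv (V x) t₀ ≠ 0 := by
    by_contra! h0
    have hzero : ∀ᶠ t in nhds t₀, ∀ x, V x t = 0 := by
      refine eventually_eq_zero_of_fderiv_eq_zero V t₀ ?_
        (fun x => ((hsm x).fderiv_right (m := ∞) (by simp)).continuousAt) fun x => ?_
      · filter_upwards [hI₀.mem_nhds ht₀'] with t ht x z
        rw [(hlie x z t ht).1, VectorField.lieBracket_eq]
        simp only [fderiv_eq_smul_deriv, smul_eq_mul]
      · ext
        rw [fderiv_eq_smul_deriv, h0]
        simp
    obtain ⟨r', hr', hball'⟩ := Metric.eventually_nhds_iff_ball.1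
      (hzero.and (hI₀.mem_nhds ht₀'))
    set I₁ := Metric.ball t₀ r' with hI₁def
    have hI₁ : IsOpen I₁ := Metric.isOpen_ball
    have hI₁₀ : I₁ ⊆ I₀ := fun t ht => (hball' t ht).2
    have hV : ∀ x, ∀ t ∈ I₁, V x t = 0 := fun x t ht => (hball' t ht).1 x
    have hV' : ∀ x, ∀ t ∈ I₁, deriv (V x) t = 0 := fun x t ht => by
      have : V x =ᶠ[nhds t] fun _ => 0 := by
        filter_upwards [hI₁.mem_nhds ht] with t' ht' using hV x t' ht'
      rw [this.deriv_eq, deriv_const]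
    refine hρ.not_vanish hI₁ ⟨t₀, Metric.mem_ball_self hr'⟩ (hI₁₀.trans hI) ?_
    intro x s p hp
    -- With `b` zero and `A` zero the fields are `β_s(t) ∂_{u_s}`. These commute, so evaluation at
    -- `p` kills all brackets and therefore vanishes.
    let L : 𝔤 →ₗ[ℝ] ℝ × ℝ := (LinearMap.proj p).comp ((siteField s).comp ρ)
    refine linearMap_eq_zero_of_lie L (fun x y => ?_) x
    have hp' : p ∈ I₀ ×ˢ S.J s := ⟨hI₁₀ hp.1, hp.2⟩
    have h1 := (hform ⁅x, y⁆).at_eq hp'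
    rw [((hlie x y p.1 hp'.1).2 s).2, hV' _ _ hp.1, hV' _ _ hp.1, hV' _ _ hp.1, hV _ _ hp.1,
      hV _ _ hp.1, hV _ _ hp.1] at h1
    refine h1.trans ?_
    simp
  -- Taylor series at `t₀`
  let T : 𝔤 →ₗ[ℝ] PowerSeries ℝ :=
    { toFun := fun x => taylor t₀ (V x)
      map_add' := fun x y => by rw [map_add, taylor_add (hsm x) (hsm y)]
      map_smul' := fun c x => by rw [map_smul, taylor_smul]; rfl }
  obtain ⟨e, he, he0⟩ := exists_canonicalBasis T (fun x y => by
    have hev : V ⁅x, y⁆ =ᶠ[nhds t₀] V x * deriv (V y) - V y * deriv (V x) := by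
      filter_upwards [hI₀.mem_nhds ht₀'] with t ht using (hlie x y t ht).1
    show taylor t₀ (V ⁅x, y⁆) = _
    have hx := contDiffAt_deriv (hsm x)
    have hy := contDiffAt_deriv (hsm y)
    rw [taylor_congr hev, taylor_sub (f := V x * deriv (V y)) (g := V y * deriv (V x)) ((hsm x).mul hy) ((hsm y).mul hx), taylor_mul (hsm x) hy,
      taylor_mul (hsm y) hx, taylor_deriv, taylor_deriv]
    rfl) (by
    obtain ⟨x, hx⟩ := hjet
    refine ⟨x, ?_⟩
    show PowerSeries.coeff 1 (taylor t₀ (V x)) ≠ 0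
    simpa [coeff_taylor] using hx)
  have he0' : V (e 0) t₀ = 1 := by
    have : PowerSeries.coeff 0 (taylor t₀ (V (e 0))) = 1 := he0
    simpa [coeff_taylor] using this
  have hpos : ∀ᶠ t in nhds t₀, 0 < V (e 0) t :=
    continuousAt_const.eventually_lt (hsm (e 0)).continuousAt (by rw [he0']; exact one_pos)
  obtain ⟨r', hr', hball'⟩ := Metric.eventually_nhds_iff_ball.1 (hpos.and (hI₀.mem_nhds ht₀'))
  have hsub : Metric.ball t₀ r' ⊆ I₀ := fun t ht => (hball' t ht).2
  exact ⟨e, r', fun i => V (e i), fun i => β (e i), he, hr', hsub.trans hI,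
    fun i => (hform (e i)).mono hsub, fun t ht => (hball' t ht).1⟩

end SymmetryAlgebra

/-! ### Straightening the three fields. -/

theorem deriv_eq_of_eqOn {I₀ : Set ℝ} (hI₀ : IsOpen I₀) {f g : ℝ → ℝ} (h : ∀ t ∈ I₀, f t = g t)
    {t g' : ℝ} (ht : t ∈ I₀) (hg : HasDerivAt g g' t) : deriv f t = g' := by
  have hev : f =ᶠ[nhds t] g := by
    filter_upwards [hI₀.mem_nhds ht] with t' ht' using h t' ht'
  rw [hev.deriv_eq, hg.deriv]

theorem hasDerivAt_of_contDiffOn {I₀ : Set ℝ} (hI₀ : IsOpen I₀) {f : ℝ → ℝ}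
    (hf : ContDiffOn ℝ ∞ f I₀) {t : ℝ} (ht : t ∈ I₀) : HasDerivAt f (deriv f t) t :=
  ((hf.contDiffAt (hI₀.mem_nhds ht)).differentiableAt (by simp)).hasDerivAt

theorem contDiffOn_deriv {I₀ : Set ℝ} (hI₀ : IsOpen I₀) {f : ℝ → ℝ}
    (hf : ContDiffOn ℝ ∞ f I₀) : ContDiffOn ℝ ∞ (deriv f) I₀ := fun _ ht =>
  (contDiffAt_deriv (hf.contDiffAt (hI₀.mem_nhds ht))).contDiffWithinAt

/-- Three symmetries which become `X₁, X₂, X₃` in the variables `t̃ = T(t)`,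
`ũ_s = b(t)^{-1/2} (u_s - Q_s(t))`, where `T' = b⁻¹`, over the open set `I₀` of times: their
coefficients, and the equations for the right-hand sides of the system. -/
structure CanonicalData (S : LatticeSystem) (X : Fin 3 → PointField) (I₀ : Set ℝ) (b T : ℝ → ℝ)
    (Q : Site → ℝ → ℝ) : Prop where
  isOpen : IsOpen I₀
  smooth_b : ContDiffOn ℝ ∞ b I₀
  pos : ∀ t ∈ I₀, 0 < b t
  smooth_T : ContDiffOn ℝ ∞ T I₀
  smooth_Q : ∀ s, ContDiffOn ℝ ∞ (Q s) I₀
  hasDerivAt_T : ∀ t ∈ I₀, HasDerivAt T (b t)⁻¹ t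
  field : ∀ i s, ∀ p ∈ I₀ ×ˢ S.J s, (X i).at s p =
    (b p.1 * ((canonicalField i).at s (T p.1, p.2 - Q s p.1)).1,
      ((canonicalField i).at s (T p.1, p.2 - Q s p.1)).1
          * (deriv b p.1 / 2 * (p.2 - Q s p.1) + b p.1 * deriv (Q s) p.1)
        + ((canonicalField i).at s (T p.1, p.2 - Q s p.1)).2)
  translation : ∀ s, ∀ q ∈ S.Ω s, q.1 ∈ I₀ →
    fderiv ℝ (S.F s) q (b q.1, fun δ =>
        deriv b q.1 / 2 * (q.2 δ - Q (s + δ) q.1) + b q.1 * deriv (Q (s + δ)) q.1) =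
      deriv (deriv (deriv b)) q.1 / 2 * (q.2 origin - Q s q.1)
        + 3 / 2 * deriv b q.1 * (deriv (deriv (Q s)) q.1 - S.F s q)
        + b q.1 * deriv (deriv (deriv (Q s))) q.1
  dilation : ∀ s, ∀ q ∈ S.Ω s, q.1 ∈ I₀ →
    fderiv ℝ (S.F s) q (0, fun δ => (q.2 δ - Q (s + δ) q.1) / 2) =
      (deriv (deriv b) q.1 / b q.1 - 1 / 2 * (deriv b q.1 / b q.1) ^ 2) * (q.2 origin - Q s q.1)
        + 3 / 2 * (deriv (deriv (Q s)) q.1 - S.F s q)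

/-- In canonical form the `∂_t` coefficients of the first two fields have ratio `t̃`, which dictates
`T = b₁ / b₀`; the relation `[X 0, X 1] = X 0` then yields `T' = 1 / b₀`. The combination `X 1 - T X
0` has no `∂_t` part and must become `½ ũ_s ∂_{ũ_s}`. Its `∂_{u_s}` coefficient is `u_s/2 - (T β₀ -
β₁)`, so `Q_s` has to be its zero. The remaining relations express `b₂`, `β₀`, `β₂` by `b₀`, `T`,
`Q`. -/
theorem canonicalData_of_localForm {S : LatticeSystem} {X : Fin 3 → PointField} {I₀ : Set ℝ}
    {b : Fin 3 → ℝ → ℝ} {β : Fin 3 → Site → ℝ → ℝ} (hI₀ : IsOpen I₀) (hI : I₀ ⊆ S.I)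
    (hX : ∀ i, S.IsSymmetry (X i))
    (h : ∀ i, (X i).LocalForm S I₀ (b i) 0 (β i)) (hpos : ∀ t ∈ I₀, 0 < b 0 t)
    (h01 : ∀ s, ∀ p ∈ I₀ ×ˢ S.J s,
      (X 0).at s p = VectorField.lieBracket ℝ ((X 0).at s) ((X 1).at s) p)
    (h02 : ∀ s, ∀ p ∈ I₀ ×ˢ S.J s,
      ((2 : ℝ) • X 1).at s p = VectorField.lieBracket ℝ ((X 0).at s) ((X 2).at s) p)
    (h12 : ∀ s, ∀ p ∈ I₀ ×ˢ S.J s,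
      (X 2).at s p = VectorField.lieBracket ℝ ((X 1).at s) ((X 2).at s) p) :
    CanonicalData S X I₀ (b 0) (fun t => b 1 t / b 0 t)
      (fun s t => 2 * (b 1 t / b 0 t * β 0 s t - β 1 s t)) := by
  have hne : ∀ t ∈ I₀, b 0 t ≠ 0 := fun t ht => (hpos t ht).ne'
  -- the bracket relations
  have r01 := (h 0).lie hI₀ (h 1) (h 0) h01
  have r12 := (h 1).lie hI₀ (h 2) (h 2) h12
  have hd1 : ∀ t ∈ I₀, HasDerivAt (b 1) (deriv (b 1) t) t := fun t ht =>
    hasDerivAt_of_contDiffOn hI₀ (h 1).smooth_b ht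
  have h2form : ((2 : ℝ) • X 1).LocalForm S I₀ (fun t => 2 * b 1 t) 0 (fun s t => 2 * β 1 s t) :=
    ⟨contDiffOn_const.mul (h 1).smooth_b, fun s => contDiffOn_const.mul ((h 1).smooth_β s),
      fun t ht u hu => congrArg (2 * ·) ((h 1).tau t ht u hu), fun s t ht u hu => by
        rw [((hd1 t ht).const_mul 2).deriv]
        refine (congrArg (2 * ·) ((h 1).phi s t ht u hu)).trans ?_
        simp only [Pi.zero_apply]; ring⟩
  have r02 := (h 0).lie hI₀ (h 2) h2form h02
  simp only [Pi.zero_apply, add_zero, true_and] at r01 r02 r12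
  set T : ℝ → ℝ := fun t => b 1 t / b 0 t with hT
  set Q : Site → ℝ → ℝ := fun s t => 2 * (b 1 t / b 0 t * β 0 s t - β 1 s t) with hQ
  have sb := (h 0).smooth_b
  have sT : ContDiffOn ℝ ∞ T I₀ := (h 1).smooth_b.div sb hne
  have sQ : ∀ s, ContDiffOn ℝ ∞ (Q s) I₀ := fun s =>
    contDiffOn_const.mul ((sT.mul ((h 0).smooth_β s)).sub ((h 1).smooth_β s))
  have D : ∀ {f : ℝ → ℝ} {t : ℝ}, ContDiffOn ℝ ∞ f I₀ → t ∈ I₀ → HasDerivAt f (deriv f t) t :=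
    fun hf ht => hasDerivAt_of_contDiffOn hI₀ hf ht
  have sb' := contDiffOn_deriv hI₀ sb
  have sb'' := contDiffOn_deriv hI₀ sb'
  -- the coefficients of `∂_t`
  have b1 : ∀ t ∈ I₀, b 1 t = T t * b 0 t := fun t ht => by
    simp only [hT]; field_simp [hne t ht]
  have β1 : ∀ s, ∀ t ∈ I₀, β 1 s t = T t * β 0 s t - Q s t / 2 := fun s t ht => by
    simp only [hT, hQ]; ring
  have dT' : ∀ t ∈ I₀, HasDerivAt T
      ((deriv (b 1) t * b 0 t - b 1 t * deriv (b 0) t) / b 0 t ^ 2) t := fun t ht =>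
    (hd1 t ht).div (D sb ht) (hne t ht)
  clear_value T Q
  have b1' : ∀ t ∈ I₀, deriv (b 1) t = 1 + T t * deriv (b 0) t := fun t ht => by
    have := (r01 t ht).1
    have h0 := hne t ht
    rw [b1 t ht] at this
    apply mul_left_cancel₀ h0
    linear_combination -this
  have dT : ∀ t ∈ I₀, HasDerivAt T (b 0 t)⁻¹ t := fun t ht => by
    refine (dT' t ht).congr_deriv ?_
    rw [b1' t ht, b1 t ht]
    have h0 := hne t ht
    field_simp
    ring
  have b1'' : ∀ t ∈ I₀, deriv (deriv (b 1)) t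
      = deriv (b 0) t / b 0 t + T t * deriv (deriv (b 0)) t := fun t ht =>
    deriv_eq_of_eqOn hI₀ b1' ht ((((dT t ht).mul (D sb' ht)).const_add 1).congr_deriv (by ring))
  have b1''' : ∀ t ∈ I₀, deriv (deriv (deriv (b 1))) t
      = (2 * deriv (deriv (b 0)) t / b 0 t - (deriv (b 0) t / b 0 t) ^ 2)
        + T t * deriv (deriv (deriv (b 0))) t := fun t ht =>
    deriv_eq_of_eqOn hI₀ b1'' ht ((((D sb' ht).div (D sb ht) (hne t ht)).add
      ((dT t ht).mul (D sb'' ht))).congr_deriv (by have h0 := hne t ht; field_simp; ring))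
  have b2' : ∀ t ∈ I₀, deriv (b 2) t = 2 * T t + T t ^ 2 * deriv (b 0) t ∧
      b 2 t = T t ^ 2 * b 0 t := fun t ht => by
    have e1 := (r02 t ht).1
    have e2 := (r12 t ht).1
    have h0 := hne t ht
    rw [b1' t ht, b1 t ht] at e2
    rw [b1 t ht] at e1
    -- The two relations are linear in `b 2` and its derivative; this combination eliminates the
    -- derivative.
    have e3 : b 2 t = T t ^ 2 * b 0 t := by linear_combination (1 / 2 : ℝ) * e2 - T t / 2 * e1
    refine ⟨mul_left_cancel₀ h0 ?_, e3⟩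
    rw [e3] at e1
    linear_combination -e1
  -- the coefficients of `∂_{u_s}`
  have dβ1 : ∀ s, ∀ t ∈ I₀, deriv (β 1 s) t
      = β 0 s t / b 0 t + T t * deriv (β 0 s) t - deriv (Q s) t / 2 := fun s t ht =>
    deriv_eq_of_eqOn hI₀ (β1 s) ht ((((dT t ht).mul (D ((h 0).smooth_β s) ht)).sub
      ((D (sQ s) ht).div_const 2)).congr_deriv (by ring))
  have β0 : ∀ s, ∀ t ∈ I₀, β 0 s t = b 0 t * deriv (Q s) t - deriv (b 0) t / 2 * Q s t :=
    fun s t ht => by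
      have e := (r01 t ht).2 s
      have h0 := hne t ht
      rw [dβ1 s t ht, b1' t ht, b1 t ht, β1 s t ht] at e
      field_simp at e
      linear_combination (-1 / 2 : ℝ) * e
  have sQ' := fun s => contDiffOn_deriv hI₀ (sQ s)
  have sQ'' := fun s => contDiffOn_deriv hI₀ (sQ' s)
  have dβ0 : ∀ s, ∀ t ∈ I₀, deriv (β 0 s) t = deriv (b 0) t / 2 * deriv (Q s) t
      + b 0 t * deriv (deriv (Q s)) t - deriv (deriv (b 0)) t / 2 * Q s t := fun s t ht =>
    deriv_eq_of_eqOn hI₀ (β0 s) ht ((((D sb ht).mul (D (sQ' s) ht)).sub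
      (((D sb' ht).div_const 2).mul (D (sQ s) ht))).congr_deriv (by ring))
  have ddβ0 : ∀ s, ∀ t ∈ I₀, deriv (deriv (β 0 s)) t = 3 / 2 * deriv (b 0) t * deriv (deriv (Q s)) t
      + b 0 t * deriv (deriv (deriv (Q s))) t - deriv (deriv (deriv (b 0))) t / 2 * Q s t :=
    fun s t ht => deriv_eq_of_eqOn hI₀ (dβ0 s) ht ((((((D sb' ht).div_const 2).mul
      (D (sQ' s) ht)).add ((D sb ht).mul (D (sQ'' s) ht))).sub
      (((D sb'' ht).div_const 2).mul (D (sQ s) ht))).congr_deriv (by ring))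
  have ddβ1 : ∀ s, ∀ t ∈ I₀, deriv (deriv (β 1 s)) t
      = (2 * deriv (β 0 s) t / b 0 t - β 0 s t * deriv (b 0) t / b 0 t ^ 2)
        + T t * deriv (deriv (β 0 s)) t - deriv (deriv (Q s)) t / 2 := fun s t ht =>
    deriv_eq_of_eqOn hI₀ (dβ1 s) ht (((((D ((h 0).smooth_β s) ht).div (D sb ht) (hne t ht)).add
      ((dT t ht).mul (D (contDiffOn_deriv hI₀ ((h 0).smooth_β s)) ht))).sub
      ((D (sQ' s) ht).div_const 2)).congr_deriv (by have h0 := hne t ht; field_simp; ring))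
  have β2 : ∀ s, ∀ t ∈ I₀, β 2 s t = T t ^ 2 * β 0 s t - T t * Q s t := fun s t ht => by
    have e1 := (r02 t ht).2 s
    have e2 := (r12 t ht).2 s
    have h0 := hne t ht
    have e3 : b 0 t * deriv (β 1 s) t
        = β 0 s t + b 0 t * T t * deriv (β 0 s) t - b 0 t * deriv (Q s) t / 2 := by
      rw [dβ1 s t ht]; field_simp
    rw [(b2' t ht).1, (b2' t ht).2, β1 s t ht] at e1 e2
    rw [b1' t ht, b1 t ht] at e2
    linear_combination (2 / 3 : ℝ) * e2 - 2 / 3 * T t * e1 - 2 / 3 * T t ^ 2 * e3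
      - 1 / 3 * T t ^ 2 * β0 s t ht
  refine ⟨hI₀, sb, hpos, sT, sQ, dT, fun i s p hp => ?_, fun s q hq ht => ?_, fun s q hq ht => ?_⟩
  · rw [(h i).at_eq hp]
    have ht := hp.1
    fin_cases i
    · simp [canonicalField, PointField.at, β0 s _ ht]
      ring
    · simp [canonicalField, PointField.at, b1' _ ht, b1 _ ht, β1 s _ ht, β0 s _ ht]
      constructor <;> ring
    · simp [canonicalField, PointField.at, (b2' _ ht).1, (b2' _ ht).2, β2 s _ ht, β0 s _ ht]
      constructor <;> ring
  · have e := (h 0).rhs_equation hI₀ hI (hX 0) hq ht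
    simp only [Pi.zero_apply, add_zero, zero_sub] at e
    rw [ddβ0 s _ ht] at e
    have hw : (fun δ : Stencil => deriv (b 0) q.1 / 2 * (q.2 δ - Q (s + δ) q.1)
        + b 0 q.1 * deriv (Q (s + δ)) q.1)
        = fun δ : Stencil => deriv (b 0) q.1 / 2 * q.2 δ + β 0 (s + δ) q.1 := by
      funext δ; rw [β0 _ _ ht]; ring
    rw [hw, e]
    ring
  · have e0 := (h 0).rhs_equation hI₀ hI (hX 0) hq ht
    have e1 := (h 1).rhs_equation hI₀ hI (hX 1) hq ht
    simp only [Pi.zero_apply, add_zero, zero_sub] at e0 e1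
    -- The derivative of `F` is linear in the direction, so with `T` frozen at this time the
    -- dilation equation is the one for `X 1` minus `T` times the one for `X 0`.
    have hw : ((0, fun δ => (q.2 δ - Q (s + δ) q.1) / 2) : ℝ × (Stencil → ℝ))
        = (b 1 q.1, fun δ : Stencil => deriv (b 1) q.1 / 2 * q.2 δ + β 1 (s + δ) q.1)
          - T q.1 • (b 0 q.1, fun δ : Stencil => deriv (b 0) q.1 / 2 * q.2 δ + β 0 (s + δ) q.1) := by
      ext δ
      · simp [b1 _ ht]
      · simp [b1' _ ht, β1 _ _ ht]; ring
    have h0 := hne _ ht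
    rw [hw, map_sub, map_smul, e0, e1, ddβ1 s _ ht, b1''' _ ht, b1' _ ht, dβ0 s _ ht, ddβ0 s _ ht,
      β0 s _ ht, smul_eq_mul]
    field_simp
    ring

/-! ### The interaction in canonical coordinates. -/

theorem add_origin (s : Site) : s + (origin : ℤ × ℤ) = s := by simp [origin]

/-- `u_s³ F_s` in the canonical variables, expressed by the original ones. -/
def reducedRhs (S : LatticeSystem) (b : ℝ → ℝ) (Q : Site → ℝ → ℝ) (s : Site)
    (q : ℝ × (Stencil → ℝ)) : ℝ :=
  (q.2 origin - Q s q.1) ^ 3 * (S.F s q - deriv (deriv (Q s)) q.1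
    - (deriv (deriv b) q.1 / b q.1 - 1 / 2 * (deriv b q.1 / b q.1) ^ 2) / 2
      * (q.2 origin - Q s q.1))

/-- The point of the original space with time `t` and canonical variables `c ξ_δ`. -/
def scaledPoint (b : ℝ → ℝ) (Q : Site → ℝ → ℝ) (s : Site) (t c : ℝ) (ξ : Stencil → ℝ) :
    ℝ × (Stencil → ℝ) := (t, fun δ => √(b t) * c * ξ δ + Q (s + δ) t)

namespace CanonicalData

variable {S : LatticeSystem} {X : Fin 3 → PointField} {I₀ : Set ℝ} {b T : ℝ → ℝ}
  {Q : Site → ℝ → ℝ}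

theorem hasDerivAt_sqrt (h : CanonicalData S X I₀ b T Q) {t : ℝ} (ht : t ∈ I₀) :
    HasDerivAt (fun t => √(b t)) (deriv b t / (2 * √(b t))) t :=
  (hasDerivAt_of_contDiffOn h.isOpen h.smooth_b ht).sqrt (h.pos t ht).ne'

theorem deriv_T (h : CanonicalData S X I₀ b T Q) {t : ℝ} (ht : t ∈ I₀) : deriv T t = (b t)⁻¹ :=
  (h.hasDerivAt_T t ht).deriv

theorem deriv_deriv_T (h : CanonicalData S X I₀ b T Q) {t : ℝ} (ht : t ∈ I₀) :
    deriv (deriv T) t = -deriv b t / b t ^ 2 :=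
  deriv_eq_of_eqOn h.isOpen (fun _ ht => h.deriv_T ht) ht
    ((hasDerivAt_of_contDiffOn h.isOpen h.smooth_b ht).inv (h.pos t ht).ne')

theorem deriv_deriv_deriv_T (h : CanonicalData S X I₀ b T Q) {t : ℝ} (ht : t ∈ I₀) :
    deriv (deriv (deriv T)) t = -deriv (deriv b) t / b t ^ 2 + 2 * deriv b t ^ 2 / b t ^ 3 := by
  have h0 := (h.pos t ht).ne'
  have hb := hasDerivAt_of_contDiffOn h.isOpen h.smooth_b ht
  have hb' := hasDerivAt_of_contDiffOn h.isOpen (contDiffOn_deriv h.isOpen h.smooth_b) ht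
  exact deriv_eq_of_eqOn h.isOpen (fun _ ht => h.deriv_deriv_T ht) ht
    ((hb'.neg.div (hb.pow 2) (pow_ne_zero 2 h0)).congr_deriv (by
      simp only [Pi.neg_apply, Pi.pow_apply]; field_simp; ring))

/-- The allowed transformation to the canonical variables. -/
def transformation (h : CanonicalData S X I₀ b T Q) (hc : I₀.OrdConnected) :
    AllowedTransformation where
  dom := I₀
  T := T
  P _ := 1
  Q := Q
  isOpen_dom := h.isOpen
  ordConnected_dom := hc
  smooth_T := h.smooth_T
  deriv_T_pos t ht := by rw [h.deriv_T ht]; exact inv_pos.2 (h.pos t ht)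
  P_ne_zero _ := one_ne_zero
  smooth_Q := h.smooth_Q

theorem map_eq (h : CanonicalData S X I₀ b T Q) (hc : I₀.OrdConnected) (s : Site) {p : ℝ × ℝ}
    (hp : p.1 ∈ I₀) :
    (h.transformation hc).map s p = (T p.1, (p.2 - Q s p.1) / √(b p.1)) := by
  simp only [AllowedTransformation.map, transformation, h.deriv_T hp, inv_one, mul_one]
  rw [Real.inv_rpow (h.pos _ hp).le, ← Real.sqrt_eq_rpow, inv_mul_eq_div]

theorem newU_eq (h : CanonicalData S X I₀ b T Q) (hc : I₀.OrdConnected) (s : Site)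
    {q : ℝ × (Stencil → ℝ)} (hq : q.1 ∈ I₀) (δ : Stencil) :
    (h.transformation hc).newU s q δ = (q.2 δ - Q (s + δ) q.1) / √(b q.1) := by
  rw [AllowedTransformation.newU, h.map_eq hc _ (p := (q.1, q.2 δ)) hq]

/-- The `∂_u` coefficients of the canonical fields are linear in `u`, so the scaling by `1/√b`,
absent from `CanonicalData.field`, passes through them; its derivative cancels the term `b'/2 (u_s -
Q_s)`. -/
theorem fderiv_map (h : CanonicalData S X I₀ b T Q) (hc : I₀.OrdConnected) (i : Fin 3) (s : Site)
    {p : ℝ × ℝ} (hp : p ∈ I₀ ×ˢ S.J s) :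
    fderiv ℝ ((h.transformation hc).map s) p ((X i).at s p)
      = (canonicalField i).at s ((h.transformation hc).map s p) := by
  have hev : (h.transformation hc).map s =ᶠ[nhds p]
      fun p => (T p.1, (p.2 - Q s p.1) / √(b p.1)) := by
    filter_upwards [(h.isOpen.preimage continuous_fst).mem_nhds hp.1] with p hp
      using h.map_eq hc s hp
  have hfst : HasFDerivAt (Prod.fst : ℝ × ℝ → ℝ) (ContinuousLinearMap.fst ℝ ℝ ℝ) p :=
    hasFDerivAt_fst
  have hsnd : HasFDerivAt (Prod.snd : ℝ × ℝ → ℝ) (ContinuousLinearMap.snd ℝ ℝ ℝ) p :=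
    hasFDerivAt_snd
  have hr : 0 < √(b p.1) := Real.sqrt_pos.2 (h.pos _ hp.1)
  have hr2 : b p.1 = √(b p.1) ^ 2 := (Real.sq_sqrt (h.pos _ hp.1).le).symm
  have h1 := (h.hasDerivAt_T _ hp.1).comp_hasFDerivAt p hfst
  have h2 := (hasDerivAt_of_contDiffOn h.isOpen (h.smooth_Q s) hp.1).comp_hasFDerivAt p hfst
  have h3 := ((h.hasDerivAt_sqrt hp.1).inv hr.ne').comp_hasFDerivAt p hfst
  have h4 : HasFDerivAt (fun p : ℝ × ℝ => (T p.1, (p.2 - Q s p.1) / √(b p.1))) _ p :=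
    (h1.prodMk ((hsnd.sub h2).mul h3)).congr_of_eventuallyEq
      (Filter.Eventually.of_forall fun p => by simp [div_eq_mul_inv])
  rw [hev.fderiv_eq, h4.fderiv, h.field i s p hp, h.map_eq hc s hp.1]
  generalize hy : p.2 - Q s p.1 = y
  generalize √(b p.1) = r at *
  fin_cases i <;> simp [canonicalField, PointField.at, hr2, hy, Real.sqrt_sq hr.le] <;> (try constructor) <;>
    field_simp <;> ring

/-- With `T' = 1/b` the Schwarzian derivative of `T` is `-(b''/b - (b'/b)²/2)`, which is the linear
correction in `reducedRhs`; multiplication by `ũ_s³` removes all powers of `√b`. -/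
theorem newF_eq (h : CanonicalData S X I₀ b T Q) (hc : I₀.OrdConnected) (s : Site)
    {q : ℝ × (Stencil → ℝ)} (hq : q.1 ∈ I₀) (hne : (h.transformation hc).newU s q origin ≠ 0) :
    (h.transformation hc).newF S s q
      = ((h.transformation hc).newU s q origin ^ 3)⁻¹ * reducedRhs S b Q s q := by
  have hb := h.pos _ hq
  have hr : 0 < √(b q.1) := Real.sqrt_pos.2 hb
  have hr2 : b q.1 = √(b q.1) ^ 2 := (Real.sq_sqrt hb.le).symm
  have hpow : ((b q.1)⁻¹) ^ (-(3 / 2) : ℝ) = √(b q.1) ^ 3 := by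
    rw [Real.inv_rpow hb.le, Real.rpow_neg hb.le, inv_inv, Real.sqrt_eq_rpow, ← Real.rpow_natCast,
      ← Real.rpow_mul hb.le]
    norm_num
  have e1 : deriv (h.transformation hc).T q.1 = (b q.1)⁻¹ := h.deriv_T hq
  have e2 : iteratedDeriv 2 (h.transformation hc).T q.1 = -deriv b q.1 / b q.1 ^ 2 := by
    rw [iteratedDeriv_succ, iteratedDeriv_one]; exact h.deriv_deriv_T hq
  have e3 : iteratedDeriv 3 (h.transformation hc).T q.1
      = -deriv (deriv b) q.1 / b q.1 ^ 2 + 2 * deriv b q.1 ^ 2 / b q.1 ^ 3 := by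
    rw [iteratedDeriv_succ, iteratedDeriv_succ, iteratedDeriv_one]; exact h.deriv_deriv_deriv_T hq
  have e4 : iteratedDeriv 2 ((h.transformation hc).Q s) q.1 = deriv (deriv (Q s)) q.1 := by
    rw [iteratedDeriv_succ, iteratedDeriv_one]; rfl
  have e5 : (h.transformation hc).P s = 1 := rfl
  rw [h.newU_eq hc s hq, add_origin] at hne ⊢
  rw [AllowedTransformation.newF, e1, e2, e3, e4, e5, hpow, h.newU_eq hc s hq, add_origin,
    reducedRhs]
  generalize q.2 origin - Q s q.1 = y at *
  have hy : y ≠ 0 := fun h0 => hne (by rw [h0, zero_div])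
  generalize √(b q.1) = r at *
  rw [hr2]
  have hr0 := hr.ne'
  have hz : ((r ^ 2)⁻¹) ^ (-3 : ℤ) = r ^ 6 := by
    rw [zpow_neg, inv_zpow, inv_inv, ← zpow_natCast, ← zpow_mul]; norm_cast
  rw [hz]
  field_simp
  ring

/-- Along curves with constant ratios of the canonical variables `u_s³ F_s` is constant. -/
theorem hasDerivAt_reducedRhs (h : CanonicalData S X I₀ b T Q) {s : Site} {ξ : Stencil → ℝ}
    (hξ : ξ origin = 1) {τ c : ℝ → ℝ} {a d σ : ℝ} (hτ : HasDerivAt τ a σ) (hc : HasDerivAt c d σ)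
    (hI : τ σ ∈ I₀) (hc0 : c σ ≠ 0) (hΩ : scaledPoint b Q s (τ σ) (c σ) ξ ∈ S.Ω s) :
    HasDerivAt (fun σ => reducedRhs S b Q s (scaledPoint b Q s (τ σ) (c σ) ξ)) 0 σ := by
  have hb := h.pos _ hI
  have hr : 0 < √(b (τ σ)) := Real.sqrt_pos.2 hb
  have hr2 : b (τ σ) = √(b (τ σ)) ^ 2 := (Real.sq_sqrt hb.le).symm
  have D : ∀ {f : ℝ → ℝ}, ContDiffOn ℝ ∞ f I₀ → HasDerivAt (fun σ => f (τ σ)) (deriv f (τ σ) * a) σ :=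
    fun hf => (hasDerivAt_of_contDiffOn h.isOpen hf hI).comp σ hτ
  have dr : HasDerivAt (fun σ => √(b (τ σ))) (deriv b (τ σ) / (2 * √(b (τ σ))) * a) σ :=
    (h.hasDerivAt_sqrt hI).comp σ hτ
  have sb' := contDiffOn_deriv h.isOpen h.smooth_b
  have sQ' := contDiffOn_deriv h.isOpen (h.smooth_Q s)
  set q := scaledPoint b Q s (τ σ) (c σ) ξ with hq
  have hq1 : q.1 = τ σ := rfl
  have hq2 : ∀ δ : Stencil, q.2 δ = √(b (τ σ)) * c σ * ξ δ + Q (s + δ) (τ σ) := fun δ => rfl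
  -- the derivative of the curve
  have dγ : HasDerivAt (fun σ => scaledPoint b Q s (τ σ) (c σ) ξ)
      ((a / b (τ σ)) • (b q.1, fun δ : Stencil => deriv b q.1 / 2 * (q.2 δ - Q (s + δ) q.1)
          + b q.1 * deriv (Q (s + δ)) q.1)
        + (2 * d / c σ) • (0, fun δ : Stencil => (q.2 δ - Q (s + δ) q.1) / 2)) σ := by
    have h1 : HasDerivAt (fun σ => fun δ : Stencil => √(b (τ σ)) * c σ * ξ δ + Q (s + δ) (τ σ))
        (fun δ => (deriv b (τ σ) / (2 * √(b (τ σ))) * a * c σ + √(b (τ σ)) * d) * ξ δ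
          + deriv (Q (s + δ)) (τ σ) * a) σ :=
      hasDerivAt_pi.2 fun δ => ((dr.mul hc).mul_const (ξ δ)).add (D (h.smooth_Q (s + δ)))
    refine (hτ.prodMk h1).congr_deriv ?_
    ext δ
    · simp [hq1, hb.ne']
    · simp only [hq1, hq2, Prod.snd_add, Prod.smul_snd, Pi.add_apply, Pi.smul_apply, smul_eq_mul]
      generalize √(b (τ σ)) = r at *
      rw [hr2]
      have hr0 := hr.ne'
      field_simp
      ring
  have dF := ((LatticeSystem.contDiffAt_F hΩ).differentiableAt (by simp)).hasFDerivAt.comp_hasDerivAt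
    σ dγ
  -- The tangent of the curve is a combination of the translation and dilation directions, so both
  -- invariance equations together give the derivative of `F` along it.
  rw [map_add, map_smul, map_smul, h.translation s q hΩ hI, h.dilation s q hΩ hI] at dF
  have dy : HasDerivAt (fun σ => √(b (τ σ)) * c σ)
      (deriv b (τ σ) / (2 * √(b (τ σ))) * a * c σ + √(b (τ σ)) * d) σ := dr.mul hc
  have dκ := ((D (contDiffOn_deriv h.isOpen sb')).div (D h.smooth_b) hb.ne').sub
    ((((D sb').div (D h.smooth_b) hb.ne').pow 2).const_mul (1 / 2))
  have dG := (dy.pow 3).mul ((dF.sub (D (contDiffOn_deriv h.isOpen sQ'))).sub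
    ((dκ.div_const 2).mul dy))
  refine (dG.congr_of_eventuallyEq (Filter.Eventually.of_forall fun σ => ?_)).congr_deriv ?_
  · simp [reducedRhs, scaledPoint, hξ, add_origin]
  · have hqo : q.2 origin - Q s (τ σ) = √(b (τ σ)) * c σ := by
      rw [hq2, hξ, add_origin]; ring
    simp only [hq1, hqo, Pi.sub_apply, Pi.div_apply, Pi.pow_apply, Function.comp_apply, ← hq,
      smul_eq_mul, Pi.mul_apply, Nat.reduceSub, pow_one, Nat.cast_ofNat]
    generalize √(b (τ σ)) = r at *
    generalize S.F s q = F at *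
    rw [hr2]
    have hr0 := hr.ne'
    field_simp
    ring

end CanonicalData

/-- The family of ratios `u_δ / u_s`, including the trivial one. -/
def extendOne (η : Neighbour → ℝ) (δ : Stencil) : ℝ :=
  if h : δ = origin then 1 else η ⟨δ, h⟩

theorem extendOne_origin (η : Neighbour → ℝ) : extendOne η origin = 1 := by simp [extendOne]

theorem contDiff_extendOne : ContDiff ℝ ∞ extendOne := by
  refine contDiff_pi.2 fun δ => ?_
  by_cases h : δ = origin
  · simpa [extendOne, h] using contDiff_const
  · simpa [extendOne, h] using contDiff_apply ℝ ℝ _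

theorem extendOne_ratios {u : Stencil → ℝ} (hu : u origin ≠ 0) :
    extendOne (ratios u) = fun δ => u δ / u origin := by
  funext δ
  by_cases h : δ = origin
  · subst h; rw [extendOne_origin, div_self hu]
  · simp [extendOne, ratios, h]

namespace CanonicalData

variable {S : LatticeSystem} {X : Fin 3 → PointField} {I₀ : Set ℝ} {b T : ℝ → ℝ}
  {Q : Site → ℝ → ℝ}

/-- Time, scale `ũ_s` and ratios are coordinates wherever `ũ_s ≠ 0`, with inverse `scaledPoint`. -/
theorem scaledPoint_self (h : CanonicalData S X I₀ b T Q) (hc : I₀.OrdConnected) (s : Site)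
    {q : ℝ × (Stencil → ℝ)} (hq : q.1 ∈ I₀) (hne : (h.transformation hc).newU s q origin ≠ 0) :
    scaledPoint b Q s q.1 ((h.transformation hc).newU s q origin)
      (extendOne (ratios ((h.transformation hc).newU s q))) = q := by
  have hr : √(b q.1) ≠ 0 := (Real.sqrt_pos.2 (h.pos _ hq)).ne'
  rw [extendOne_ratios hne]
  refine Prod.ext rfl (funext fun δ => ?_)
  simp only [scaledPoint]
  rw [mul_assoc, mul_div_cancel₀ _ hne, h.newU_eq hc s hq, mul_div_cancel₀ _ hr, sub_add_cancel]

theorem continuousAt_newU (h : CanonicalData S X I₀ b T Q) (hc : I₀.OrdConnected) (s : Site)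
    {q : ℝ × (Stencil → ℝ)} (hq : q.1 ∈ I₀) :
    ContinuousAt ((h.transformation hc).newU s) q := by
  have hr : √(b q.1) ≠ 0 := (Real.sqrt_pos.2 (h.pos _ hq)).ne'
  refine continuousAt_pi.2 fun δ => ?_
  have hev : (fun q => (h.transformation hc).newU s q δ)
      =ᶠ[nhds q] fun q => (q.2 δ - Q (s + δ) q.1) / √(b q.1) := by
    filter_upwards [(h.isOpen.preimage continuous_fst).mem_nhds hq] with q hq
      using h.newU_eq hc s hq δ
  have c1 : ContinuousAt (fun q : ℝ × (Stencil → ℝ) => Q (s + δ) q.1) q :=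
    ContinuousAt.comp (f := Prod.fst)
      (((h.smooth_Q (s + δ)).contDiffAt (h.isOpen.mem_nhds hq)).continuousAt) continuousAt_fst
  have c2 : ContinuousAt (fun q : ℝ × (Stencil → ℝ) => b q.1) q :=
    ContinuousAt.comp (f := Prod.fst)
      ((h.smooth_b.contDiffAt (h.isOpen.mem_nhds hq)).continuousAt) continuousAt_fst
  have c3 : ContinuousAt (fun q : ℝ × (Stencil → ℝ) => q.2 δ) q := by fun_prop
  exact ((c3.sub c1).div c2.sqrt hr).congr hev.symm

theorem continuousAt_scaledPoint (h : CanonicalData S X I₀ b T Q) (s : Site)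
    {z : ℝ × ℝ × (Stencil → ℝ)} (hz : z.1 ∈ I₀) :
    ContinuousAt (fun z : ℝ × ℝ × (Stencil → ℝ) => scaledPoint b Q s z.1 z.2.1 z.2.2) z := by
  refine continuousAt_fst.prodMk (continuousAt_pi.2 fun δ => ?_)
  have c1 : ContinuousAt (fun z : ℝ × ℝ × (Stencil → ℝ) => Q (s + δ) z.1) z :=
    ContinuousAt.comp (f := Prod.fst)
      (((h.smooth_Q (s + δ)).contDiffAt (h.isOpen.mem_nhds hz)).continuousAt) continuousAt_fst
  have c2 : ContinuousAt (fun z : ℝ × ℝ × (Stencil → ℝ) => b z.1) z :=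
    ContinuousAt.comp (f := Prod.fst)
      ((h.smooth_b.contDiffAt (h.isOpen.mem_nhds hz)).continuousAt) continuousAt_fst
  have c3 : ContinuousAt (fun z : ℝ × ℝ × (Stencil → ℝ) => z.2.2 δ) z := by fun_prop
  have c4 : ContinuousAt (fun z : ℝ × ℝ × (Stencil → ℝ) => z.2.1) z := by fun_prop
  exact ((c2.sqrt.mul c4).mul c3).add c1

/-- Locally `u_s³ F_s`, in the canonical variables, depends on the ratios of these only. -/
theorem eventually_reducedRhs_eq (h : CanonicalData S X I₀ b T Q) (hc : I₀.OrdConnected) {s : Site}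
    {q₀ : ℝ × (Stencil → ℝ)} (hq₀ : q₀ ∈ S.Ω s) (hI : q₀.1 ∈ I₀)
    (hne : (h.transformation hc).newU s q₀ origin ≠ 0) :
    ∀ᶠ q in nhds q₀, q.1 ∈ I₀ ∧ (h.transformation hc).newU s q origin ≠ 0 ∧
      reducedRhs S b Q s q = reducedRhs S b Q s (scaledPoint b Q s q₀.1
        ((h.transformation hc).newU s q₀ origin)
        (extendOne (ratios ((h.transformation hc).newU s q)))) := by
  set N := (h.transformation hc).newU s with hN
  set Z : ℝ × (Stencil → ℝ) → ℝ × ℝ × (Stencil → ℝ) :=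
    fun q => (q.1, N q origin, extendOne (ratios (N q))) with hZ
  have cN : ContinuousAt N q₀ := h.continuousAt_newU hc s hI
  have cNδ : ∀ δ, ContinuousAt (fun q => N q δ) q₀ := fun δ => continuousAt_pi.1 cN δ
  have hev : ∀ᶠ q in nhds q₀, q.1 ∈ I₀ ∧ N q origin ≠ 0 :=
    Filter.Eventually.and ((h.isOpen.preimage continuous_fst).mem_nhds hI) ((cNδ origin).eventually_ne hne)
  have cZ : ContinuousAt Z q₀ := by
    refine continuousAt_fst.prodMk ((cNδ origin).prodMk ?_)
    refine (contDiff_extendOne.continuous.continuousAt).comp (continuousAt_pi.2 fun δ => ?_)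
    exact (cNδ δ).div (cNδ origin) hne
  have hmem : ∀ᶠ z in nhds (Z q₀), z.1 ∈ I₀ ∧ z.2.1 ≠ 0 ∧
      scaledPoint b Q s z.1 z.2.1 z.2.2 ∈ S.Ω s := by
    refine Filter.Eventually.and ((h.isOpen.preimage continuous_fst).mem_nhds hI)
      (Filter.Eventually.and ?_ ?_)
    · have c1 : ContinuousAt (fun z : ℝ × ℝ × (Stencil → ℝ) => z.2.1) (Z q₀) := by fun_prop
      exact c1.eventually_ne hne
    · refine (h.continuousAt_scaledPoint s (z := Z q₀) hI).eventually_mem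
        ((S.isOpen_Ω s).mem_nhds ?_)
      show scaledPoint b Q s q₀.1 (N q₀ origin) (extendOne (ratios (N q₀))) ∈ S.Ω s
      rwa [hN, h.scaledPoint_self hc s hI hne]
  obtain ⟨ε, hε, hball⟩ := Metric.eventually_nhds_iff_ball.1 hmem
  filter_upwards [hev, cZ.eventually_mem (Metric.ball_mem_nhds _ hε)] with q hq hZq
  refine ⟨hq.1, hq.2, ?_⟩
  set ξ := extendOne (ratios (N q)) with hξ
  -- The segment moves time and scale from those of `q` to those of `q₀` with the ratios of `q`
  -- fixed. It stays in the ball because a ball of the product is a product of convex balls.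
  have hpath : ∀ σ ∈ Set.Icc (0 : ℝ) 1,
      HasDerivAt (fun σ => reducedRhs S b Q s (scaledPoint b Q s (q.1 + σ * (q₀.1 - q.1))
        (N q origin + σ * (N q₀ origin - N q origin)) ξ)) 0 σ := by
    intro σ hσ
    have hm : (q.1 + σ * (q₀.1 - q.1), N q origin + σ * (N q₀ origin - N q origin), ξ)
        ∈ Metric.ball (Z q₀) ε := by
      rw [hZ] at hZq ⊢
      simp only [← ball_prod_same, Set.mem_prod] at hZq ⊢
      exact ⟨(convex_ball _ _).add_smul_sub_mem hZq.1 (Metric.mem_ball_self hε) hσ,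
        (convex_ball _ _).add_smul_sub_mem hZq.2.1 (Metric.mem_ball_self hε) hσ, hZq.2.2⟩
    obtain ⟨m1, m2, m3⟩ := hball _ hm
    have lin : ∀ x y : ℝ, HasDerivAt (fun σ => x + σ * y) y σ := fun x y => by
      simpa using ((hasDerivAt_id σ).mul_const y).const_add x
    exact h.hasDerivAt_reducedRhs (extendOne_origin _) (lin _ _) (lin _ _) m1 m2 m3
  have hconst := constant_of_has_deriv_right_zero
    (fun σ hσ => (hpath σ hσ).continuousAt.continuousWithinAt)
    (fun σ hσ => (hpath σ ⟨hσ.1, hσ.2.le⟩).hasDerivWithinAt) 1 (Set.right_mem_Icc.2 zero_le_one)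
  simp only [one_mul, add_sub_cancel, zero_mul, add_zero] at hconst
  rw [hconst, hξ, hN, h.scaledPoint_self hc s hq.1 hq.2]

/-- The function `f` is `reducedRhs` on the slice where time and scale are frozen at their values at
`q₀`, and `W` is the part of this slice inside `Ω_s`. -/
theorem exists_canonical_rhs (h : CanonicalData S X I₀ b T Q) (hc : I₀.OrdConnected) {s : Site}
    {q₀ : ℝ × (Stencil → ℝ)} (hq₀ : q₀ ∈ S.Ω s) (hI : q₀.1 ∈ I₀)
    (hne : (h.transformation hc).newU s q₀ origin ≠ 0) :
    ∃ (f : (Neighbour → ℝ) → ℝ) (W : Set (Neighbour → ℝ)),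
      IsOpen W ∧ ratios ((h.transformation hc).newU s q₀) ∈ W ∧ ContDiffOn ℝ ∞ f W ∧
      ∀ᶠ q in nhds q₀, (h.transformation hc).newF S s q
        = ((h.transformation hc).newU s q origin ^ 3)⁻¹
          * f (ratios ((h.transformation hc).newU s q)) := by
  set Φ : (Neighbour → ℝ) → ℝ × (Stencil → ℝ) := fun η => scaledPoint b Q s q₀.1
    ((h.transformation hc).newU s q₀ origin) (extendOne η) with hΦ
  have sΦ : ContDiff ℝ ∞ Φ := by
    refine contDiff_const.prodMk (contDiff_pi.2 fun δ => ?_)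
    exact (contDiff_const.mul (contDiff_pi.1 contDiff_extendOne δ)).add contDiff_const
  refine ⟨fun η => reducedRhs S b Q s (Φ η), Φ ⁻¹' S.Ω s,
    (S.isOpen_Ω s).preimage sΦ.continuous, ?_, ?_, ?_⟩
  · show Φ _ ∈ S.Ω s
    simpa only [hΦ, h.scaledPoint_self hc s hI hne] using hq₀
  · have sF : ContDiffOn ℝ ∞ (fun η => S.F s (Φ η)) (Φ ⁻¹' S.Ω s) :=
      (S.smooth_F s).comp sΦ.contDiffOn (fun _ h => h)
    have sy : ContDiff ℝ ∞ (fun η => (Φ η).2 origin - Q s q₀.1) :=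
      (contDiff_pi.1 (contDiff_snd.comp sΦ) origin).sub contDiff_const
    exact (sy.pow 3).contDiffOn.mul
      ((sF.sub (contDiffOn_const (c := deriv (deriv (Q s)) q₀.1))).sub
        (ContDiff.mul (contDiff_const (c := (deriv (deriv b) q₀.1 / b q₀.1
          - 1 / 2 * (deriv b q₀.1 / b q₀.1) ^ 2) / 2)) sy).contDiffOn)
  · filter_upwards [h.eventually_reducedRhs_eq hc hq₀ hI hne] with q hq
    rw [h.newF_eq hc s hq.1 hq.2.1, hq.2.2]

end CanonicalData

/-- Simple symmetry algebras are `sl(2, ℝ)`, in canonical form up to allowed transformations. -/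
theorem LatticeSystem.IsSymmetryAlgebra.canonicalForm {S : LatticeSystem} {𝔤 : Type*} [LieRing 𝔤]
    [LieAlgebra ℝ 𝔤] [FiniteDimensional ℝ 𝔤] [LieAlgebra.IsSimple ℝ 𝔤] {ρ : 𝔤 →ₗ[ℝ] PointField}
    (hρ : S.IsSymmetryAlgebra ρ) {t₀ : ℝ} (ht₀ : S.CoupledAt t₀) :
    ∃ (A : AllowedTransformation) (e : Module.Basis (Fin 3) ℝ 𝔤),
      t₀ ∈ A.dom ∧ A.dom ⊆ S.I ∧ HasCanonicalBrackets e ∧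
      (∀ (i : Fin 3) (s : Site), ∀ p ∈ A.dom ×ˢ S.J s,
        fderiv ℝ (A.map s) p ((ρ (e i)).at s p) = (canonicalField i).at s (A.map s p)) ∧
      (∀ (s : Site), ∀ q₀ ∈ S.Ω s, q₀.1 ∈ A.dom → A.newU s q₀ origin ≠ 0 →
        ∃ (f : (Neighbour → ℝ) → ℝ) (W : Set (Neighbour → ℝ)),
          IsOpen W ∧ ratios (A.newU s q₀) ∈ W ∧ ContDiffOn ℝ ∞ f W ∧
          ∀ᶠ q in nhds q₀,
            A.newF S s q = (A.newU s q origin ^ 3)⁻¹ * f (ratios (A.newU s q))) := by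
  obtain ⟨e, r, b, β, he, hr, hI, hform, hpos⟩ := hρ.exists_basis ht₀
  have hlie : ∀ x y, ∀ s, ∀ p ∈ Metric.ball t₀ r ×ˢ S.J s,
      (ρ ⁅x, y⁆).at s p = VectorField.lieBracket ℝ ((ρ x).at s) ((ρ y).at s) p :=
    fun x y s p hp => hρ.map_lie x y s p ⟨hI hp.1, hp.2⟩
  have hcd := canonicalData_of_localForm (X := fun i => ρ (e i)) Metric.isOpen_ball hI
    (fun i => hρ.isSymmetry _) hform hpos
    (fun s p hp => by rw [← hlie _ _ s p hp, he.1])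
    (fun s p hp => by rw [← hlie _ _ s p hp, he.2.1, map_smul])
    (fun s p hp => by rw [← hlie _ _ s p hp, he.2.2])
  have hord : (Metric.ball t₀ r).OrdConnected := (convex_ball t₀ r).ordConnected
  exact ⟨hcd.transformation hord, e, Metric.mem_ball_self hr, hI, he,
    fun i s p hp => hcd.fderiv_map hord i s hp,
    fun s q₀ hq₀ hqI hne => hcd.exists_canonical_rhs hord hq₀ hqI hne⟩

/-- The combination `c₁ X₁ + c₂ X₂ + c₃ X₃` of the canonical fields. -/
theorem sum_canonicalField_at (c : Fin 3 → ℝ) (s : Site) (p : ℝ × ℝ) :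
    ∑ i, c i • (canonicalField i).at s p
      = (c 0 + c 1 * p.1 + c 2 * p.1 ^ 2, (c 1 / 2 + c 2 * p.1) * p.2) := by
  simp [Fin.sum_univ_three, canonicalField, PointField.at]
  ring

/-- `c₀ + c₁ t + c₂ t²` -/
def quadratic (c : Fin 3 → ℝ) (t : ℝ) : ℝ := c 0 + c 1 * t + c 2 * t ^ 2

theorem deriv_quadratic (c : Fin 3 → ℝ) : deriv (quadratic c) = fun t => c 1 + 2 * c 2 * t := by
  funext t
  have h : HasDerivAt (fun t => c 0 + c 1 * t + c 2 * t ^ 2) (c 1 * 1 + c 2 * (2 * t)) t := by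
    exact ((((hasDerivAt_id t).const_mul (c 1)).const_add (c 0)).add
      ((hasDerivAt_pow 2 t).const_mul (c 2))).congr_deriv (by simp)
  rw [show quadratic c = fun t => c 0 + c 1 * t + c 2 * t ^ 2 from rfl, h.deriv]
  ring

theorem deriv_deriv_quadratic (c : Fin 3 → ℝ) :
    deriv (deriv (quadratic c)) = fun _ => 2 * c 2 := by
  funext t
  rw [deriv_quadratic]
  simp

section CanonicalInteraction

variable {S : LatticeSystem}

theorem localForm_of_canonical {X : PointField} {c : Fin 3 → ℝ}
    (hX : ∀ s, ∀ p ∈ S.I ×ˢ S.J s, X.at s p = ∑ i, c i • (canonicalField i).at s p) :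
    X.LocalForm S S.I (quadratic c) 0 0 := by
  refine ⟨?_, fun s => contDiffOn_const, fun t ht u hu => ?_, fun s t ht u hu => ?_⟩
  · exact ((contDiff_const.add (contDiff_const.mul contDiff_id)).add
      (contDiff_const.mul (contDiff_id.pow 2))).contDiffOn
  · obtain ⟨s, hs⟩ := Set.mem_iUnion.1 hu
    have := congrArg Prod.fst (hX s (t, u) ⟨ht, hs⟩)
    rwa [sum_canonicalField_at] at this
  · have := congrArg Prod.snd (hX s (t, u) ⟨ht, hu⟩)
    rw [sum_canonicalField_at] at this
    refine this.trans ?_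
    rw [deriv_quadratic]
    simp only [Pi.zero_apply]
    ring

/-- A canonical interaction does not depend on time and is homogeneous of degree `-3`. -/
theorem fderiv_canonical {s : Site} {f : (Neighbour → ℝ) → ℝ}
    (hF : ∀ q ∈ S.Ω s, q.2 origin ≠ 0 ∧ S.F s q = (q.2 origin ^ 3)⁻¹ * f (ratios q.2))
    {q : ℝ × (Stencil → ℝ)} (hq : q ∈ S.Ω s) :
    fderiv ℝ (S.F s) q (1, 0) = 0 ∧ fderiv ℝ (S.F s) q (0, q.2) = -3 * S.F s q := by
  have hd := ((LatticeSystem.contDiffAt_F hq).differentiableAt (by simp)).hasFDerivAt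
  constructor
  · have hl : HasDerivAt (fun t : ℝ => (t, q.2)) (1, 0) q.1 :=
      (hasDerivAt_id _).prodMk (hasDerivAt_const _ _)
    have h1 : HasDerivAt (fun t : ℝ => S.F s (t, q.2)) _ q.1 := hd.comp_hasDerivAt q.1 hl
    refine h1.unique ((hasDerivAt_const q.1 (S.F s q)).congr_of_eventuallyEq ?_)
    filter_upwards [hl.continuousAt.eventually_mem ((S.isOpen_Ω s).mem_nhds hq)] with t ht
    rw [(hF _ ht).2, (hF _ hq).2]
  · have hl : HasDerivAt (fun l : ℝ => (q.1, l • q.2)) (0, q.2) 1 := by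
      refine (hasDerivAt_const _ _).prodMk ?_
      simpa using (hasDerivAt_id (1 : ℝ)).smul_const q.2
    have hd' : HasFDerivAt (S.F s) (fderiv ℝ (S.F s) q) ((fun l : ℝ => (q.1, l • q.2)) 1) := by
      simpa using hd
    have h1 : HasDerivAt (fun l : ℝ => S.F s (q.1, l • q.2)) _ 1 := hd'.comp_hasDerivAt 1 hl
    have h2 : HasDerivAt (fun l : ℝ => (l ^ 3)⁻¹ * S.F s q) (-3 * S.F s q) 1 := by
      simpa using (((hasDerivAt_pow 3 (1 : ℝ)).inv (by norm_num)).mul_const (S.F s q))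
    refine h1.unique (h2.congr_of_eventuallyEq ?_)
    have hm : ∀ᶠ l : ℝ in nhds 1, (q.1, l • q.2) ∈ S.Ω s :=
      hl.continuousAt.eventually_mem ((S.isOpen_Ω s).mem_nhds (by simpa using hq))
    filter_upwards [hm, eventually_ne_nhds (one_ne_zero (α := ℝ))] with l hl hl0
    rw [(hF _ hl).2, (hF _ hq).2]
    have hr : ratios (l • q.2) = ratios q.2 := by
      funext δ
      simp only [ratios, Pi.smul_apply, smul_eq_mul]
      exact mul_div_mul_left _ _ hl0
    simp only [hr, Pi.smul_apply, smul_eq_mul, mul_pow, mul_inv]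
    ring

/-- Combinations of the canonical fields are symmetries of canonical interactions. -/
theorem isSymmetry_of_canonical {f : Site → (Neighbour → ℝ) → ℝ}
    (hF : ∀ s, ∀ q ∈ S.Ω s, q.2 origin ≠ 0 ∧ S.F s q = (q.2 origin ^ 3)⁻¹ * f s (ratios q.2))
    {X : PointField} (hX : X.IsSmoothOn S) {c : Fin 3 → ℝ}
    (hc : ∀ s, ∀ p ∈ S.I ×ˢ S.J s, X.at s p = ∑ i, c i • (canonicalField i).at s p) :
    S.IsSymmetry X := by
  refine ⟨hX, fun s q hq v w hw => ?_⟩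
  have hw : w = S.F s q := sub_eq_zero.1 hw
  rw [(localForm_of_canonical hc).prolongationDelta_eq S.isOpen_I subset_rfl hX hq
    (S.mem_box s q hq).1, hw]
  obtain ⟨h1, h2⟩ := fderiv_canonical (hF s) hq
  -- The direction is `b ∂_t` plus `b'/2` times the Euler field. Time independence kills the first
  -- part, degree -3 matches the term `-(3/2) b' F`, and `b''' = 0` removes the rest.
  have hv : ((quadratic c q.1, fun δ => (deriv (quadratic c) q.1 / 2 + (0 : Site → ℝ) (s + δ))
      * q.2 δ + (0 : Site → ℝ → ℝ) (s + δ) q.1) : ℝ × (Stencil → ℝ))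
      = quadratic c q.1 • (1, 0) + (deriv (quadratic c) q.1 / 2) • (0, q.2) := by
    ext δ <;> simp
  rw [hv, map_add, map_smul, map_smul, h1, h2, deriv_deriv_quadratic]
  simp
  ring

/-- The canonical realization of `sl(2, ℝ)` by vector fields. -/
def canonicalRealization : SL2 →ₗ[ℝ] PointField where
  toFun x := ∑ i, sl2Coord x i • canonicalField i
  map_add' x y := by simp only [map_add, Pi.add_apply, add_smul, Finset.sum_add_distrib]
  map_smul' r x := by
    simp only [map_smul, Pi.smul_apply, smul_eq_mul, mul_smul, Finset.smul_sum, RingHom.id_apply]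

theorem canonicalRealization_at (x : SL2) (s : Site) (p : ℝ × ℝ) :
    (canonicalRealization x).at s p = ∑ i, sl2Coord x i • (canonicalField i).at s p := by
  simp only [canonicalRealization, LinearMap.coe_mk, AddHom.coe_mk, Fin.sum_univ_three]
  rfl

theorem canonicalRealization_isSmoothOn (x : SL2) : (canonicalRealization x).IsSmoothOn S := by
  have h : ∀ s, ContDiff ℝ ∞ ((canonicalRealization x).at s) := fun s => by
    have : (canonicalRealization x).at s = _ :=
      funext fun p => (canonicalRealization_at x s p).trans (sum_canonicalField_at _ s p)
    rw [this]
    fun_prop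
  exact ⟨(contDiff_fst.comp (h (0, 0))).contDiffOn, fun s => (contDiff_snd.comp (h s)).contDiffOn⟩

theorem canonicalRealization_isSymmetryAlgebra {f : Site → (Neighbour → ℝ) → ℝ}
    (hF : ∀ s, ∀ q ∈ S.Ω s, q.2 origin ≠ 0 ∧ S.F s q = (q.2 origin ^ 3)⁻¹ * f s (ratios q.2)) :
    S.IsSymmetryAlgebra canonicalRealization := by
  have hloc : ∀ x, (canonicalRealization x).LocalForm S S.I (quadratic (sl2Coord x)) 0 0 :=
    fun x => localForm_of_canonical fun s p _ => canonicalRealization_at x s p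
  refine ⟨fun x => isSymmetry_of_canonical hF (canonicalRealization_isSmoothOn x)
    fun s p _ => canonicalRealization_at x s p, fun x y s p hp => ?_, fun x hx => ?_⟩
  · rw [VectorField.lieBracket_eq]
    simp only
    rw [(hloc x).at_eq hp, (hloc y).at_eq hp, (hloc _).at_eq hp, (hloc x).fderiv_at S.isOpen_I hp,
      (hloc y).fderiv_at S.isOpen_I hp, sl2Coord_lie]
    simp only [deriv_quadratic, quadratic, Pi.zero_apply]
    ext <;> simp <;> ring
  -- Faithfulness: the `∂_t` coefficient is a quadratic polynomial that vanishes on an open set, so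
  -- its value and first two derivatives at one point give zero coefficients.
  · have h0 : ∀ t ∈ S.I, quadratic (sl2Coord x) t = 0 := fun t ht => by
      obtain ⟨u, hu⟩ := S.nonempty_J (0, 0)
      have := hx (0, 0) (t, u) ⟨ht, hu⟩
      rw [(hloc x).at_eq (p := (t, u)) ⟨ht, hu⟩] at this
      exact congrArg Prod.fst this
    have hder : ∀ g : ℝ → ℝ, (∀ t ∈ S.I, g t = 0) → ∀ t ∈ S.I, deriv g t = 0 := fun g hg t ht => by
      have : g =ᶠ[nhds t] fun _ => 0 := by
        filter_upwards [S.isOpen_I.mem_nhds ht] with t' ht' using hg t' ht'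
      rw [this.deriv_eq, deriv_const]
    obtain ⟨t, ht⟩ := S.nonempty_I
    have e0 := h0 t ht
    have e1 := hder _ h0 t ht
    have e2 := hder _ (hder _ h0) t ht
    rw [deriv_deriv_quadratic] at e2
    rw [deriv_quadratic] at e1
    simp only [quadratic] at e0
    have c2 : sl2Coord x 2 = 0 := by linarith
    have c1 : sl2Coord x 1 = 0 := by rw [c2] at e1; linarith
    have c0 : sl2Coord x 0 = 0 := by rw [c2, c1] at e0; linarith
    apply sl2Coord.injective
    ext i
    fin_cases i <;> simp [c0, c1, c2]

theorem canonicalRealization_sl2Basis (i : Fin 3) :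
    canonicalRealization (sl2Basis i) = canonicalField i := by
  have hb : sl2Coord (sl2Basis i) = Pi.single i 1 := by simp [sl2Basis]
  simp only [canonicalRealization, LinearMap.coe_mk, AddHom.coe_mk, hb, Pi.single_apply, ite_smul,
    one_smul, zero_smul, Finset.sum_ite_eq', Finset.mem_univ, if_true]

end CanonicalInteraction

/-! ### An isotropic system without further symmetries. -/

theorem exists_eq_quadratic {b : ℝ → ℝ} (hb : ContDiff ℝ ∞ b)
    (h : ∀ t, deriv (deriv (deriv b)) t = 0) : ∃ c, b = quadratic c := by
  have h0 := fun t => (hb.contDiffAt (x := t).differentiableAt (by simp)).hasDerivAt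
  have h1 := fun t => ((contDiffAt_deriv (hb.contDiffAt (x := t))).differentiableAt
    (by simp)).hasDerivAt
  have h2 := fun t => ((contDiffAt_deriv (contDiffAt_deriv (hb.contDiffAt (x := t)))).differentiableAt
    (by simp)).hasDerivAt
  have const : ∀ g : ℝ → ℝ, (∀ t, HasDerivAt g 0 t) → ∀ t, g t = g 0 := fun g hg t =>
    eq_of_hasDerivAt_zero isOpen_univ isPreconnected_univ (fun t _ => hg t) trivial trivial
  have k2 := const (deriv (deriv b)) fun t => (h2 t).congr_deriv (h t)
  have k1 := const (fun t => deriv b t - deriv (deriv b) 0 * t) fun t =>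
    ((h1 t).sub ((hasDerivAt_id t).const_mul _)).congr_deriv (by rw [k2 t]; ring)
  have k0 := const (fun t => b t - deriv b 0 * t - deriv (deriv b) 0 / 2 * t ^ 2) fun t =>
    (((h0 t).sub ((hasDerivAt_id t).const_mul _)).sub ((hasDerivAt_pow 2 t).const_mul _)).congr_deriv
      (by push_cast; linear_combination k1 t)
  refine ⟨![b 0, deriv b 0, deriv (deriv b) 0 / 2], funext fun t => ?_⟩
  simp only [quadratic, Matrix.cons_val]
  linear_combination k0 t

/-- The right-hand side `u_s⁻⁴ ∑ u_{s+δ}`, the sum being over the nearest neighbours. -/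
def isotropicRhs (q : ℝ × (Stencil → ℝ)) : ℝ := (q.2 origin ^ 4)⁻¹ * ∑ η : Neighbour, q.2 η

theorem isotropicRhs_eq (q : ℝ × (Stencil → ℝ)) :
    isotropicRhs q = (q.2 origin ^ 3)⁻¹ * ∑ η : Neighbour, ratios q.2 η := by
  simp only [isotropicRhs, ratios, ← Finset.sum_div, pow_succ _ 3, mul_inv]
  ring

theorem contDiffAt_isotropicRhs {q : ℝ × (Stencil → ℝ)} (hq : q.2 origin ≠ 0) :
    ContDiffAt ℝ ∞ isotropicRhs q := by
  have h : ∀ δ, ContDiffAt ℝ ∞ (fun q : ℝ × (Stencil → ℝ) => q.2 δ) q := fun δ => by fun_prop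
  exact (((h origin).pow 4).inv (pow_ne_zero 4 hq)).mul (ContDiffAt.sum fun η _ => h η)

theorem fderiv_isotropicRhs {q : ℝ × (Stencil → ℝ)} (hq : q.2 origin ≠ 0) (a : ℝ)
    (w : Stencil → ℝ) :
    fderiv ℝ isotropicRhs q (a, w) = (q.2 origin ^ 4)⁻¹ * ∑ η : Neighbour, w η
      - 4 * (q.2 origin ^ 5)⁻¹ * w origin * ∑ η : Neighbour, q.2 η := by
  have hl : HasDerivAt (fun r : ℝ => q + r • (a, w)) (a, w) 0 := by
    simpa using ((hasDerivAt_id (0 : ℝ)).smul_const (a, w)).const_add q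
  have hu : ∀ δ, HasDerivAt (fun r : ℝ => q.2 δ + r * w δ) (w δ) 0 := fun δ => by
    simpa using ((hasDerivAt_id (0 : ℝ)).mul_const (w δ)).const_add (q.2 δ)
  have hd : HasFDerivAt isotropicRhs (fderiv ℝ isotropicRhs q)
      ((fun r : ℝ => q + r • (a, w)) 0) := by
    simpa using ((contDiffAt_isotropicRhs hq).differentiableAt (by simp)).hasFDerivAt
  have h1 : HasDerivAt (fun r : ℝ => isotropicRhs (q + r • (a, w))) _ 0 :=
    HasFDerivAt.comp_hasDerivAt (l := isotropicRhs) 0 hd hl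
  have h2 : HasDerivAt (fun r : ℝ => isotropicRhs (q + r • (a, w))) _ 0 :=
    (((hu origin).pow 4).inv (by simpa using hq)).mul
      (HasDerivAt.fun_sum fun (η : Neighbour) _ => hu η)
  rw [h1.unique h2]
  simp only [zero_mul, add_zero]
  simp
  field_simp
  ring

theorem partialU_isotropicRhs_neighbour {q : ℝ × (Stencil → ℝ)} (hq : q.2 origin ≠ 0)
    (η : Neighbour) : partialU η isotropicRhs q = (q.2 origin ^ 4)⁻¹ := by
  rw [partialU, fderiv_isotropicRhs hq, Pi.single_eq_of_ne η.2.symm]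
  have : ∑ ζ : Neighbour, (Pi.single (η : Stencil) (1 : ℝ) : Stencil → ℝ) ζ = 1 := by
    simp [Pi.single_apply, Subtype.coe_inj]
  rw [this]
  ring

theorem partialU_isotropicRhs_origin {q : ℝ × (Stencil → ℝ)} (hq : q.2 origin ≠ 0) :
    partialU origin isotropicRhs q = -4 * (q.2 origin ^ 5)⁻¹ * ∑ η : Neighbour, q.2 η := by
  have : ∑ ζ : Neighbour, (Pi.single origin (1 : ℝ) : Stencil → ℝ) ζ = 0 :=
    Finset.sum_eq_zero fun ζ _ => Pi.single_eq_of_ne ζ.2 _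
  rw [partialU, fderiv_isotropicRhs hq, Pi.single_eq_same, this]
  ring

/-- The system `ü_s = u_s⁻⁴ ∑ u_{s+δ}` on positive functions. -/
def isotropicSystem : LatticeSystem where
  I := Set.univ
  J _ := Set.Ioi 0
  Ω _ := {q | ∀ δ, 0 < q.2 δ}
  F _ := isotropicRhs
  isOpen_I := isOpen_univ
  ordConnected_I := Set.ordConnected_univ
  nonempty_I := Set.univ_nonempty
  isOpen_J _ := isOpen_Ioi
  ordConnected_J _ := Set.ordConnected_Ioi
  nonempty_J _ := Set.nonempty_Ioi
  ordConnected_iUnion_J := by simpa [Set.iUnion_const] using Set.ordConnected_Ioi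
  isOpen_Ω _ := by
    simp only [Set.ofPred_forall]
    exact isOpen_iInter_of_finite fun δ => isOpen_lt (by fun_prop) (by fun_prop)
  mem_box _ _ hq := ⟨trivial, hq⟩
  dense_proj _ p hp := subset_closure ⟨(p.1, fun _ => p.2), fun _ => hp.2, rfl⟩
  smooth_F _ _ hq := (contDiffAt_isotropicRhs (hq origin).ne').contDiffWithinAt

theorem isotropicSystem_F (s : Site) (q : ℝ × (Stencil → ℝ)) (hq : q ∈ isotropicSystem.Ω s) :
    q.2 origin ≠ 0 ∧ isotropicSystem.F s q =
      (q.2 origin ^ 3)⁻¹ * (fun ξ => ∑ η : Neighbour, ξ η) (ratios q.2) :=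
  ⟨(hq origin).ne', isotropicRhs_eq q⟩

instance : Nonempty Neighbour := ⟨⟨⟨(1, 0), by simp [stencil]⟩, by simp [origin, Subtype.ext_iff]⟩⟩

theorem isotropicSystem_coupledAt (t : ℝ) : isotropicSystem.CoupledAt t := by
  refine ⟨(0, 0), Classical.arbitrary _, fun _ => 1, fun _ => one_pos, ?_⟩
  rw [show isotropicSystem.F (0, 0) = isotropicRhs from rfl, partialU_isotropicRhs_neighbour]
  all_goals norm_num

theorem isotropicSystem_isNonlinearCoupled : isotropicSystem.IsNonlinearCoupled := by
  have hone : ∀ s, ((0, fun _ => 1) : ℝ × (Stencil → ℝ)) ∈ isotropicSystem.Ω s :=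
    fun s δ => one_pos
  refine ⟨fun s => ⟨origin, (Classical.arbitrary Neighbour : Neighbour), _, hone s, ?_⟩,
    fun s δ => ⟨_, hone s, ?_⟩⟩
  · have hev : partialU (Classical.arbitrary Neighbour : Neighbour) (isotropicSystem.F s)
        =ᶠ[nhds (0, fun _ => 1)] fun q => (q.2 origin ^ 4)⁻¹ := by
      filter_upwards [(isotropicSystem.isOpen_Ω s).mem_nhds (hone s)] with q hq
      exact partialU_isotropicRhs_neighbour (hq origin).ne' _
    have hd : HasFDerivAt (fun q : ℝ × (Stencil → ℝ) => (q.2 origin ^ 4)⁻¹) _ (0, fun _ => 1) :=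
      HasDerivAt.comp_hasFDerivAt (h₂ := fun x : ℝ => (x ^ 4)⁻¹) (0, fun _ => 1)
        ((hasDerivAt_pow 4 (1 : ℝ)).inv (by norm_num))
        (((ContinuousLinearMap.proj origin).comp
          (ContinuousLinearMap.snd ℝ ℝ (Stencil → ℝ))).hasFDerivAt)
    rw [partialU, hev.fderiv_eq, hd.fderiv]
    simp
  · rw [show isotropicSystem.F s = isotropicRhs from rfl]
    by_cases hδ : δ = origin
    · subst hδ
      rw [partialU_isotropicRhs_origin (by simp)]
      have : 0 < ∑ η : Neighbour, (1 : ℝ) :=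
        Finset.sum_pos (fun _ _ => one_pos) Finset.univ_nonempty
      simpa using this.ne'
    · rw [partialU_isotropicRhs_neighbour (by simp) ⟨δ, hδ⟩]
      simp

/-- The interaction is coupled at every time, so a symmetry has its local form globally in time,
with constants `A` not yet known to vanish, as no simple algebra is given. Linearity of `F` in the
neighbours lets the single equation for `F` be split into coefficients. -/
theorem isotropicSystem_isSymmetry_iff (X : PointField) : isotropicSystem.IsSymmetry X ↔
    X.IsSmoothOn isotropicSystem ∧ ∃ c : Fin 3 → ℝ, ∀ s, ∀ p ∈ isotropicSystem.I ×ˢ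
      isotropicSystem.J s, X.at s p = ∑ i, c i • (canonicalField i).at s p := by
  refine ⟨fun hX => ⟨hX.1, ?_⟩, fun ⟨hX, c, hc⟩ =>
    isSymmetry_of_canonical (f := fun _ ξ => ∑ η, ξ η) isotropicSystem_F hX hc⟩
  obtain ⟨A, β, hloc⟩ := hX.exists_localForm isOpen_univ isPreconnected_univ subset_rfl
    (fun t _ => isotropicSystem_coupledAt t) (u₀ := 1) (Set.mem_iUnion.2 ⟨(0, 0), Set.mem_Ioi.2 one_pos⟩)
  set b : ℝ → ℝ := fun t => X.1 (t, 1)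
  -- the determining equation is affine in the variables of the neighbours
  have key : ∀ s t, ∀ x > 0, ∀ y : Neighbour → ℝ, (∀ η, 0 < y η) →
      ∑ η : Neighbour, ((A (s + η) - 5 * A s) * x - 4 * β s t) * y η
        = x ^ 6 * deriv (deriv (deriv b)) t / 2 + x ^ 5 * deriv (deriv (β s)) t
          - x * ∑ η : Neighbour, β (s + η) t := by
    intro s t x hx y hy
    set u : Stencil → ℝ := fun δ => if h : δ = origin then x else y ⟨δ, h⟩ with hu
    have huo : u origin = x := by simp [hu]
    have hun : ∀ η : Neighbour, u η = y η := fun η => by simp [hu, η.2]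
    have hq : ((t, u) : ℝ × (Stencil → ℝ)) ∈ isotropicSystem.Ω s := fun δ => by
      by_cases h : δ = origin
      · simpa [h, huo] using hx
      · simpa [hun ⟨δ, h⟩] using hy ⟨δ, h⟩
    have e := hloc.rhs_equation isOpen_univ subset_rfl hX hq trivial
    rw [show isotropicSystem.F s = isotropicRhs from rfl, fderiv_isotropicRhs (hq origin).ne',
      isotropicRhs] at e
    have ho : s + (origin : ℤ × ℤ) = s := add_zero s
    simp only [huo, hun, ho, Finset.sum_add_distrib, add_mul, ← Finset.mul_sum] at e
    have hx0 : x ≠ 0 := ne_of_gt hx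
    field_simp at e
    simp only [sub_mul, Finset.sum_sub_distrib, mul_assoc, ← Finset.mul_sum]
    have e' : ∑ η : Neighbour, A (s + η) * (x * y η) = x * ∑ η : Neighbour, A (s + η) * y η := by
      rw [Finset.mul_sum]
      exact Finset.sum_congr rfl fun _ _ => by ring
    rw [e']
    linarith
  -- Comparing the neighbour values `1` everywhere with those where the value at `η` is raised to
  -- `2` isolates the coefficient of `y η`.
  have hcoef : ∀ s t, ∀ η : Neighbour, ∀ x > 0, (A (s + η) - 5 * A s) * x - 4 * β s t = 0 := by
    intro s t η x hx
    have h1 := key s t x hx (fun _ => 1) fun _ => one_pos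
    have h2 := key s t x hx (fun ζ => 1 + if ζ = η then 1 else 0) fun ζ => by positivity
    rw [← h1] at h2
    simpa [mul_add, Finset.sum_add_distrib] using h2
  have hAβ : ∀ s t, ∀ η : Neighbour, A (s + η) - 5 * A s = 0 ∧ -(4 * β s t) = 0 := fun s t η =>
    affine_eq_zero_of_isOpen isOpen_Ioi Set.nonempty_Ioi fun x hx => by
      linarith [hcoef s t η x hx]
  have hβ : ∀ s, β s = fun _ => 0 := fun s => funext fun t => by
    linarith [(hAβ s t (Classical.arbitrary _)).2]
  -- One step along the lattice multiplies `A` by 5, in either direction; going there and back gives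
  -- `A s = 25 A s`.
  have hA : ∀ s, A s = 0 := fun s => by
    have h1 := (hAβ s 0 ⟨⟨(1, 0), by simp [stencil]⟩, by simp [origin, Subtype.ext_iff]⟩).1
    have h2 := (hAβ (s + (1, 0)) 0 ⟨⟨(-1, 0), by simp [stencil]⟩, by simp [origin, Subtype.ext_iff]⟩).1
    have h3 : s + (1, 0) + (-1, 0) = s := by simp [add_assoc]
    simp only [h3] at h1 h2
    linarith
  have hb : ∀ t, deriv (deriv (deriv b)) t = 0 := fun t => by
    have := key (0, 0) t 1 one_pos (fun _ => 1) fun _ => one_pos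
    simp only [hA, hβ] at this
    simpa using this.symm
  obtain ⟨c, hc⟩ := exists_eq_quadratic (contDiffOn_univ.1 hloc.smooth_b) hb
  refine ⟨c, fun s p hp => ?_⟩
  rw [hloc.at_eq hp, sum_canonicalField_at, hA, hβ, hc, deriv_quadratic]
  ext <;> simp [quadratic]
  ring_nf
  simp

end TriLattice

end

theorem mainTheorem4 :
    -- `sl(2, ℝ)` is a simple Lie algebra
    LieAlgebra.IsSimple ℝ TriLattice.SL2 ∧
    -- every simple Lie algebra of symmetries is `sl(2, ℝ)`, in canonical form up to allowed
    -- transformations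
    (∀ (S : TriLattice.LatticeSystem), S.IsNonlinearCoupled →
      ∀ (𝔤 : Type*) [LieRing 𝔤] [LieAlgebra ℝ 𝔤] [FiniteDimensional ℝ 𝔤]
        [LieAlgebra.IsSimple ℝ 𝔤] (ρ : 𝔤 →ₗ[ℝ] TriLattice.PointField),
      S.IsSymmetryAlgebra ρ →
        Nonempty (𝔤 ≃ₗ⁅ℝ⁆ TriLattice.SL2) ∧
        ∀ t₀ : ℝ, S.CoupledAt t₀ →
          ∃ (A : TriLattice.AllowedTransformation) (e : Module.Basis (Fin 3) ℝ 𝔤),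
            t₀ ∈ A.dom ∧ A.dom ⊆ S.I ∧
            TriLattice.HasCanonicalBrackets e ∧
            (∀ (i : Fin 3) (s : TriLattice.Site), ∀ p ∈ A.dom ×ˢ S.J s,
              fderiv ℝ (A.map s) p ((ρ (e i)).at s p)
                = (TriLattice.canonicalField i).at s (A.map s p)) ∧
            (∀ (s : TriLattice.Site), ∀ q₀ ∈ S.Ω s, q₀.1 ∈ A.dom →
              A.newU s q₀ TriLattice.origin ≠ 0 →
              ∃ (f : (TriLattice.Neighbour → ℝ) → ℝ) (W : Set (TriLattice.Neighbour → ℝ)),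
                IsOpen W ∧ TriLattice.ratios (A.newU s q₀) ∈ W ∧ ContDiffOn ℝ ∞ f W ∧
                ∀ᶠ q in nhds q₀,
                  A.newF S s q = (A.newU s q TriLattice.origin ^ 3)⁻¹
                    * f (TriLattice.ratios (A.newU s q)))) ∧
    -- the canonical fields form a symmetry algebra `sl(2, ℝ)` for each canonical interaction
    (∀ (S : TriLattice.LatticeSystem) (f : TriLattice.Site → (TriLattice.Neighbour → ℝ) → ℝ),
      (∀ s, ∀ q ∈ S.Ω s, q.2 TriLattice.origin ≠ 0 ∧
        S.F s q = (q.2 TriLattice.origin ^ 3)⁻¹ * f s (TriLattice.ratios q.2)) →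
      ∃ (e : Module.Basis (Fin 3) ℝ TriLattice.SL2)
        (ρ : TriLattice.SL2 →ₗ[ℝ] TriLattice.PointField),
        S.IsSymmetryAlgebra ρ ∧ TriLattice.HasCanonicalBrackets e ∧
        ∀ i, ρ (e i) = TriLattice.canonicalField i) ∧
    -- for some nonlinear, coupled, homogeneous and isotropic canonical interaction there are no
    -- further symmetries
    (∃ (S : TriLattice.LatticeSystem) (f : (TriLattice.Neighbour → ℝ) → ℝ),
      S.I = Set.univ ∧ (∀ s, S.J s = Set.Ioi 0) ∧
      (∀ s, S.Ω s = {q | ∀ δ, 0 < q.2 δ}) ∧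
      S.IsNonlinearCoupled ∧
      ContDiffOn ℝ ∞ f {ξ | ∀ δ, 0 < ξ δ} ∧
      (∀ (π : Equiv.Perm TriLattice.Neighbour) (ξ : TriLattice.Neighbour → ℝ),
        f (fun δ => ξ (π δ)) = f ξ) ∧
      (∀ s, ∀ q ∈ S.Ω s,
        S.F s q = (q.2 TriLattice.origin ^ 3)⁻¹ * f (TriLattice.ratios q.2)) ∧
      ∀ X : TriLattice.PointField, S.IsSymmetry X ↔
        X.IsSmoothOn S ∧ ∃ c : Fin 3 → ℝ, ∀ s, ∀ p ∈ S.I ×ˢ S.J s,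
          X.at s p = ∑ i, c i • (TriLattice.canonicalField i).at s p) := by
  refine ⟨TriLattice.sl2Basis_hasCanonicalBrackets.isSimple TriLattice.sl2Basis, ?_, ?_, ?_⟩
  · intro S hS 𝔤 _ _ _ _ ρ hρ
    refine ⟨?_, fun t₀ ht₀ => hρ.canonicalForm ht₀⟩
    -- The isomorphism type needs the canonical basis at just one coupled time.
    obtain ⟨t, ht⟩ := hS.exists_coupledAt
    obtain ⟨-, e, -, -, he, -⟩ := hρ.canonicalForm ht
    exact ⟨TriLattice.HasCanonicalBrackets.equiv e he TriLattice.sl2Basis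
      TriLattice.sl2Basis_hasCanonicalBrackets⟩
  · exact fun S f hF => ⟨TriLattice.sl2Basis, TriLattice.canonicalRealization,
      TriLattice.canonicalRealization_isSymmetryAlgebra hF,
      TriLattice.sl2Basis_hasCanonicalBrackets, TriLattice.canonicalRealization_sl2Basis⟩
  · exact ⟨TriLattice.isotropicSystem, fun ξ => ∑ η, ξ η, rfl, fun _ => rfl, fun _ => rfl,
      TriLattice.isotropicSystem_isNonlinearCoupled,
      (ContDiff.sum fun η _ => contDiff_apply ℝ ℝ η).contDiffOn,
      fun π ξ => Equiv.sum_comp π ξ,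
      fun s q hq => (TriLattice.isotropicSystem_F s q hq).2,
      TriLattice.isotropicSystem_isSymmetry_iff⟩
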